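/- Let $W_1,W_2,\dots$ be i.i.d. random variables with $0<W_i<1$ almost surely, let $T_i:=(1-W_1)\cdots(1-W_i)$ (with $T_0=1$), and let $P_i:=T_{i-1}W_i$, $i\ge 1$, be the residual allocation model with factors $W_i$. Given $P=(P_1,P_2,\dots)$, let $X_1,X_2,\dots$ be i.i.d. with distribution $P$ on $\mathbb N_+=\{1,2,\dots\}$, and let $\Pi=(\Pi_1,\Pi_2,\dots)$ be the sequence of distinct values of $(X_j)$ in order of appearance (the $P$-biased permutation of $\mathbb N_+$). A permutation $\pi$ of $\mathbb N_+$ splits at $n\ge 0$ if it maps $[n]=\{1,\dots,n\}$ onto itself, i.e. if $n=0$ or $[n]$ is a block of $\pi$; then $\pi^n_i:=\pi_{n+i}-n$ is the residual permutation, and a permutation of $\mathbb Z$ splits at $z$ if it maps $(-\infty,z]$ onto itself. Let $R_n:=1(\Pi\text{ splits at }n)$, let $Y_1\in\{1,2,\dots\}\cup\{\infty\}$ be the first splitting time $\ge 1$ of $\Pi$, and let $\mu:=\mathbb E(Y_1)$; call $\Pi$ positive recurrent if $\mu<\infty$. Then: (i) $\Pi$ is almost surely a permutation of $\mathbb N_+$,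 and it is strictly regenerative with zero delay: its splitting times $0=T'_0<T'_1<\cdots$ form a (possibly terminating) renewal process with i.i.d. spacings in $\{1,2,\dots\}\cup\{\infty\}$, and for every $n\ge1$ with $\mathbb P(R_n=1)>0$, conditionally given $R_n=1$, the pair $(\Pi^n,(R_{n+k})_{k\ge1})$ is distributed as $(\Pi,(R_k)_{k\ge1})$ and is independent of $(R_0,\dots,R_n)$. For all $n$, $$u_n:=\mathbb P([n]\text{ is a block of }\Pi)=\int_0^\infty e^{-x}\,\mathbb E\prod_{i=1}^n\Bigl(1-\exp\Bigl(-\frac{xW_i}{T_i}\Bigr)\Bigr)\,dx .$$ If $\sum_{i\ge2}\mathbb E\exp(-xW_i/T_i)<\infty$ for some $x>0$, then $\Pi$ is positive recurrent. (ii) If $W_i=1-q$ for all $i$, for some constant $0<q<1$ (so that $P$ is the geometric$(1-q)$ distribution), then $\Pi$ is positive recurrent; almost surely all its blocks between consecutive splitting times are finite; for each $j\ge1$ the number $C_{n,j}$ of cycles of $\Pi$ of length $j$ contained in $[n]$ satisfies $C_{n,j}/n\to\nu_j/\mu$ almost surely, where $\nu_j$ is the expected number of cycles of length $j$ of $\Pi$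 contained in $[Y_1]$, and $\mu=\sum_j j\nu_j$; and $\Pi$ has a stationary version $\Pi^*$ on $\mathbb Z$: a random permutation of $\mathbb Z$ whose displacements $(\Pi^*_z-z)_{z\in\mathbb Z}$ form a stationary process, whose splitting times are almost surely unbounded above and below, which splits at each $z$ with probability $1/\mu$, and such that, given that it splits at $z$, the permutation $(\Pi^*_{z+i}-z)_{i\ge1}$ has the law of $\Pi$ and is independent of the splitting times up to $z$. (iii) If the $W_i$ have the beta$(1,\theta)$ distribution for some $\theta>0$ (so that $P$ is GEM$(\theta)$), all the conclusions of (ii) hold. -/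

import Mathlib

open MeasureTheory ProbabilityTheory Filter Topology
open scoped ENNReal

/-! The positive integers `1, 2, 3, …` are relabelled `0, 1, 2, …` (`i` stands for the positive
integer `i + 1`), so that `[n]` is `{i | i < n}`, the `n`-th residual permutation is
`i ↦ π (n + i) - n`, and `W i`, `P i` stand for `W_{i+1}`, `P_{i+1}`.
The same relabelling is used on `ℤ`. -/

namespace RegenPerm

noncomputable section

/-! ### Splitting times, residual permutations, cycles -/

/-- The permutation `π` splits at `n`: it maps `[n]` to itself and the complement of `[n]`
to itself, that is, `[n]` is a block of `π`. Every `π` splits at `0`. -/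
def SplitsAt (π : ℕ → ℕ) (n : ℕ) : Prop := ∀ i, π i < n ↔ i < n

/-- The set of splitting times (with `0` included). -/
def splitSet (π : ℕ → ℕ) : Set ℕ := {n | SplitsAt π n}

/-- The residual permutation after a splitting time `n`. -/
def residual (n : ℕ) (π : ℕ → ℕ) : ℕ → ℕ := fun i => π (n + i) - n

/-- The first strictly positive splitting time, i.e. the length of the first component
(`⊤` if there is none). -/
def firstSplit (π : ℕ → ℕ) : ℕ∞ := ⨅ (n : ℕ) (_ : 0 < n ∧ SplitsAt π n), (n : ℕ∞)

/-- The number of cycles of length `j` of `π` that are wholly contained in `[n]` (for `1 ≤ j`). -/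
def cycleCount (π : ℕ → ℕ) (n j : ℕ) : ℕ :=
  {C : Set ℕ | C ⊆ Set.Iio n ∧
    ∃ i, Function.minimalPeriod π i = j ∧ C = Set.range (fun k : ℕ => π^[k] i)}.ncard

/-- The permutation `σ` of `ℤ` splits at `z`, i.e. it maps `(-∞, z)` onto itself (in the labelling
above, a cut immediately to the left of the position `z`). -/
def SplitsAtInt (σ : ℤ → ℤ) (z : ℤ) : Prop := ∀ i, σ i < z ↔ i < z

/-- The one-sided permutation to the right of a cut at `z`. -/
def residualInt (z : ℤ) (σ : ℤ → ℤ) : ℕ → ℕ := fun i => (σ (z + i) - z).toNat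

/-! ### Renewal processes and regenerative permutations -/

/-- The set of finite renewal times `T_k = t + y_1 + ⋯ + y_k`, `k ≥ 0`. -/
def renewalTimes (t : ℕ) (y : ℕ → ℕ∞) : Set ℕ :=
  {n | ∃ k : ℕ, (n : ℕ∞) = (t : ℕ∞) + ∑ i ∈ Finset.range k, y i}

/-- The law of the random set of renewal times of a delayed renewal process: the delay `T_0` has
law `ν`, the spacings are i.i.d. with law `ρ` on `{1, 2, …} ∪ {∞}`, and `T_0` and the spacings are
independent. -/
def renewalLaw (ν : Measure ℕ) (ρ : Measure ℕ∞) : Measure (Set ℕ) :=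
  (ν.prod (Measure.infinitePi (fun _ : ℕ => ρ))).map (fun x => renewalTimes x.1 x.2)

variable {Ω : Type*} [MeasurableSpace Ω]

/-- The random permutation `Pi` is regenerative with respect to a possibly delayed renewal process,
given through its random set `R` of renewal times. `Q` is the joint law of the random
permutation and the renewal set with zero delay that reappear after each renewal. -/
structure IsRegenerative (Pi : Ω → ℕ → ℕ) (R : Ω → Set ℕ) (μ : Measure Ω)
    (Q : Measure ((ℕ → ℕ) × Set ℕ)) : Prop where
  measurable_perm : Measurable Pi
  measurable_renewals : Measurable R
  bijective : ∀ᵐ ω ∂μ, Function.Bijective (Pi ω)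
  bijective_ref : ∀ᵐ x ∂Q, Function.Bijective x.1
  /-- `R` is a renewal set, and that of `Q` is the corresponding one with zero delay. -/
  renewal : ∃ (ν : Measure ℕ) (ρ : Measure ℕ∞), IsProbabilityMeasure ν ∧
    IsProbabilityMeasure ρ ∧ ρ {0} = 0 ∧ μ.map R = renewalLaw ν ρ ∧
    Q.map Prod.snd = renewalLaw (Measure.dirac 0) ρ
  /-- Every renewal time is a splitting time. -/
  splits : ∀ᵐ ω ∂μ, ∀ n ∈ R ω, SplitsAt (Pi ω) n
  /-- Given a renewal at `n`, the residual permutation with the residual renewals has law `Q`. -/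
  residual_law : ∀ n : ℕ, 0 < n → μ {ω | n ∈ R ω} ≠ 0 →
    (μ[|{ω | n ∈ R ω}]).map (fun ω => (residual n (Pi ω), {k : ℕ | n + k ∈ R ω})) = Q
  /-- Given a renewal at `n`, the renewals up to time `n` are independent of the residual
  permutation with the residual renewals. -/
  residual_indep : ∀ n : ℕ, 0 < n → μ {ω | n ∈ R ω} ≠ 0 →
    IndepFun (fun ω => R ω ∩ Set.Iic n)
      (fun ω => (residual n (Pi ω), {k : ℕ | n + k ∈ R ω})) (μ[|{ω | n ∈ R ω}])

/-- Strictly regenerative with zero delay: `Pi` is regenerative with respect to its own splitting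
times `0 = T_0 < T_1 < ⋯`, and what follows a splitting time is a copy of `Pi` itself. -/
def IsStrictlyRegenerative (Pi : Ω → ℕ → ℕ) (μ : Measure Ω) : Prop :=
  IsRegenerative Pi (fun ω => splitSet (Pi ω)) μ (μ.map (fun ω => (Pi ω, splitSet (Pi ω))))

/-- The mean length of the first component. -/
def meanBlock (Pi : Ω → ℕ → ℕ) (μ : Measure Ω) : ℝ≥0∞ :=
  ∫⁻ ω, ((firstSplit (Pi ω) : ℕ∞) : ℝ≥0∞) ∂μ

/-- Positive recurrence of a strictly regenerative permutation with zero delay: the component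
lengths have finite mean. -/
def IsPositiveRecurrent (Pi : Ω → ℕ → ℕ) (μ : Measure Ω) : Prop := meanBlock Pi μ < ∞

/-- The expected number of cycles of length `j` in the first (hence in a generic) component. -/
def meanCycles (Pi : Ω → ℕ → ℕ) (μ : Measure Ω) (j : ℕ) : ℝ≥0∞ :=
  ∫⁻ ω, (cycleCount (Pi ω) (firstSplit (Pi ω)).toNat j : ℝ≥0∞) ∂μ

/-- The cycle counts have the limit frequencies `ν_j / m`, where `m` is the mean component length
and `ν_j` the mean number of cycles of length `j` in a component; moreover `∑ j, j ν_j = m`. -/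
def HasCycleFrequencies (Pi : Ω → ℕ → ℕ) (μ : Measure Ω) : Prop :=
  (∀ j : ℕ, 1 ≤ j → ∀ᵐ ω ∂μ,
    Tendsto (fun n : ℕ => (cycleCount (Pi ω) n j : ℝ) / n) atTop
      (𝓝 ((meanCycles Pi μ j).toReal / (meanBlock Pi μ).toReal))) ∧
  ∑' j : ℕ, (j : ℝ≥0∞) * meanCycles Pi μ j = meanBlock Pi μ

/-- `Q` is the law of a stationary version on `ℤ` of the strictly regenerative permutation `Pi`:
a random permutation of `ℤ` with stationary displacements that splits at arbitrarily small and
large times, splits at each fixed time with probability `1 / m`, and, given that it splits at `z`,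
is to the right of `z` a copy of `Pi` independent of the splitting times up to `z`. -/
structure IsStationaryVersion (Q : Measure (ℤ → ℤ)) (Pi : Ω → ℕ → ℕ) (μ : Measure Ω) : Prop where
  prob : IsProbabilityMeasure Q
  bijective : ∀ᵐ σ ∂Q, Function.Bijective σ
  stationary : ∀ a : ℤ,
    Q.map (fun σ => fun z : ℤ => σ (a + z) - (a + z)) = Q.map (fun σ => fun z : ℤ => σ z - z)
  unbounded : ∀ᵐ σ ∂Q, ∀ z : ℤ, (∃ t < z, SplitsAtInt σ t) ∧ ∃ t > z, SplitsAtInt σ t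
  density : ∀ z : ℤ, Q {σ | SplitsAtInt σ z} = (meanBlock Pi μ)⁻¹
  residual_law : ∀ z : ℤ, (Q[|{σ | SplitsAtInt σ z}]).map (residualInt z) = μ.map Pi
  residual_indep : ∀ z : ℤ,
    IndepFun (fun σ => {t : ℤ | t ≤ z ∧ SplitsAtInt σ t}) (residualInt z)
      (Q[|{σ | SplitsAtInt σ z}])

/-- Almost surely every point lies in a finite block. -/
def AllBlocksFinite (Pi : Ω → ℕ → ℕ) (μ : Measure Ω) : Prop :=
  ∀ᵐ ω ∂μ, ∀ i : ℕ, ∃ n > i, SplitsAt (Pi ω) n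

/-! ### Residual allocation models and `P`-biased permutations -/

/-- `T_i = (1 - W_1) ⋯ (1 - W_i)`, the mass that remains after `i` sticks. -/
def remaining (W : ℕ → Ω → ℝ) (i : ℕ) (ω : Ω) : ℝ := ∏ j ∈ Finset.range i, (1 - W j ω)

/-- The residual allocation model: the stick lengths `(1 - W_1) ⋯ (1 - W_{i-1}) W_i`. -/
def stick (W : ℕ → Ω → ℝ) (ω : Ω) (i : ℕ) : ℝ := remaining W i ω * W i ω

/-- Given the random discrete distribution `P`, the `X_j` are i.i.d. with distribution `P`. -/
def IsSampleFrom (X : ℕ → Ω → ℕ) (P : Ω → ℕ → ℝ) (μ : Measure Ω) : Prop :=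
  (∀ j, Measurable (X j)) ∧
  ∀ (n : ℕ) (x : Fin n → ℕ) (B : Set (ℕ → ℝ)), MeasurableSet B →
    μ ({ω | ∀ j : Fin n, X j ω = x j} ∩ P ⁻¹' B) =
      ∫⁻ ω in P ⁻¹' B, ∏ j : Fin n, ENNReal.ofReal (P ω (x j)) ∂μ

/-- The sequence of distinct values, in order of appearance, of a sequence with infinitely many
distinct values. -/
def distinctValues (x : ℕ → ℕ) (i : ℕ) : ℕ := x (Nat.nth (fun j => ∀ k < j, x k ≠ x j) i)

/-- The `P`-biased permutation driven by the sample `X` from `P`. -/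
def biasedPerm (X : ℕ → Ω → ℕ) (ω : Ω) : ℕ → ℕ := distinctValues (fun j => X j ω)

end

end RegenPerm

/-!
A random permutation is studied through its law on `ℕ → ℕ`. The key property is `IsRegenLaw`: on
the event of a split at `n`, the residual permutation is independent of the restriction to `[n]`
and has the original law. All the assertions except the integral formula and the recurrence
criterion hold for every such law, the later ones if the mean block length is finite.

*Regenerative laws.* The law of a random set is determined by the probabilities that it contains a
given finite set. For the set of splitting times and for a renewal set with zero delay these satisfy
the same first-step recursion, whence `IsRegenLaw.isStrictlyRegenerative`. The events that `m` is
the last splitting time up to `n` are disjoint, so `∑ m ≤ n, u m * P(Y > n - m) ≤ 1` with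
`u m = P(split at m)` and `Y` the first block length; hence `u ≥ c` implies `E Y ≤ 1 / c`
(`IsRegenLaw.lintegral_firstSplit_le`). The successive blocks are independent with the same law, and
the strong law of large numbers along the block ends, with monotonicity in between, gives the cycle
frequencies (`IsRegenLaw.ae_tendsto_cycleCount`). For the stationary version record the
displacements and the splitting times as a marked sequence; seen from a uniform position in a
length-biased first block this is a one-sided stationary process, and its natural extension to `ℤ`,
built as a Markov chain on one-sided sequences, is the trace of the desired permutation
(`IsRegenLaw.exists_stationary`).

*The biased permutation is regenerative.* The probability that the distinct values in a sample
begin with `a₁, …, a_k` is the expectation of `∏ p(a_i) / (1 - p(a₁) - ⋯ - p(a_{i-1}))`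
(`measure_initSeg`). In a residual allocation model, once the first `n` values have exhausted `[n]`
these factors are those of the model with the factors `W (n + ·)`, by self-similarity of stick
breaking; since the `W i` are i.i.d. the law of the initial segments factorizes, and this determines
the joint law (`isRegenLaw_biasedPerm`).

*The probability of a split at `n`.* Given the masses, the sum of the products above over all
arrangements of `[n]` and the integral `T ∫ exp (-T t) ∏ i < n, (1 - exp (-p i t)) dt`, where `T` is
the mass outside `[n]`, satisfy the same recursion: for the integral this is an integration by parts
(`mul_expRace`). The ratios `p i / T` become those of the formula if the order of the first `n`
factors is reversed, which does not change their law (`measureReal_splitsAt`).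

*Recurrence.* Under the summability assumption the infinite product in the formula is almost surely
positive for a suitable `x`, so that `u` is bounded below (`isPositiveRecurrent_of_tsum`). As
`exp (-y) ≤ 1 / √y`, the assumption holds as soon as `E (1 / √W₁) < ∞`, because `E √(1 - W₁) < 1`
(`isPositiveRecurrent_of_lintegral`); this covers constant and beta distributed factors.
-/

namespace RegenPerm

/-! ### Splitting times and residual permutations -/

lemma splitsAt_zero (π : ℕ → ℕ) : SplitsAt π 0 := fun i => by simp

lemma residual_zero (π : ℕ → ℕ) : residual 0 π = π := by
  funext i; simp [residual]

lemma residual_residual (π : ℕ → ℕ) (n k : ℕ) :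
    residual k (residual n π) = residual (n + k) π := by
  funext i; simp [residual, Nat.sub_sub, add_assoc]

lemma SplitsAt.le_apply {π : ℕ → ℕ} {n : ℕ} (h : SplitsAt π n) (i : ℕ) : n ≤ π (n + i) := by
  have := h (n + i); omega

lemma SplitsAt.add_residual {π : ℕ → ℕ} {n : ℕ} (h : SplitsAt π n) (i : ℕ) :
    n + residual n π i = π (n + i) := by
  have := h.le_apply i; simp only [residual]; omega

lemma SplitsAt.residual_iff {π : ℕ → ℕ} {n : ℕ} (h : SplitsAt π n) (k : ℕ) :
    SplitsAt (residual n π) k ↔ SplitsAt π (n + k) := by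
  constructor
  · intro hk i
    by_cases hi : i < n
    · have := (h i).2 hi; omega
    · obtain ⟨j, rfl⟩ : ∃ j, i = n + j := ⟨i - n, by omega⟩
      have h1 := hk j; have h2 := h.add_residual j; omega
  · intro hk i
    have h1 := hk (n + i); have h2 := h.add_residual i; omega

lemma SplitsAt.splitSet_residual {π : ℕ → ℕ} {n : ℕ} (h : SplitsAt π n) :
    splitSet (residual n π) = {k | n + k ∈ splitSet π} := by
  ext k; exact h.residual_iff k

lemma SplitsAt.splitsAt_of_le {π π' : ℕ → ℕ} {n : ℕ} (h : SplitsAt π n) (h' : SplitsAt π' n)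
    (hag : ∀ i < n, π i = π' i) {m : ℕ} (hm : m ≤ n) : SplitsAt π m ↔ SplitsAt π' m := by
  suffices H : ∀ π π' : ℕ → ℕ, SplitsAt π' n → (∀ i < n, π i = π' i) → SplitsAt π m →
      SplitsAt π' m from ⟨H π π' h' hag, H π' π h fun i hi => (hag i hi).symm⟩
  intro π π' h' hag hs i
  by_cases hi : i < n
  · rw [← hag i hi]; exact hs i
  · have := h' i; omega

/-! ### The first strictly positive splitting time -/

lemma coe_lt_firstSplit_iff {π : ℕ → ℕ} {k : ℕ} :
    (k : ℕ∞) < firstSplit π ↔ ∀ m, 0 < m → m ≤ k → ¬ SplitsAt π m := by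
  rw [← ENat.add_one_le_iff (ENat.natCast_ne_top k)]
  simp only [firstSplit, le_iInf_iff]
  constructor
  · intro h m hm hk hs
    have h1 := h m ⟨hm, hs⟩
    have h2 : k + 1 ≤ m := by exact_mod_cast h1
    omega
  · intro h m hm
    have : k + 1 ≤ m := by
      by_contra hc
      exact h m hm.1 (by omega) hm.2
    exact_mod_cast this

lemma firstSplit_le {π : ℕ → ℕ} {m : ℕ} (hm : 0 < m) (hs : SplitsAt π m) :
    firstSplit π ≤ m := iInf₂_le m ⟨hm, hs⟩

lemma firstSplit_eq_coe_iff {π : ℕ → ℕ} {n : ℕ} :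
    firstSplit π = n ↔ 0 < n ∧ SplitsAt π n ∧ ∀ m, 0 < m → m < n → ¬ SplitsAt π m := by
  constructor
  · intro h
    have hlt : ∀ m, 0 < m → m < n → ¬ SplitsAt π m := fun m hm hmn hs => by
      have := firstSplit_le hm hs
      rw [h] at this
      have : n ≤ m := by exact_mod_cast this
      omega
    have h1 : ¬ ((n : ℕ∞) < firstSplit π) := by rw [h]; exact lt_irrefl _
    rw [coe_lt_firstSplit_iff] at h1
    push Not at h1
    obtain ⟨m, hm, hmn, hs⟩ := h1
    have : m = n := by
      by_contra hne
      exact hlt m hm (by omega) hs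
    subst this
    exact ⟨hm, hs, hlt⟩
  · rintro ⟨hn, hs, hlt⟩
    refine le_antisymm (firstSplit_le hn hs) ?_
    simp only [firstSplit, le_iInf_iff]
    intro m hm
    have : n ≤ m := by
      by_contra hc
      exact hlt m hm.1 (by omega) hm.2
    exact_mod_cast this

lemma firstSplit_eq_top_iff {π : ℕ → ℕ} :
    firstSplit π = ⊤ ↔ ∀ m, 0 < m → ¬ SplitsAt π m := by
  simp only [firstSplit, iInf_eq_top]
  constructor
  · intro h m hm hs; exact ENat.natCast_ne_top m (h m ⟨hm, hs⟩)
  · intro h m hm; exact absurd hm.2 (h m hm.1)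

lemma firstSplit_pos (π : ℕ → ℕ) : 0 < firstSplit π :=
  coe_lt_firstSplit_iff.2 (fun m hm hk => by omega)

lemma coe_toNat_firstSplit {π : ℕ → ℕ} (h : firstSplit π ≠ ⊤) :
    (((firstSplit π).toNat : ℕ) : ℕ∞) = firstSplit π := ENat.natCast_toNat h

lemma splitsAt_firstSplit {π : ℕ → ℕ} (h : firstSplit π ≠ ⊤) :
    SplitsAt π (firstSplit π).toNat :=
  (firstSplit_eq_coe_iff.1 (coe_toNat_firstSplit h).symm).2.1

lemma toNat_firstSplit_pos {π : ℕ → ℕ} (h : firstSplit π ≠ ⊤) :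
    0 < (firstSplit π).toNat :=
  (firstSplit_eq_coe_iff.1 (coe_toNat_firstSplit h).symm).1

/-! ### Measurability -/

lemma measurableSet_splitsAt (n : ℕ) : MeasurableSet {π : ℕ → ℕ | SplitsAt π n} := by
  simp only [SplitsAt, Set.ofPred_forall]
  refine MeasurableSet.iInter fun i => ?_
  exact (MeasurableSet.of_discrete (s := {x : ℕ | x < n ↔ i < n})).preimage (measurable_pi_apply i)

lemma measurable_splitSet : Measurable splitSet :=
  measurable_pi_iff.2 fun n => measurableSet_setOfPred.1 (measurableSet_splitsAt n)

lemma measurable_residual (n : ℕ) : Measurable (residual n) :=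
  measurable_pi_iff.2 fun i =>
    (Measurable.of_discrete (f := fun x : ℕ => x - n)).comp (measurable_pi_apply (n + i))

lemma measurableSet_lt_firstSplit (k : ℕ) : MeasurableSet {π | (k : ℕ∞) < firstSplit π} := by
  simp only [coe_lt_firstSplit_iff, Set.ofPred_forall]
  exact MeasurableSet.iInter fun m => MeasurableSet.iInter fun _ => MeasurableSet.iInter fun _ =>
    (measurableSet_splitsAt m).compl

lemma measurableSet_firstSplit_eq (k : ℕ) : MeasurableSet {π | firstSplit π = k} := by
  simp only [firstSplit_eq_coe_iff, Set.ofPred_and, Set.ofPred_forall]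
  refine (MeasurableSet.const _).inter ((measurableSet_splitsAt k).inter ?_)
  exact MeasurableSet.iInter fun m => MeasurableSet.iInter fun _ => MeasurableSet.iInter fun _ =>
    (measurableSet_splitsAt m).compl

lemma measurableSet_firstSplit_eq_top : MeasurableSet {π | firstSplit π = ⊤} := by
  simp only [firstSplit_eq_top_iff, Set.ofPred_forall]
  exact MeasurableSet.iInter fun m => MeasurableSet.iInter fun _ => (measurableSet_splitsAt m).compl

lemma measurable_firstSplit : Measurable firstSplit := by
  refine measurable_to_countable' fun y => ?_
  induction y using ENat.recTopCoe with
  | top => exact measurableSet_firstSplit_eq_top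
  | coe k => exact measurableSet_firstSplit_eq k

/-! ### Laws of strictly regenerative permutations -/

/-- On the permutations that split at `n`, membership in `A` depends only on the values
at the points of `[n]`. -/
def DependsOnPast (n : ℕ) (A : Set (ℕ → ℕ)) : Prop :=
  ∀ π π' : ℕ → ℕ, SplitsAt π n → SplitsAt π' n → (∀ i < n, π i = π' i) → π ∈ A → π' ∈ A

/-- A probability measure on maps `ℕ → ℕ`, concentrated on permutations, such that given a split
at `n` the residual permutation is independent of the restriction to `[n]` and has the original
law. -/
structure IsRegenLaw (lam : Measure (ℕ → ℕ)) : Prop where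
  prob : IsProbabilityMeasure lam
  bijective : ∀ᵐ π ∂lam, Function.Bijective π
  regen : ∀ (n : ℕ) (A B : Set (ℕ → ℕ)), MeasurableSet A → DependsOnPast n A → MeasurableSet B →
    lam ({π | SplitsAt π n} ∩ A ∩ residual n ⁻¹' B) = lam ({π | SplitsAt π n} ∩ A) * lam B

lemma dependsOnPast_univ (n : ℕ) : DependsOnPast n Set.univ := fun _ _ _ _ _ _ => trivial

lemma dependsOnPast_splitsAt {m n : ℕ} (h : m ≤ n) : DependsOnPast n {π | SplitsAt π m} :=
  fun _ _ h1 h2 hag hs => (h1.splitsAt_of_le h2 hag h).1 hs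

lemma DependsOnPast.inter {n : ℕ} {A B : Set (ℕ → ℕ)} (hA : DependsOnPast n A)
    (hB : DependsOnPast n B) : DependsOnPast n (A ∩ B) :=
  fun π π' h1 h2 hag hs => ⟨hA π π' h1 h2 hag hs.1, hB π π' h1 h2 hag hs.2⟩

lemma dependsOnPast_firstSplit_eq (n : ℕ) : DependsOnPast n {π | firstSplit π = n} := by
  intro π π' h1 h2 hag hs
  simp only [Set.mem_ofPred_eq, firstSplit_eq_coe_iff] at hs ⊢
  refine ⟨hs.1, h2, fun m hm hmn h => hs.2.2 m hm hmn ?_⟩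
  exact (h1.splitsAt_of_le h2 hag hmn.le).2 h

lemma dependsOnPast_splitSet_inter_Iic (n : ℕ) (S : Set (Set ℕ)) :
    DependsOnPast n {π | splitSet π ∩ Set.Iic n ∈ S} := by
  intro π π' h1 h2 hag hs
  have : splitSet π' ∩ Set.Iic n = splitSet π ∩ Set.Iic n := by
    ext m
    simp only [Set.mem_inter_iff, Set.mem_Iic, and_congr_left_iff]
    exact fun hm => (h1.splitsAt_of_le h2 hag hm).symm
  simpa [this] using hs

namespace IsRegenLaw

variable {lam : Measure (ℕ → ℕ)}

lemma regen_firstSplit (h : IsRegenLaw lam) (n : ℕ) {A B : Set (ℕ → ℕ)} (hA : MeasurableSet A)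
    (hA' : DependsOnPast n A) (hB : MeasurableSet B) :
    lam ({π | firstSplit π = n} ∩ A ∩ residual n ⁻¹' B) =
      lam ({π | firstSplit π = n} ∩ A) * lam B := by
  have hsub : {π | firstSplit π = n} ⊆ {π | SplitsAt π n} :=
    fun π hπ => (firstSplit_eq_coe_iff.1 hπ).2.1
  have h1 := h.regen n ({π | firstSplit π = n} ∩ A) B ((measurableSet_firstSplit_eq n).inter hA)
    ((dependsOnPast_firstSplit_eq n).inter hA') hB
  rwa [← Set.inter_assoc, Set.inter_eq_self_of_subset_right hsub] at h1

lemma regen_residual (h : IsRegenLaw lam) (n : ℕ) {B : Set (ℕ → ℕ)} (hB : MeasurableSet B) :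
    lam ({π | SplitsAt π n} ∩ residual n ⁻¹' B) = lam {π | SplitsAt π n} * lam B := by
  simpa using h.regen n Set.univ B MeasurableSet.univ (dependsOnPast_univ n) hB

end IsRegenLaw

/-! ### Independence of the past and the future of a sequence -/

lemma indepFun_past_future {Ω E : Type*} [MeasurableSpace Ω] [MeasurableSpace E] {μ : Measure Ω}
    {X : ℕ → Ω → E} (hX : ∀ i, Measurable (X i)) (h : iIndepFun X μ) (n : ℕ) :
    IndepFun (fun ω (i : Fin n) => X i ω) (fun ω (i : ℕ) => X (n + i) ω) μ := by
  have h1 := indep_iSup_of_disjoint (fun i => (hX i).comap_le) h.iIndep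
    (S := Set.Iio n) (T := Set.Ici n) (by
      rw [Set.disjoint_left]; intro a ha hb
      simp only [Set.mem_Iio, Set.mem_Ici] at ha hb; omega)
  refine indep_of_indep_of_le_right (indep_of_indep_of_le_left h1 ?_) ?_
  · refine Measurable.comap_le (@measurable_pi_iff _ _ _ (_) _ _ |>.2 fun i => ?_)
    refine measurable_iff_comap_le.2 ?_
    exact le_iSup₂_of_le (f := fun i (_ : i ∈ Set.Iio n) => MeasurableSpace.comap (X i) _)
      (i : ℕ) i.2 le_rfl
  · refine Measurable.comap_le (@measurable_pi_iff _ _ _ (_) _ _ |>.2 fun i => ?_)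
    refine measurable_iff_comap_le.2 ?_
    exact le_iSup₂_of_le (f := fun i (_ : i ∈ Set.Ici n) => MeasurableSpace.comap (X i) _)
      (n + i) (Nat.le_add_right n i) le_rfl

lemma infinitePi_head_tail {E : Type*} [MeasurableSpace E] (ρ : Measure E)
    [IsProbabilityMeasure ρ] {A : Set E} {B : Set (ℕ → E)} (hA : MeasurableSet A)
    (hB : MeasurableSet B) :
    Measure.infinitePi (fun _ : ℕ => ρ) {y | y 0 ∈ A ∧ (fun n => y (n + 1)) ∈ B} =
      ρ A * Measure.infinitePi (fun _ : ℕ => ρ) B := by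
  have hi : iIndepFun (fun (i : ℕ) (y : ℕ → E) => y i) (Measure.infinitePi (fun _ : ℕ => ρ)) :=
    iIndepFun_infinitePi (P := fun _ : ℕ => ρ) (X := fun _ (x : E) => x) (fun i => measurable_id)
  have h1 := indepFun_past_future (fun i => measurable_pi_apply i) hi 1
  have h2 := h1.measure_inter_preimage_eq_mul {x | x 0 ∈ A} B
    (hA.preimage (measurable_pi_apply 0)) hB
  have e1 : Measure.infinitePi (fun _ : ℕ => ρ) {y | y 0 ∈ A} = ρ A := by
    conv_rhs => rw [← Measure.infinitePi_map_eval (fun _ : ℕ => ρ) 0,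
      Measure.map_apply (measurable_pi_apply 0) hA]
    rfl
  have e2 : Measure.infinitePi (fun _ : ℕ => ρ) {y | (fun n => y (1 + n)) ∈ B} =
      Measure.infinitePi (fun _ : ℕ => ρ) B := by
    have := Measure.map_infinitePi_infinitePi_of_inj (P := fun _ : ℕ => ρ)
      (f := fun n : ℕ => 1 + n) (fun a b hab => by simpa using hab)
    conv_rhs => rw [← this]
    rw [Measure.map_apply (measurable_pi_iff.2 fun i => measurable_pi_apply _) hB]
    rfl
  rw [← e1, ← e2]
  simp only [add_comm _ 1]
  exact h2

/-! ### The law of a random set of renewal times -/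

lemma measurableSet_subset_finset (F : Finset ℕ) :
    MeasurableSet {R : Set ℕ | (F : Set ℕ) ⊆ R} := by
  have : {R : Set ℕ | (F : Set ℕ) ⊆ R} = ⋂ n ∈ F, {R : Set ℕ | n ∈ R} := by
    ext R; simp [Set.subset_def]
  rw [this]
  exact F.measurableSet_biInter fun n _ => measurableSet_setOfPred.2 (measurable_pi_apply n)

/-- The law of a random set is determined by the probabilities that it contains a given finite
set. -/
lemma measure_set_ext {T : Type*} [Countable T] {P P' : Measure (Set T)} [IsFiniteMeasure P]
    (h : ∀ F : Finset T, P {R | (F : Set T) ⊆ R} = P' {R | (F : Set T) ⊆ R}) : P = P' := by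
  classical
  refine ext_of_generate_finite (Set.range fun F : Finset T => {R : Set T | (F : Set T) ⊆ R})
    ?_ ?_ ?_ (by simpa using h ∅)
  · refine le_antisymm ?_ ?_
    · have : Measurable[MeasurableSpace.generateFrom
          (Set.range fun F : Finset T => {R : Set T | (F : Set T) ⊆ R})]
          (id : Set T → T → Prop) := by
        refine @measurable_pi_iff _ _ _ (_) _ _ |>.2 fun t => ?_
        refine @measurable_to_prop _ (_) _ ?_
        refine MeasurableSpace.measurableSet_generateFrom ⟨{t}, ?_⟩
        ext R
        simp only [Finset.coe_singleton, Set.singleton_subset_iff, Set.mem_preimage,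
          Set.mem_singleton_iff, eq_iff_iff, iff_true]
        rfl
      have h2 := this.comap_le
      rwa [MeasurableSpace.comap_id] at h2
    · refine MeasurableSpace.generateFrom_le ?_
      rintro _ ⟨F, rfl⟩
      have : {R : Set T | (F : Set T) ⊆ R} = ⋂ n ∈ F, {R : Set T | n ∈ R} := by
        ext R; simp [Set.subset_def]
      simp only [this]
      exact F.measurableSet_biInter fun n _ => measurableSet_setOfPred.2 (measurable_pi_apply n)
  · rintro _ ⟨F, rfl⟩ _ ⟨G, rfl⟩ _
    refine ⟨F ∪ G, ?_⟩
    ext R; simp [Set.union_subset_iff]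
  · rintro _ ⟨F, rfl⟩; exact h F

/-- A random subset of `ℕ` that contains `0` and starts afresh at its first positive element,
which equals `k` with probability `f k`: first-step decomposition. -/
structure HasFirstStep (P : Measure (Set ℕ)) (f : ℕ → ℝ≥0∞) : Prop where
  zero_mem : ∀ᵐ R ∂P, 0 ∈ R
  step : ∀ (F : Finset ℕ) (m : ℕ), m ∈ F → 0 < m → (∀ x ∈ F, m ≤ x) →
    P {R | (F : Set ℕ) ⊆ R} =
      ∑ k ∈ Finset.Icc 1 m, f k * P {R | ((F.image (· - k) : Finset ℕ) : Set ℕ) ⊆ R}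

lemma HasFirstStep.unique {P P' : Measure (Set ℕ)} [IsProbabilityMeasure P]
    [IsProbabilityMeasure P'] {f : ℕ → ℝ≥0∞} (h : HasFirstStep P f) (h' : HasFirstStep P' f) :
    P = P' := by
  refine measure_set_ext fun F => ?_
  -- Removing `0` from the set `F` changes neither side, and a step lowers all its elements.
  have key : ∀ N : ℕ, ∀ F : Finset ℕ, (∀ x ∈ F, x ≤ N) →
      P {R | (F : Set ℕ) ⊆ R} = P' {R | (F : Set ℕ) ⊆ R} := by
    intro N
    induction N using Nat.strong_induction_on with
    | _ N ih =>
    intro F hF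
    have hz : ∀ Q : Measure (Set ℕ), (∀ᵐ R ∂Q, 0 ∈ R) →
        Q {R | (F : Set ℕ) ⊆ R} = Q {R | ((F.erase 0 : Finset ℕ) : Set ℕ) ⊆ R} := by
      intro Q hQ
      refine measure_congr (eventuallyEq_set.2 ?_)
      filter_upwards [hQ] with R hR
      refine ⟨fun h x hx => h (Finset.mem_of_mem_erase hx), fun h x hx => ?_⟩
      by_cases hx0 : x = 0
      · rwa [hx0]
      · exact h (Finset.mem_erase.2 ⟨hx0, hx⟩)
    rw [hz P h.zero_mem, hz P' h'.zero_mem]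
    by_cases hne : (F.erase 0).Nonempty
    · set G := F.erase 0 with hG
      have hm := G.min'_mem hne
      have hpos : 0 < G.min' hne := Nat.pos_of_ne_zero (Finset.ne_of_mem_erase hm)
      have hle : ∀ x ∈ G, G.min' hne ≤ x := fun x hx => G.min'_le x hx
      rw [h.step G _ hm hpos hle, h'.step G _ hm hpos hle]
      refine Finset.sum_congr rfl fun k hk => ?_
      rw [Finset.mem_Icc] at hk
      have hmN := hF _ (Finset.mem_of_mem_erase hm)
      rw [ih (N - 1) (by omega)]
      intro x hx
      obtain ⟨y, hy, rfl⟩ := Finset.mem_image.1 hx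
      have := hF y (Finset.mem_of_mem_erase hy)
      omega
    · rw [Finset.not_nonempty_iff_eq_empty] at hne
      simp [hne]
  exact key (F.sup id) F fun x hx => Finset.le_sup (f := id) hx

lemma measurable_renewalTimes :
    Measurable (fun x : ℕ × (ℕ → ℕ∞) => renewalTimes x.1 x.2) := by
  refine measurable_pi_iff.2 fun n => measurable_to_prop ?_
  have : (fun x : ℕ × (ℕ → ℕ∞) => renewalTimes x.1 x.2 n) ⁻¹' {True} =
      ⋃ k : ℕ, {x | (n : ℕ∞) = (x.1 : ℕ∞) + ∑ i ∈ Finset.range k, x.2 i} := by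
    ext x
    simp only [Set.mem_preimage, Set.mem_singleton_iff, eq_iff_iff, iff_true, Set.mem_iUnion]
    rfl
  rw [this]
  refine MeasurableSet.iUnion fun k => ?_
  have hm : Measurable fun x : ℕ × (ℕ → ℕ∞) => (x.1 : ℕ∞) + ∑ i ∈ Finset.range k, x.2 i := by
    have h1 : Measurable fun x : ℕ × (ℕ → ℕ∞) => (x.1 : ℕ∞) :=
      (Measurable.of_discrete (f := fun n : ℕ => (n : ℕ∞))).comp measurable_fst
    have h2 : ∀ k, Measurable fun x : ℕ × (ℕ → ℕ∞) => ∑ i ∈ Finset.range k, x.2 i := by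
      intro k
      induction k with
      | zero => simp
      | succ k ih =>
        simp only [Finset.sum_range_succ]
        exact (Measurable.of_discrete (f := fun p : ℕ∞ × ℕ∞ => p.1 + p.2)).comp
          (ih.prodMk ((measurable_pi_apply k).comp measurable_snd))
    exact (Measurable.of_discrete (f := fun p : ℕ∞ × ℕ∞ => p.1 + p.2)).comp (h1.prodMk (h2 k))
  exact measurableSet_eq_fun measurable_const hm

lemma renewalLaw_dirac_zero (ρ : Measure ℕ∞) [IsProbabilityMeasure ρ] :
    renewalLaw (Measure.dirac 0) ρ =
      (Measure.infinitePi (fun _ : ℕ => ρ)).map (renewalTimes 0) := by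
  rw [renewalLaw, Measure.dirac_prod, Measure.map_map measurable_renewalTimes
    measurable_prodMk_left]
  rfl

lemma zero_mem_renewalTimes (y : ℕ → ℕ∞) : 0 ∈ renewalTimes 0 y := ⟨0, by simp⟩

lemma mem_renewalTimes_iff {y : ℕ → ℕ∞} {n : ℕ} (hn : 0 < n) :
    n ∈ renewalTimes 0 y ↔
      ∃ k ≤ n, y 0 = k ∧ n - k ∈ renewalTimes 0 (fun i => y (i + 1)) := by
  constructor
  · rintro ⟨j, hj⟩
    cases j with
    | zero => simp at hj; omega
    | succ j =>
      rw [Finset.sum_range_succ'] at hj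
      simp only [Nat.cast_zero, zero_add] at hj
      have hfin : ∃ k : ℕ, y 0 = k := by
        cases hy : y 0 using ENat.recTopCoe with
        | top => rw [hy] at hj; simp at hj
        | coe k => exact ⟨k, rfl⟩
      obtain ⟨k, hk⟩ := hfin
      have hfin2 : ∃ s : ℕ, ∑ i ∈ Finset.range j, y (i + 1) = s := by
        cases hy : ∑ i ∈ Finset.range j, y (i + 1) using ENat.recTopCoe with
        | top => rw [hy] at hj; simp at hj
        | coe k => exact ⟨k, rfl⟩
      obtain ⟨s, hs⟩ := hfin2
      rw [hs, hk] at hj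
      have hj' : n = s + k := by exact_mod_cast hj
      refine ⟨k, by omega, hk, j, ?_⟩
      rw [hs]; simp [hj']
  · rintro ⟨k, hk, hy, j, hj⟩
    refine ⟨j + 1, ?_⟩
    rw [Finset.sum_range_succ', hy]
    simp only [Nat.cast_zero, zero_add] at hj ⊢
    rw [← hj]
    have : n = (n - k) + k := by omega
    exact_mod_cast this

lemma measurable_renewalTimes_zero : Measurable (renewalTimes 0) :=
  measurable_renewalTimes.comp measurable_prodMk_left

instance (ρ : Measure ℕ∞) [IsProbabilityMeasure ρ] :
    IsProbabilityMeasure (renewalLaw (Measure.dirac 0) ρ) := by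
  rw [renewalLaw_dirac_zero]
  exact Measure.isProbabilityMeasure_map measurable_renewalTimes_zero.aemeasurable

lemma hasFirstStep_renewalLaw (ρ : Measure ℕ∞) [IsProbabilityMeasure ρ] (hρ : ρ {0} = 0) :
    HasFirstStep (renewalLaw (Measure.dirac 0) ρ) (fun k => ρ {(k : ℕ∞)}) := by
  rw [renewalLaw_dirac_zero]
  refine ⟨?_, ?_⟩
  · refine (ae_map_iff measurable_renewalTimes_zero.aemeasurable
      (measurableSet_setOfPred.2 (measurable_pi_apply 0))).2 ?_
    exact Eventually.of_forall fun y => zero_mem_renewalTimes y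
  · intro F m hmF hm hF
    have hmeas := fun F : Finset ℕ =>
      (measurableSet_subset_finset F).preimage measurable_renewalTimes_zero
    simp only [Measure.map_apply measurable_renewalTimes_zero (measurableSet_subset_finset _)]
    have hy0 : ∀ᵐ y ∂(Measure.infinitePi (fun _ : ℕ => ρ)), y 0 ≠ 0 := by
      rw [ae_iff]
      simp only [ne_eq, not_not]
      have := infinitePi_head_tail ρ (A := {0}) (B := Set.univ) (by simp) MeasurableSet.univ
      simpa [hρ] using this
    have hset : renewalTimes 0 ⁻¹' {R | (F : Set ℕ) ⊆ R}
        =ᵐ[Measure.infinitePi (fun _ : ℕ => ρ)]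
        (⋃ k ∈ Finset.Icc 1 m, {y : ℕ → ℕ∞ | y 0 ∈ ({(k : ℕ∞)} : Set ℕ∞) ∧ (fun n => y (n + 1)) ∈
          renewalTimes 0 ⁻¹' {R | ((F.image (· - k) : Finset ℕ) : Set ℕ) ⊆ R}} :
            Set (ℕ → ℕ∞)) := by
      refine eventuallyEq_set.2 ?_
      filter_upwards [hy0] with y hy
      simp only [Set.mem_iUnion, Finset.mem_Icc, Set.mem_ofPred_eq, Set.mem_singleton_iff,
        Set.mem_preimage]
      constructor
      · intro h
        obtain ⟨k, hk, hyk, -⟩ := (mem_renewalTimes_iff hm).1 (h hmF)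
        have hk0 : k ≠ 0 := by rintro rfl; exact hy (by simpa using hyk)
        refine ⟨k, ⟨by omega, hk⟩, hyk, ?_⟩
        intro x hx
        rw [Finset.mem_coe, Finset.mem_image] at hx
        obtain ⟨z, hz, rfl⟩ := hx
        obtain ⟨k', hk', hyk', hr⟩ := (mem_renewalTimes_iff (hm.trans_le (hF z hz))).1 (h hz)
        rw [hyk] at hyk'
        have : k = k' := by exact_mod_cast hyk'
        subst this; exact hr
      · rintro ⟨k, hk, hyk, hr⟩ z hz
        refine (mem_renewalTimes_iff (hm.trans_le (hF z hz))).2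
          ⟨k, hk.2.trans (hF z hz), hyk, hr ?_⟩
        exact Finset.mem_coe.2 (Finset.mem_image_of_mem _ hz)
    rw [measure_congr hset, measure_biUnion_finset]
    · refine Finset.sum_congr rfl fun k _ => ?_
      exact infinitePi_head_tail ρ (by simp) (hmeas _)
    · intro a _ b _ hab
      rw [Function.onFun, Set.disjoint_left]
      rintro y ⟨h1, -⟩ ⟨h2, -⟩
      apply hab
      rw [Set.mem_singleton_iff] at h1 h2
      rw [h1] at h2; exact_mod_cast h2
    · intro k _
      refine MeasurableSet.inter ?_ ?_
      · exact (MeasurableSet.singleton (k : ℕ∞)).preimage (measurable_pi_apply 0)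
      · exact (hmeas _).preimage (measurable_pi_iff.2 fun i => measurable_pi_apply _)

/-! ### The splitting times form a renewal process -/

namespace IsRegenLaw

variable {lam : Measure (ℕ → ℕ)}

lemma hasFirstStep (h : IsRegenLaw lam) :
    HasFirstStep (lam.map splitSet) (fun k => lam {π | firstSplit π = k}) := by
  refine ⟨?_, ?_⟩
  · refine (ae_map_iff measurable_splitSet.aemeasurable
      (measurableSet_setOfPred.2 (measurable_pi_apply 0))).2 ?_
    exact Eventually.of_forall fun y => splitsAt_zero y
  · intro F m hmF hm hF
    have hmeas := fun F : Finset ℕ =>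
      (measurableSet_subset_finset F).preimage measurable_splitSet
    simp only [Measure.map_apply measurable_splitSet (measurableSet_subset_finset _)]
    have hset : splitSet ⁻¹' {R | (F : Set ℕ) ⊆ R} =
        ⋃ k ∈ Finset.Icc 1 m, ({π | firstSplit π = k} ∩ residual k ⁻¹'
          (splitSet ⁻¹' {R | ((F.image (· - k) : Finset ℕ) : Set ℕ) ⊆ R})) := by
      ext π
      simp only [Set.mem_iUnion, Finset.mem_Icc, Set.mem_inter_iff, Set.mem_ofPred_eq,
        Set.mem_preimage]
      constructor
      · intro h
        have hle := firstSplit_le hm (h hmF)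
        have hfin : firstSplit π ≠ ⊤ := fun ht => by simp [ht] at hle
        have hc := coe_toNat_firstSplit hfin
        set k := (firstSplit π).toNat
        have hs : SplitsAt π k := splitsAt_firstSplit hfin
        have hkm : k ≤ m := by rw [← hc] at hle; exact_mod_cast hle
        refine ⟨k, ⟨toNat_firstSplit_pos hfin, hkm⟩, hc.symm, ?_⟩
        intro x hx
        rw [Finset.mem_coe, Finset.mem_image] at hx
        obtain ⟨z, hz, rfl⟩ := hx
        refine (hs.residual_iff _).2 ?_
        rw [Nat.add_sub_cancel' (hkm.trans (hF z hz))]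
        exact h hz
      · rintro ⟨k, hk, hyk, hr⟩ z hz
        have hs : SplitsAt π k := (firstSplit_eq_coe_iff.1 hyk).2.1
        have h1 : SplitsAt (residual k π) (z - k) :=
          hr (Finset.mem_coe.2 (Finset.mem_image_of_mem _ hz))
        rw [hs.residual_iff, Nat.add_sub_cancel' (hk.2.trans (hF z hz))] at h1
        exact h1
    rw [hset, measure_biUnion_finset]
    · refine Finset.sum_congr rfl fun k _ => ?_
      have h1 := h.regen_firstSplit k MeasurableSet.univ (dependsOnPast_univ k)
        (hmeas (F.image (· - k)))
      rwa [Set.inter_univ] at h1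
    · intro a _ b _ hab
      rw [Function.onFun, Set.disjoint_left]
      rintro π ⟨h1, -⟩ ⟨h2, -⟩
      apply hab
      rw [Set.mem_ofPred_eq] at h1 h2
      rw [h1] at h2; exact_mod_cast h2
    · intro k _
      exact (measurableSet_firstSplit_eq k).inter ((hmeas _).preimage (measurable_residual k))

lemma map_splitSet (h : IsRegenLaw lam) :
    lam.map splitSet = renewalLaw (Measure.dirac 0) (lam.map firstSplit) := by
  have := h.prob
  have := Measure.isProbabilityMeasure_map (μ := lam) measurable_firstSplit.aemeasurable
  have := Measure.isProbabilityMeasure_map (μ := lam) measurable_splitSet.aemeasurable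
  refine h.hasFirstStep.unique ?_
  convert hasFirstStep_renewalLaw (lam.map firstSplit) ?_ using 1
  · funext k
    rw [Measure.map_apply measurable_firstSplit (by simp)]; rfl
  · rw [Measure.map_apply measurable_firstSplit (by simp)]
    have : firstSplit ⁻¹' {0} = ∅ := by
      ext π; simp [(firstSplit_pos π).ne']
    rw [this, measure_empty]

end IsRegenLaw

/-! ### Strict regeneration -/

lemma cond_map {Ω E : Type*} [MeasurableSpace Ω] [MeasurableSpace E] {μ : Measure Ω} {f : Ω → E}
    (hf : Measurable f) {S : Set E} (hS : MeasurableSet S) :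
    (μ[|f ⁻¹' S]).map f = (μ.map f)[|S] := by
  rw [ProbabilityTheory.cond, ProbabilityTheory.cond, Measure.map_smul,
    Measure.map_apply hf hS, Measure.restrict_map hf hS]

/-- If the residual is independent of the past given a split at `n`, so it is given the
splitting times up to `n`. -/
lemma IsRegenLaw.indepFun_cond {lam : Measure (ℕ → ℕ)} (h : IsRegenLaw lam) {n : ℕ}
    (hn : lam {π | SplitsAt π n} ≠ 0) :
    IndepFun (fun π => splitSet π ∩ Set.Iic n) (residual n) (lam[|{π | SplitsAt π n}]) := by
  have := h.prob
  have hS := measurableSet_splitsAt n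
  rw [indepFun_iff_measure_inter_preimage_eq_mul]
  intro A B hA hB
  have hAm : MeasurableSet ((fun π => splitSet π ∩ Set.Iic n) ⁻¹' A) :=
    hA.preimage (measurable_pi_iff.2 fun m => measurableSet_setOfPred.1
      ((measurableSet_splitsAt m).inter (MeasurableSet.const (m ≤ n))))
  rw [cond_apply hS, cond_apply hS, cond_apply hS, ← Set.inter_assoc,
    h.regen n _ B hAm (dependsOnPast_splitSet_inter_Iic n A) hB, h.regen_residual n hB]
  have hfin : lam {π | SplitsAt π n} ≠ ∞ := measure_ne_top _ _
  rw [← mul_assoc (lam {π | SplitsAt π n})⁻¹ (lam {π | SplitsAt π n}),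
    ENNReal.inv_mul_cancel hn hfin, one_mul, mul_assoc]

lemma IsRegenLaw.map_residual_cond {lam : Measure (ℕ → ℕ)} (h : IsRegenLaw lam) {n : ℕ}
    (hn : lam {π | SplitsAt π n} ≠ 0) :
    (lam[|{π | SplitsAt π n}]).map (residual n) = lam := by
  have := h.prob
  ext B hB
  rw [Measure.map_apply (measurable_residual n) hB, cond_apply (measurableSet_splitsAt n),
    h.regen_residual n hB, ← mul_assoc, ENNReal.inv_mul_cancel hn (measure_ne_top _ _), one_mul]

lemma measurable_id_splitSet : Measurable fun π : ℕ → ℕ => (π, splitSet π) :=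
  measurable_id.prodMk measurable_splitSet

theorem IsRegenLaw.isStrictlyRegenerative {Ω : Type*} [MeasurableSpace Ω] {μ : Measure Ω}
    {Pi : Ω → ℕ → ℕ} (hPi : Measurable Pi) (h : IsRegenLaw (μ.map Pi)) :
    IsStrictlyRegenerative Pi μ := by
  have := h.prob
  have hprob := Measure.isProbabilityMeasure_map (μ := μ.map Pi) measurable_firstSplit.aemeasurable
  have hset : ∀ n, {ω | n ∈ splitSet (Pi ω)} = Pi ⁻¹' {π | SplitsAt π n} := fun n => rfl
  have hzero : ∀ n, μ {ω | n ∈ splitSet (Pi ω)} ≠ 0 → (μ.map Pi) {π | SplitsAt π n} ≠ 0 := by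
    intro n hn
    rwa [Measure.map_apply hPi (measurableSet_splitsAt n)]
  -- On the event of a split at `n` the residual renewals are those of the residual permutation.
  have hae : ∀ n, (fun ω => (residual n (Pi ω), {k : ℕ | n + k ∈ splitSet (Pi ω)}))
      =ᵐ[μ[|{ω | n ∈ splitSet (Pi ω)}]]
      (fun π => (π, splitSet π)) ∘ residual n ∘ Pi := by
    intro n
    refine ae_cond_of_forall_mem ((measurableSet_splitsAt n).preimage hPi) fun ω hω => ?_
    exact Prod.ext rfl (SplitsAt.splitSet_residual hω).symm
  have hmap2 : (μ.map Pi).map splitSet = μ.map (fun ω => splitSet (Pi ω)) :=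
    Measure.map_map measurable_splitSet hPi
  have hmap1 : (μ.map fun ω => (Pi ω, splitSet (Pi ω))) = (μ.map Pi).map fun π => (π, splitSet π) :=
    (Measure.map_map measurable_id_splitSet hPi).symm
  refine ⟨hPi, measurable_splitSet.comp hPi, ae_of_ae_map hPi.aemeasurable h.bijective, ?_,
    ⟨Measure.dirac 0, (μ.map Pi).map firstSplit, inferInstance, hprob, ?_, ?_, ?_⟩,
    Eventually.of_forall fun ω n hn => hn, ?_, ?_⟩
  · rw [hmap1]
    have h2 : ∀ᵐ π ∂((μ.map Pi).map (fun π => (π, splitSet π))).map Prod.fst,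
        Function.Bijective π := by
      rw [Measure.map_map measurable_fst measurable_id_splitSet]
      have hb : (μ.map Pi).map (Prod.fst ∘ fun π => (π, splitSet π)) = μ.map Pi :=
        Measure.map_id
      rw [hb]
      exact h.bijective
    exact ae_of_ae_map measurable_fst.aemeasurable h2
  · rw [Measure.map_apply measurable_firstSplit (by simp)]
    have : firstSplit ⁻¹' {0} = ∅ := by
      ext π; simp [(firstSplit_pos π).ne']
    rw [this, measure_empty]
  · rw [← hmap2, h.map_splitSet]
  · rw [hmap1, Measure.map_map measurable_snd measurable_id_splitSet, ← h.map_splitSet]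
    rfl
  · intro n _ hn
    rw [Measure.map_congr (hae n), ← Measure.map_map measurable_id_splitSet
      ((measurable_residual n).comp hPi), ← Measure.map_map (measurable_residual n) hPi, hset,
      cond_map hPi (measurableSet_splitsAt n), h.map_residual_cond (hzero n hn), hmap1]
  · intro n _ hn
    refine IndepFun.congr ?_ (EventuallyEq.refl _ _) (hae n).symm
    have h1 := h.indepFun_cond (hzero n hn)
    rw [← cond_map hPi (measurableSet_splitsAt n)] at h1
    have h2 := h1.comp measurable_id measurable_id_splitSet
    rw [indepFun_iff_measure_inter_preimage_eq_mul] at h2 ⊢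
    intro A B hA hB
    have hm1 : Measurable fun π => splitSet π ∩ Set.Iic n :=
      measurable_pi_iff.2 fun m => measurableSet_setOfPred.1
        ((measurableSet_splitsAt m).inter (MeasurableSet.const (m ≤ n)))
    have hm2 := measurable_id_splitSet.comp (measurable_residual n)
    have h3 := h2 A B hA hB
    rw [Function.id_comp, Measure.map_apply hPi ((hA.preimage hm1).inter (hB.preimage hm2)),
      Measure.map_apply hPi (hA.preimage hm1), Measure.map_apply hPi (hB.preimage hm2)] at h3
    exact h3

/-! ### The mean length of the first block -/

lemma lintegral_enat_eq_tsum {E : Type*} [MeasurableSpace E] {μ : Measure E} {f : E → ℕ∞}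
    (hf : ∀ k : ℕ, MeasurableSet {x | (k : ℕ∞) < f x}) :
    ∫⁻ x, (f x : ℝ≥0∞) ∂μ = ∑' k : ℕ, μ {x | (k : ℕ∞) < f x} := by
  have hpt : ∀ x, (f x : ℝ≥0∞) =
      ∑' k : ℕ, {x | (k : ℕ∞) < f x}.indicator (fun _ => (1 : ℝ≥0∞)) x := by
    intro x
    cases hx : f x using ENat.recTopCoe with
    | top =>
      have : ∀ k : ℕ, {x | (k : ℕ∞) < f x}.indicator (fun _ => (1 : ℝ≥0∞)) x = 1 := fun k =>
        Set.indicator_of_mem (by simp [hx]) _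
      simp only [this]
      simp
    | coe n =>
      rw [tsum_eq_sum (s := Finset.range n)]
      · rw [Finset.sum_congr rfl (g := fun _ => (1 : ℝ≥0∞))]
        · simp
        · intro k hk
          refine Set.indicator_of_mem ?_ _
          rw [Set.mem_ofPred_eq, hx]; exact_mod_cast Finset.mem_range.1 hk
      · intro k hk
        refine Set.indicator_of_notMem ?_ _
        rw [Set.mem_ofPred_eq, hx]
        rw [Finset.mem_range] at hk
        exact_mod_cast hk
  simp only [hpt]
  rw [lintegral_tsum fun k => (measurable_const.indicator (hf k)).aemeasurable]
  refine tsum_congr fun k => ?_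
  rw [lintegral_indicator (hf k)]; simp

namespace IsRegenLaw

variable {lam : Measure (ℕ → ℕ)}

/-- Decomposition at the last splitting time up to `n`: the events that it equals `m` are
disjoint. -/
lemma sum_last_split_le (h : IsRegenLaw lam) (n : ℕ) :
    ∑ m ∈ Finset.range (n + 1),
      lam {π | SplitsAt π m} * lam {π | ((n - m : ℕ) : ℕ∞) < firstSplit π} ≤ 1 := by
  have := h.prob
  have hm := fun m => h.regen_residual m (measurableSet_lt_firstSplit (n - m))
  simp only [← hm]
  rw [← measure_biUnion_finset]
  · exact prob_le_one
  · have key : ∀ a b : ℕ, a < b → b ≤ n → ∀ π, SplitsAt π a →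
        (((n - a : ℕ) : ℕ∞) < firstSplit (residual a π)) → ¬ SplitsAt π b := by
      intro a b hab hb π hs hlt hsb
      refine coe_lt_firstSplit_iff.1 hlt (b - a) (by omega) (by omega) ?_
      rw [hs.residual_iff, Nat.add_sub_cancel' hab.le]; exact hsb
    intro a ha b hb hab
    rw [Finset.mem_coe, Finset.mem_range] at ha hb
    rw [Function.onFun, Set.disjoint_left]
    rintro π ⟨h1, h2⟩ ⟨h3, h4⟩
    rcases lt_or_gt_of_ne hab with hlt | hlt
    · exact key a b hlt (by omega) π h1 h2 h3
    · exact key b a hlt (by omega) π h3 h4 h1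
  · intro m _
    exact (measurableSet_splitsAt m).inter
      ((measurableSet_lt_firstSplit _).preimage (measurable_residual m))

/-- A lower bound on the probabilities of a split gives an upper bound on the mean length of the
first block. -/
lemma lintegral_firstSplit_le (h : IsRegenLaw lam) {c : ℝ≥0∞}
    (hu : ∀ n, c ≤ lam {π | SplitsAt π n}) : ∫⁻ π, (firstSplit π : ℝ≥0∞) ∂lam ≤ c⁻¹ := by
  rw [lintegral_enat_eq_tsum measurableSet_lt_firstSplit]
  refine ENNReal.tsum_le_of_sum_range_le fun n => ?_
  rw [ENNReal.le_inv_iff_mul_le, Finset.sum_mul]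
  calc ∑ k ∈ Finset.range n, lam {π | (k : ℕ∞) < firstSplit π} * c
      ≤ ∑ k ∈ Finset.range (n + 1), lam {π | (k : ℕ∞) < firstSplit π} * c :=
        Finset.sum_le_sum_of_subset (Finset.range_mono (Nat.le_succ n))
    _ = ∑ k ∈ Finset.range (n + 1), lam {π | ((n - k : ℕ) : ℕ∞) < firstSplit π} * c :=
        (Finset.sum_range_reflect (fun k => lam {π | (k : ℕ∞) < firstSplit π} * c) (n + 1)).symm
    _ ≤ ∑ k ∈ Finset.range (n + 1),
          lam {π | SplitsAt π k} * lam {π | ((n - k : ℕ) : ℕ∞) < firstSplit π} := by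
        refine Finset.sum_le_sum fun k _ => ?_
        rw [mul_comm]; gcongr; exact hu k
    _ ≤ 1 := h.sum_last_split_le n

/-! ### Successive blocks -/

lemma ae_firstSplit_ne_top (hfin : ∫⁻ π, (firstSplit π : ℝ≥0∞) ∂lam < ∞) :
    ∀ᵐ π ∂lam, firstSplit π ≠ ⊤ := by
  have hm : Measurable fun π => (firstSplit π : ℝ≥0∞) :=
    (Measurable.of_discrete (f := fun n : ℕ∞ => (n : ℝ≥0∞))).comp measurable_firstSplit
  filter_upwards [ae_lt_top hm hfin.ne] with π hπ ht
  simp [ht] at hπ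

lemma ae_exists_splitsAt_gt (h : IsRegenLaw lam) (htop : ∀ᵐ π ∂lam, firstSplit π ≠ ⊤) :
    ∀ᵐ π ∂lam, ∀ i : ℕ, ∃ n > i, SplitsAt π n := by
  have h1 : ∀ᵐ π ∂lam, ∀ n, SplitsAt π n → firstSplit (residual n π) ≠ ⊤ := by
    rw [ae_all_iff]
    intro n
    rw [ae_iff]
    have h2 := h.regen_residual n measurableSet_firstSplit_eq_top
    rw [ae_iff] at htop
    simp only [ne_eq, not_not] at htop
    rw [htop, mul_zero] at h2
    convert h2 using 2
    ext π; simp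
  filter_upwards [h1] with π hπ
  have hnext : ∀ n, SplitsAt π n → ∃ k > n, SplitsAt π k := fun n hn =>
    ⟨n + (firstSplit (residual n π)).toNat,
      Nat.lt_add_of_pos_right (toNat_firstSplit_pos (hπ n hn)),
      (hn.residual_iff _).1 (splitsAt_firstSplit (hπ n hn))⟩
  intro i
  induction i with
  | zero => exact hnext 0 (splitsAt_zero π)
  | succ i ih =>
    obtain ⟨n, hn, hs⟩ := ih
    rcases eq_or_lt_of_le (Nat.succ_le_of_lt hn) with heq | hlt
    · obtain ⟨k, hk, hs'⟩ := hnext n hs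
      exact ⟨k, by omega, hs'⟩
    · exact ⟨n, hlt, hs⟩

end IsRegenLaw

/-- Removal of the first block. -/
noncomputable def dropBlock (π : ℕ → ℕ) : ℕ → ℕ := residual (firstSplit π).toNat π

/-- A function of the first block, when this block is finite. -/
def DependsOnFirstBlock {E : Type*} (f : (ℕ → ℕ) → E) : Prop :=
  ∀ (n : ℕ) (π π' : ℕ → ℕ), firstSplit π = n → firstSplit π' = n → (∀ i < n, π i = π' i) →
    f π = f π'

lemma measurable_dropBlock : Measurable dropBlock := by
  have h1 : Measurable fun p : ℕ × (ℕ → ℕ) => residual p.1 p.2 :=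
    measurable_from_prod_countable_right fun n => measurable_residual n
  have h2 : Measurable fun π => (firstSplit π).toNat :=
    (Measurable.of_discrete (f := ENat.toNat)).comp measurable_firstSplit
  exact h1.comp (h2.prodMk measurable_id)

namespace IsRegenLaw

variable {lam : Measure (ℕ → ℕ)}

lemma measure_eq_tsum_firstSplit (htop : ∀ᵐ π ∂lam, firstSplit π ≠ ⊤) {s : Set (ℕ → ℕ)}
    (hs : MeasurableSet s) : lam s = ∑' n : ℕ, lam ({π | firstSplit π = n} ∩ s) := by
  rw [← measure_iUnion]
  · refine measure_congr (eventuallyEq_set.2 ?_)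
    filter_upwards [htop] with π hπ
    simp only [Set.mem_iUnion, Set.mem_inter_iff, Set.mem_ofPred_eq, exists_and_right]
    exact ⟨fun h => ⟨⟨_, (coe_toNat_firstSplit hπ).symm⟩, h⟩, fun h => h.2⟩
  · intro a b hab
    rw [Function.onFun, Set.disjoint_left]
    rintro π ⟨h1, -⟩ ⟨h2, -⟩
    apply hab
    rw [Set.mem_ofPred_eq] at h1 h2
    rw [h1] at h2; exact_mod_cast h2
  · exact fun n => (measurableSet_firstSplit_eq n).inter hs

/-- The first block is independent of what follows it, which has the original law. -/
lemma measure_inter_dropBlock (h : IsRegenLaw lam) (htop : ∀ᵐ π ∂lam, firstSplit π ≠ ⊤)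
    {E : Type*} [MeasurableSpace E] {f : (ℕ → ℕ) → E} (hf : Measurable f)
    (hf' : DependsOnFirstBlock f) {A : Set E} (hA : MeasurableSet A) {B : Set (ℕ → ℕ)}
    (hB : MeasurableSet B) :
    lam (f ⁻¹' A ∩ dropBlock ⁻¹' B) = lam (f ⁻¹' A) * lam B := by
  rw [measure_eq_tsum_firstSplit htop ((hA.preimage hf).inter (hB.preimage measurable_dropBlock)),
    measure_eq_tsum_firstSplit htop (hA.preimage hf), ← ENNReal.tsum_mul_right]
  refine tsum_congr fun n => ?_
  have hdep : DependsOnPast n ({π | firstSplit π = n} ∩ f ⁻¹' A) := by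
    intro π π' h1 h2 hag hs
    have hy := dependsOnPast_firstSplit_eq n π π' h1 h2 hag hs.1
    refine ⟨hy, ?_⟩
    rw [Set.mem_preimage, ← hf' n π π' hs.1 hy hag]; exact hs.2
  have hsub : {π | firstSplit π = n} ⊆ {π | SplitsAt π n} :=
    fun π hπ => (firstSplit_eq_coe_iff.1 hπ).2.1
  have h1 := h.regen n _ B ((measurableSet_firstSplit_eq n).inter (hA.preimage hf)) hdep hB
  rw [← Set.inter_assoc, Set.inter_eq_self_of_subset_right hsub] at h1
  rw [← h1]
  congr 1
  ext π
  simp only [Set.mem_inter_iff, Set.mem_ofPred_eq, Set.mem_preimage, and_assoc]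
  refine and_congr_right fun hn => and_congr_right fun _ => ?_
  rw [dropBlock, hn]; rfl

lemma measurePreserving_dropBlock (h : IsRegenLaw lam) (htop : ∀ᵐ π ∂lam, firstSplit π ≠ ⊤) :
    MeasurePreserving dropBlock lam lam := by
  have := h.prob
  refine ⟨measurable_dropBlock, ?_⟩
  ext B hB
  rw [Measure.map_apply measurable_dropBlock hB]
  simpa using h.measure_inter_dropBlock htop (f := fun _ => ()) measurable_const
    (fun _ _ _ _ _ _ => rfl) MeasurableSet.univ hB

/-- The strong law of large numbers for the successive blocks. -/
lemma strong_law_blocks (h : IsRegenLaw lam) (htop : ∀ᵐ π ∂lam, firstSplit π ≠ ⊤)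
    {f : (ℕ → ℕ) → ℝ} (hf : Measurable f) (hf' : DependsOnFirstBlock f) (hi : Integrable f lam) :
    ∀ᵐ π ∂lam, Tendsto (fun n : ℕ => (∑ i ∈ Finset.range n, f (dropBlock^[i] π)) / n) atTop
      (𝓝 (∫ π, f π ∂lam)) := by
  have := h.prob
  have hp := h.measurePreserving_dropBlock htop
  have hind : ∀ i k : ℕ, IndepFun (fun π => f (dropBlock^[i] π))
      (fun π => f (dropBlock^[i + (k + 1)] π)) lam := by
    intro i k
    have h0 : IndepFun f (fun π => f (dropBlock^[k] (dropBlock π))) lam := by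
      rw [indepFun_iff_measure_inter_preimage_eq_mul]
      intro A B hA hB
      have hg : Measurable fun π => f (dropBlock^[k] π) := hf.comp (hp.iterate k).measurable
      have h1 := h.measure_inter_dropBlock htop hf hf' hA (hB.preimage hg)
      have h2 := hp.measure_preimage (hB.preimage hg).nullMeasurableSet
      rw [← h2] at h1
      exact h1
    have hpi := hp.iterate i
    rw [indepFun_iff_measure_inter_preimage_eq_mul] at h0 ⊢
    intro A B hA hB
    have hg : Measurable fun π => f (dropBlock^[k] (dropBlock π)) :=
      hf.comp ((hp.iterate k).measurable.comp hp.measurable)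
    have h1 := h0 A B hA hB
    rw [← hpi.measure_preimage ((hA.preimage hf).inter (hB.preimage hg)).nullMeasurableSet,
      ← hpi.measure_preimage (hA.preimage hf).nullMeasurableSet,
      ← hpi.measure_preimage (hB.preimage hg).nullMeasurableSet] at h1
    have e : ∀ π, dropBlock^[i + (k + 1)] π = dropBlock^[k] (dropBlock (dropBlock^[i] π)) := by
      intro π
      rw [add_comm, Function.iterate_add_apply, Function.iterate_succ_apply]
    simp only [e]
    exact h1
  have hpair : Pairwise (Function.onFun (fun x1 x2 => x1 ⟂ᵢ[lam] x2)
      (fun (i : ℕ) π => f (dropBlock^[i] π))) := by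
    intro i j hij
    rcases lt_or_gt_of_ne hij with hlt | hlt
    · obtain ⟨k, rfl⟩ := Nat.exists_eq_add_of_lt hlt
      exact hind i k
    · obtain ⟨k, rfl⟩ := Nat.exists_eq_add_of_lt hlt
      exact (hind j k).symm
  have hident : ∀ i, IdentDistrib (fun π => f (dropBlock^[i] π))
      (fun π => f (dropBlock^[0] π)) lam lam := by
    intro i
    have hm : Measurable fun π => f (dropBlock^[i] π) := hf.comp (hp.iterate i).measurable
    refine ⟨hm.aemeasurable, hf.aemeasurable, ?_⟩
    have := Measure.map_map hf (hp.iterate i).measurable (μ := lam)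
    rw [(hp.iterate i).map_eq] at this
    exact this.symm
  exact strong_law_ae_real (fun i π => f (dropBlock^[i] π)) hi hpair hident

end IsRegenLaw

/-- The time at which the first `k` blocks end. -/
noncomputable def blockTime (π : ℕ → ℕ) (k : ℕ) : ℕ :=
  ∑ i ∈ Finset.range k, (firstSplit (dropBlock^[i] π)).toNat

lemma firstSplit_residual_ne_top {π : ℕ → ℕ} (h : ∀ i : ℕ, ∃ n > i, SplitsAt π n) {n : ℕ}
    (hn : SplitsAt π n) : firstSplit (residual n π) ≠ ⊤ := by
  rw [Ne, firstSplit_eq_top_iff]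
  push Not
  obtain ⟨k, hk, hs⟩ := h n
  refine ⟨k - n, by omega, ?_⟩
  rw [hn.residual_iff, Nat.add_sub_cancel' hk.le]; exact hs

lemma dropBlock_iterate {π : ℕ → ℕ} (h : ∀ i : ℕ, ∃ n > i, SplitsAt π n) (k : ℕ) :
    SplitsAt π (blockTime π k) ∧ dropBlock^[k] π = residual (blockTime π k) π := by
  induction k with
  | zero => exact ⟨by simpa [blockTime] using splitsAt_zero π, by simp [blockTime, residual_zero]⟩
  | succ k ih =>
    obtain ⟨h1, h2⟩ := ih
    have e : blockTime π (k + 1) = blockTime π k + (firstSplit (dropBlock^[k] π)).toNat :=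
      Finset.sum_range_succ _ _
    refine ⟨?_, ?_⟩
    · rw [e, ← h1.residual_iff, h2]
      exact splitsAt_firstSplit (firstSplit_residual_ne_top h h1)
    · rw [Function.iterate_succ_apply', dropBlock, e, ← residual_residual, ← h2]

lemma blockTime_lt_succ {π : ℕ → ℕ} (h : ∀ i : ℕ, ∃ n > i, SplitsAt π n) (k : ℕ) :
    blockTime π k < blockTime π (k + 1) := by
  obtain ⟨h1, h2⟩ := dropBlock_iterate h k
  rw [blockTime, blockTime, Finset.sum_range_succ, h2]
  exact Nat.lt_add_of_pos_right (toNat_firstSplit_pos (firstSplit_residual_ne_top h h1))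

/-! ### Cycle counts -/

/-- The number of points of `[n]` that lie on a cycle of length `j`. -/
noncomputable def cyclePoints (π : ℕ → ℕ) (n j : ℕ) : ℕ :=
  ∑ i ∈ Finset.range n, if Function.minimalPeriod π i = j then 1 else 0

lemma SplitsAt.iterate_residual {π : ℕ → ℕ} {n : ℕ} (h : SplitsAt π n) (k i : ℕ) :
    n + (residual n π)^[k] i = π^[k] (n + i) :=
  (Function.Semiconj.iterate_right (f := (n + ·)) (ga := residual n π) (gb := π)
    (fun i => h.add_residual i) k) i

lemma SplitsAt.minimalPeriod_residual {π : ℕ → ℕ} {n : ℕ} (h : SplitsAt π n) (i : ℕ) :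
    Function.minimalPeriod (residual n π) i = Function.minimalPeriod π (n + i) := by
  rw [Function.minimalPeriod_eq_minimalPeriod_iff]
  intro k
  rw [Function.IsPeriodicPt, Function.IsPeriodicPt, Function.IsFixedPt, Function.IsFixedPt,
    ← h.iterate_residual k i]
  omega

lemma SplitsAt.cyclePoints_add {π : ℕ → ℕ} {n : ℕ} (h : SplitsAt π n) (m j : ℕ) :
    cyclePoints π (n + m) j = cyclePoints π n j + cyclePoints (residual n π) m j := by
  simp only [cyclePoints, Finset.sum_range_add, h.minimalPeriod_residual]

lemma SplitsAt.iterate_lt {π : ℕ → ℕ} {n : ℕ} (h : SplitsAt π n) {i : ℕ} (hi : i < n) (k : ℕ) :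
    π^[k] i < n := by
  induction k with
  | zero => exact hi
  | succ k ih => rw [Function.iterate_succ_apply']; exact (h _).2 ih

/-- A permutation that splits at `n` has only finite cycles in `[n]`. -/
lemma SplitsAt.minimalPeriod_pos {π : ℕ → ℕ} {n : ℕ} (h : SplitsAt π n)
    (hinj : Function.Injective π) {i : ℕ} (hi : i < n) : 0 < Function.minimalPeriod π i := by
  obtain ⟨a, b, hab, he⟩ : ∃ a b : ℕ, a < b ∧ π^[a] i = π^[b] i := by
    have hnot : ¬ Function.Injective fun k : ℕ => (⟨π^[k] i, h.iterate_lt hi k⟩ : Fin n) :=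
      not_injective_infinite_finite _
    rw [Function.Injective] at hnot
    push Not at hnot
    obtain ⟨a, b, he, hne⟩ := hnot
    rw [Fin.mk.injEq] at he
    rcases lt_or_gt_of_ne hne with hlt | hlt
    · exact ⟨a, b, hlt, he⟩
    · exact ⟨b, a, hlt, he.symm⟩
  obtain ⟨c, rfl⟩ := Nat.exists_eq_add_of_lt hab
  rw [add_assoc, Function.iterate_add_apply] at he
  have hper : Function.IsPeriodicPt π (c + 1) i := (hinj.iterate a he).symm
  exact hper.minimalPeriod_pos (Nat.succ_pos c)

lemma minimalPeriod_congr {π π' : ℕ → ℕ} {n : ℕ} (h : SplitsAt π n)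
    (hag : ∀ i < n, π i = π' i) {i : ℕ} (hi : i < n) :
    Function.minimalPeriod π i = Function.minimalPeriod π' i := by
  have key : ∀ k, π^[k] i = π'^[k] i := by
    intro k
    induction k with
    | zero => rfl
    | succ k ih =>
      rw [Function.iterate_succ_apply', Function.iterate_succ_apply', ← ih]
      exact hag _ (h.iterate_lt hi k)
  rw [Function.minimalPeriod_eq_minimalPeriod_iff]
  intro k
  rw [Function.IsPeriodicPt, Function.IsPeriodicPt, Function.IsFixedPt, Function.IsFixedPt, key]

/-- At a splitting time each cycle of length `j` in `[n]` accounts for `j` points. -/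
lemma SplitsAt.mul_cycleCount {π : ℕ → ℕ} {n : ℕ} (h : SplitsAt π n)
    (hinj : Function.Injective π) (j : ℕ) : j * cycleCount π n j = cyclePoints π n j := by
  classical
  set F := (Finset.range n).filter (fun i => Function.minimalPeriod π i = j) with hF
  set C : ℕ → Set ℕ := fun i => Set.range (fun k : ℕ => π^[k] i) with hC
  have hmemF : ∀ i, i ∈ F ↔ i < n ∧ Function.minimalPeriod π i = j := by
    intro i; simp [hF]
  have hself : ∀ i, i ∈ C i := fun i => ⟨0, rfl⟩
  have hset : {S : Set ℕ | S ⊆ Set.Iio n ∧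
      ∃ i, Function.minimalPeriod π i = j ∧ S = Set.range (fun k : ℕ => π^[k] i)} =
      ((F.image C : Finset (Set ℕ)) : Set (Set ℕ)) := by
    ext S
    simp only [Set.mem_ofPred_eq, Finset.coe_image, Set.mem_image, Finset.mem_coe, hmemF]
    constructor
    · rintro ⟨h1, i, hi, rfl⟩
      exact ⟨i, ⟨h1 (hself i), hi⟩, rfl⟩
    · rintro ⟨i, ⟨h1, h2⟩, rfl⟩
      refine ⟨?_, i, h2, rfl⟩
      rintro _ ⟨k, rfl⟩
      exact h.iterate_lt h1 k
  have hcard : F.card = cyclePoints π n j := by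
    rw [hF, Finset.card_filter]; rfl
  rw [cycleCount, hset, Set.ncard_coe_finset, ← hcard,
    Finset.card_eq_sum_card_fiberwise (f := C) (t := F.image C)
      (fun i hi => Finset.mem_coe.2 (Finset.mem_image_of_mem C hi)), mul_comm,
    Finset.sum_const_nat]
  intro S hS
  obtain ⟨i, hi, rfl⟩ := Finset.mem_image.1 hS
  rw [hmemF] at hi
  have hjpos : 0 < j := hi.2 ▸ h.minimalPeriod_pos hinj hi.1
  have hper : i ∈ Function.periodicPts π :=
    Function.minimalPeriod_pos_iff_mem_periodicPts.1 (hi.2.symm ▸ hjpos)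
  have hfib : F.filter (fun i' => C i' = C i) = (Finset.range j).image (fun k => π^[k] i) := by
    ext i'
    simp only [Finset.mem_filter, hmemF, Finset.mem_image, Finset.mem_range]
    constructor
    · rintro ⟨-, h2⟩
      have h3 : i' ∈ C i := h2 ▸ hself i'
      obtain ⟨k, rfl⟩ := h3
      refine ⟨k % j, Nat.mod_lt _ hjpos, ?_⟩
      have := Function.iterate_mod_minimalPeriod_eq (f := π) (x := i) (n := k)
      rwa [hi.2] at this
    · rintro ⟨k, hk, rfl⟩
      refine ⟨⟨h.iterate_lt hi.1 k, ?_⟩, ?_⟩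
      · rw [Function.minimalPeriod_apply_iterate hper k, hi.2]
      · apply Set.Subset.antisymm
        · rintro _ ⟨m, rfl⟩
          exact ⟨m + k, by simp only [Function.iterate_add_apply]⟩
        · rintro _ ⟨m, rfl⟩
          -- Go round the cycle: `m + (j - k)` further steps lead from `π^[k] i` to `π^[m] i`.
          refine ⟨m + (j - k), ?_⟩
          simp only
          rw [← Function.iterate_add_apply, show m + (j - k) + k = m + j by omega,
            Function.iterate_add_apply]
          have : π^[j] i = i := hi.2 ▸ Function.isPeriodicPt_minimalPeriod π i
          rw [this]
  rw [hfib, Finset.card_image_of_injOn, Finset.card_range]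
  intro a ha b hb hab
  rw [Finset.mem_coe, Finset.mem_range, ← hi.2] at ha hb
  exact Function.iterate_injOn_Iio_minimalPeriod ha hb hab

lemma tsum_cyclePoints (π : ℕ → ℕ) (n : ℕ) :
    ∑' j : ℕ, (cyclePoints π n j : ℝ≥0∞) = n := by
  simp only [cyclePoints, Nat.cast_sum]
  rw [Summable.tsum_finsetSum (fun _ _ => ENNReal.summable)]
  simp

lemma cyclePoints_le (π : ℕ → ℕ) (n j : ℕ) : cyclePoints π n j ≤ n := by
  calc cyclePoints π n j ≤ ∑ i ∈ Finset.range n, 1 :=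
        Finset.sum_le_sum fun i _ => by split_ifs <;> simp
    _ = n := by simp

lemma cycleCount_mono (π : ℕ → ℕ) (j : ℕ) : Monotone fun n => cycleCount π n j := by
  intro m n hmn
  refine Set.ncard_le_ncard ?_ ?_
  · rintro S ⟨h1, h2⟩
    exact ⟨h1.trans (Set.Iio_subset_Iio hmn), h2⟩
  · exact (Set.finite_Iio n).finite_subsets.subset fun S hS => hS.1

lemma measurable_cyclePoints (n j : ℕ) : Measurable fun π => cyclePoints π n j := by
  have hiter : ∀ (k i : ℕ), Measurable fun π : ℕ → ℕ => π^[k] i := by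
    intro k
    induction k with
    | zero => intro i; exact measurable_const
    | succ k ih =>
      intro i
      simp only [Function.iterate_succ_apply']
      have h1 : Measurable fun p : ℕ × (ℕ → ℕ) => p.2 p.1 :=
        measurable_from_prod_countable_right fun n => measurable_pi_apply n
      exact h1.comp ((ih i).prodMk measurable_id)
  have hper : ∀ (k i : ℕ), MeasurableSet {π : ℕ → ℕ | Function.IsPeriodicPt π k i} := fun k i =>
    measurableSet_eq_fun (hiter k i) measurable_const
  refine Finset.measurable_sum _ fun i _ => Measurable.ite ?_ measurable_const measurable_const
  rcases Nat.eq_zero_or_pos j with rfl | hj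
  · have : {π : ℕ → ℕ | Function.minimalPeriod π i = 0} =
        ⋂ k : ℕ, ⋂ _ : 0 < k, {π : ℕ → ℕ | Function.IsPeriodicPt π k i}ᶜ := by
      ext π
      simp only [Set.mem_ofPred_eq, Set.mem_iInter, Set.mem_compl_iff]
      constructor
      · intro h k hk hp
        have := hp.minimalPeriod_pos hk; omega
      · intro h
        by_contra hne
        exact h _ (Nat.pos_of_ne_zero hne) (Function.isPeriodicPt_minimalPeriod π i)
    rw [this]
    exact MeasurableSet.iInter fun k => MeasurableSet.iInter fun _ => (hper k i).compl
  · have : {π : ℕ → ℕ | Function.minimalPeriod π i = j} =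
        {π : ℕ → ℕ | Function.IsPeriodicPt π j i} ∩
        ⋂ k : ℕ, ⋂ _ : 0 < k ∧ k < j, {π : ℕ → ℕ | Function.IsPeriodicPt π k i}ᶜ := by
      ext π
      simp only [Set.mem_ofPred_eq, Set.mem_iInter, Set.mem_compl_iff, Set.mem_inter_iff]
      constructor
      · rintro rfl
        refine ⟨Function.isPeriodicPt_minimalPeriod π i, fun k hk hp => ?_⟩
        have := hp.minimalPeriod_le hk.1; omega
      · rintro ⟨h1, h2⟩
        have h3 := h1.minimalPeriod_le hj
        have h4 := h1.minimalPeriod_pos hj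
        by_contra hne
        exact h2 _ ⟨h4, lt_of_le_of_ne h3 hne⟩ (Function.isPeriodicPt_minimalPeriod π i)
    rw [this]
    exact (hper j i).inter
      (MeasurableSet.iInter fun k => MeasurableSet.iInter fun _ => (hper k i).compl)

/-- The number of points of the first block that lie on a cycle of length `j`. -/
noncomputable def blockCyclePoints (j : ℕ) (π : ℕ → ℕ) : ℕ :=
  cyclePoints π (firstSplit π).toNat j

lemma measurable_toNat_firstSplit : Measurable fun π => (firstSplit π).toNat :=
  (Measurable.of_discrete (f := ENat.toNat)).comp measurable_firstSplit

lemma measurable_blockCyclePoints (j : ℕ) : Measurable (blockCyclePoints j) := by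
  have h1 : Measurable fun p : ℕ × (ℕ → ℕ) => cyclePoints p.2 p.1 j :=
    measurable_from_prod_countable_right fun n => measurable_cyclePoints n j
  exact h1.comp (measurable_toNat_firstSplit.prodMk measurable_id)

lemma dependsOnFirstBlock_blockCyclePoints (j : ℕ) :
    DependsOnFirstBlock (blockCyclePoints j) := by
  intro n π π' h h' hag
  simp only [blockCyclePoints, h, h', ENat.toNat_natCast, cyclePoints]
  refine Finset.sum_congr rfl fun i hi => ?_
  rw [minimalPeriod_congr (firstSplit_eq_coe_iff.1 h).2.1 hag (Finset.mem_range.1 hi)]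

lemma integral_natCast_eq_toReal {E : Type*} [MeasurableSpace E] {μ : Measure E} {g : E → ℕ}
    (hg : Measurable g) (hfin : ∫⁻ x, (g x : ℝ≥0∞) ∂μ ≠ ∞) :
    Integrable (fun x => (g x : ℝ)) μ ∧
      ∫ x, (g x : ℝ) ∂μ = (∫⁻ x, (g x : ℝ≥0∞) ∂μ).toReal := by
  have hm : Measurable fun x => (g x : ℝ≥0∞) :=
    (Measurable.of_discrete (f := fun n : ℕ => (n : ℝ≥0∞))).comp hg
  have h1 := integrable_toReal_of_lintegral_ne_top hm.aemeasurable hfin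
  have h2 := integral_toReal hm.aemeasurable (ae_lt_top hm hfin)
  simp only [ENNReal.toReal_natCast] at h1 h2
  exact ⟨h1, h2⟩

namespace IsRegenLaw

variable {lam : Measure (ℕ → ℕ)}

lemma mul_lintegral_cycleCount (h : IsRegenLaw lam) (htop : ∀ᵐ π ∂lam, firstSplit π ≠ ⊤) (j : ℕ) :
    (j : ℝ≥0∞) * ∫⁻ π, (cycleCount π (firstSplit π).toNat j : ℝ≥0∞) ∂lam =
      ∫⁻ π, (blockCyclePoints j π : ℝ≥0∞) ∂lam := by
  rw [← lintegral_const_mul' _ _ (ENNReal.natCast_ne_top j)]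
  refine lintegral_congr_ae ?_
  filter_upwards [htop, h.bijective] with π hπ hb
  rw [blockCyclePoints, ← (splitsAt_firstSplit hπ).mul_cycleCount hb.injective j]
  push_cast; rfl

lemma lintegral_toNat_firstSplit (htop : ∀ᵐ π ∂lam, firstSplit π ≠ ⊤) :
    ∫⁻ π, ((firstSplit π).toNat : ℝ≥0∞) ∂lam = ∫⁻ π, (firstSplit π : ℝ≥0∞) ∂lam := by
  refine lintegral_congr_ae ?_
  filter_upwards [htop] with π hπ
  conv_rhs => rw [← coe_toNat_firstSplit hπ]
  simp

lemma tsum_mul_lintegral_cycleCount (h : IsRegenLaw lam) (htop : ∀ᵐ π ∂lam, firstSplit π ≠ ⊤) :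
    ∑' j : ℕ, (j : ℝ≥0∞) * ∫⁻ π, (cycleCount π (firstSplit π).toNat j : ℝ≥0∞) ∂lam =
      ∫⁻ π, (firstSplit π : ℝ≥0∞) ∂lam := by
  simp only [h.mul_lintegral_cycleCount htop]
  rw [← lintegral_toNat_firstSplit htop, ← lintegral_tsum]
  · simp only [blockCyclePoints, tsum_cyclePoints]
  · exact fun j => ((Measurable.of_discrete (f := fun n : ℕ => (n : ℝ≥0∞))).comp
      (measurable_blockCyclePoints j)).aemeasurable

/-- The frequencies of the cycles of length `j`: along the ends of the blocks this is the law of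
large numbers, in between the counts are monotone. -/
lemma ae_tendsto_cycleCount (h : IsRegenLaw lam)
    (hfin : ∫⁻ π, (firstSplit π : ℝ≥0∞) ∂lam < ∞) {j : ℕ} (hj : 1 ≤ j) :
    ∀ᵐ π ∂lam, Tendsto (fun n : ℕ => (cycleCount π n j : ℝ) / n) atTop
      (𝓝 ((∫⁻ π, (cycleCount π (firstSplit π).toNat j : ℝ≥0∞) ∂lam).toReal /
        (∫⁻ π, (firstSplit π : ℝ≥0∞) ∂lam).toReal)) := by
  have := h.prob
  have htop := ae_firstSplit_ne_top hfin
  have hY := lintegral_toNat_firstSplit htop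
  obtain ⟨hYi, hYe⟩ := integral_natCast_eq_toReal (μ := lam) measurable_toNat_firstSplit
    (by rw [hY]; exact hfin.ne)
  have hCle : ∫⁻ π, (blockCyclePoints j π : ℝ≥0∞) ∂lam ≠ ∞ := by
    refine ne_top_of_le_ne_top hfin.ne ?_
    rw [← hY]
    refine lintegral_mono fun π => ?_
    have := cyclePoints_le π (firstSplit π).toNat j
    simp only [blockCyclePoints]
    exact_mod_cast this
  obtain ⟨hCi, hCe⟩ := integral_natCast_eq_toReal (μ := lam) (measurable_blockCyclePoints j) hCle
  have hYdep : DependsOnFirstBlock fun π => ((firstSplit π).toNat : ℝ) := by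
    intro n π π' h1 h2 _; simp only [h1, h2]
  have hCdep : DependsOnFirstBlock fun π => (blockCyclePoints j π : ℝ) := by
    intro n π π' h1 h2 h3
    simp only [dependsOnFirstBlock_blockCyclePoints j n π π' h1 h2 h3]
  have hYm : Measurable fun π => ((firstSplit π).toNat : ℝ) :=
    (Measurable.of_discrete (f := fun n : ℕ => (n : ℝ))).comp measurable_toNat_firstSplit
  have hCm : Measurable fun π => (blockCyclePoints j π : ℝ) :=
    (Measurable.of_discrete (f := fun n : ℕ => (n : ℝ))).comp (measurable_blockCyclePoints j)
  set m := (∫⁻ π, (firstSplit π : ℝ≥0∞) ∂lam).toReal with hm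
  rw [hY] at hYe
  have hmpos : 0 < m := by
    have h1 : (1 : ℝ≥0∞) ≤ ∫⁻ π, (firstSplit π : ℝ≥0∞) ∂lam := by
      calc (1 : ℝ≥0∞) = ∫⁻ _, 1 ∂lam := by simp
        _ ≤ _ := lintegral_mono fun π => by
          have : (1 : ℕ∞) ≤ firstSplit π := Order.one_le_iff_pos.2 (firstSplit_pos π)
          simpa using ENat.toENNReal_le.2 this
    exact ENNReal.toReal_pos (by positivity) hfin.ne
  have hlim : (∫⁻ π, (cycleCount π (firstSplit π).toNat j : ℝ≥0∞) ∂lam).toReal / m =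
      (∫ π, (blockCyclePoints j π : ℝ) ∂lam) / m / j := by
    have hj0 : (j : ℝ) ≠ 0 := by positivity
    rw [hCe, ← h.mul_lintegral_cycleCount htop j, ENNReal.toReal_mul, ENNReal.toReal_natCast]
    field_simp
  rw [hlim]
  filter_upwards [h.ae_exists_splitsAt_gt htop, h.bijective,
    h.strong_law_blocks htop hYm hYdep hYi, h.strong_law_blocks htop hCm hCdep hCi]
    with π hπ hb hlY hlC
  have hT : ∀ k, (blockTime π k : ℝ) =
      ∑ i ∈ Finset.range k, ((firstSplit (dropBlock^[i] π)).toNat : ℝ) := by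
    intro k; rw [blockTime]; push_cast; rfl
  have hcount : ∀ k, cyclePoints π (blockTime π k) j =
      ∑ i ∈ Finset.range k, blockCyclePoints j (dropBlock^[i] π) := by
    intro k
    induction k with
    | zero => simp [blockTime, cyclePoints]
    | succ k ih =>
      obtain ⟨h1, h2⟩ := dropBlock_iterate hπ k
      rw [Finset.sum_range_succ, ← ih, blockTime, Finset.sum_range_succ, ← blockTime,
        h1.cyclePoints_add, h2, blockCyclePoints]
  have hmono : StrictMono (blockTime π) := strictMono_nat_of_lt_succ (blockTime_lt_succ hπ)
  rw [hYe] at hlY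
  simp only [← hT] at hlY
  have hlY' : Tendsto (fun n : ℕ => (n : ℝ) / blockTime π n) atTop (𝓝 m⁻¹) := by
    refine (hlY.inv₀ hmpos.ne').congr fun n => ?_
    rw [inv_div]
  have hratio : Tendsto (fun n : ℕ => (blockTime π (n + 1) : ℝ) / blockTime π n) atTop (𝓝 1) := by
    have h1 := hlY.comp (tendsto_add_atTop_nat 1)
    have h2 : Tendsto (fun n : ℕ => ((n : ℝ) + 1) / n) atTop (𝓝 1) := by
      have h0 := (tendsto_one_div_atTop_nhds_zero_nat (𝕜 := ℝ)).const_add 1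
      rw [add_zero] at h0
      refine h0.congr' ?_
      filter_upwards [eventually_gt_atTop 0] with n hn
      have hn' : (n : ℝ) ≠ 0 := by positivity
      field_simp
    have h3 := (h1.mul h2).mul hlY'
    rw [mul_one, mul_inv_cancel₀ hmpos.ne'] at h3
    refine h3.congr' ?_
    filter_upwards [eventually_gt_atTop 0] with n hn
    have hn' : (n : ℝ) ≠ 0 := by positivity
    simp only [Function.comp_apply]
    push_cast
    field_simp
  refine tendsto_div_of_monotone_of_exists_subseq_tendsto_div _ _
    (fun a b hab => by exact_mod_cast cycleCount_mono π j hab) fun a ha =>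
    ⟨blockTime π, ?_, hmono.tendsto_atTop, ?_⟩
  · filter_upwards [hratio.eventually (gt_mem_nhds ha), eventually_gt_atTop 0] with n hn hn0
    have : 0 < blockTime π n := (Nat.zero_le _).trans_lt (hmono hn0)
    exact ((div_lt_iff₀ (by exact_mod_cast this)).1 hn).le
  · have h1 := (hlC.mul hlY').div_const (j : ℝ)
    rw [← div_eq_mul_inv] at h1
    refine h1.congr' ?_
    filter_upwards [eventually_gt_atTop 0] with n hn
    have hn' : (n : ℝ) ≠ 0 := by positivity
    have hj0 : (j : ℝ) ≠ 0 := by positivity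
    have hc : (j : ℝ) * cycleCount π (blockTime π n) j =
        ∑ i ∈ Finset.range n, (blockCyclePoints j (dropBlock^[i] π) : ℝ) := by
      exact_mod_cast ((dropBlock_iterate hπ n).1.mul_cycleCount hb.injective j).trans (hcount n)
    rw [← hc]
    field_simp

end IsRegenLaw

/-! ### Two-sided extension of a one-sided stationary process -/

/-- The sequence seen from the position `k` on. -/
def shiftSeq {A : Type*} (k : ℕ) (x : ℕ → A) : ℕ → A := fun i => x (k + i)

/-- A two-sided sequence seen from the position `a` on. -/
def halfLine {A : Type*} (a : ℤ) (x : ℤ → A) : ℕ → A := fun i => x (a + i)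

lemma measurable_shiftSeq {A : Type*} [MeasurableSpace A] (k : ℕ) :
    Measurable (shiftSeq k : (ℕ → A) → ℕ → A) :=
  measurable_pi_iff.2 fun i => measurable_pi_apply (k + i)

lemma measurable_halfLine {A : Type*} [MeasurableSpace A] (a : ℤ) :
    Measurable (halfLine a : (ℤ → A) → ℕ → A) :=
  measurable_pi_iff.2 fun i => measurable_pi_apply (a + i)

lemma shiftSeq_shiftSeq {A : Type*} (k l : ℕ) (x : ℕ → A) :
    shiftSeq l (shiftSeq k x) = shiftSeq (k + l) x := by
  funext i; simp [shiftSeq, add_assoc]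

lemma map_comap_compProd {α β γ : Type*} [MeasurableSpace α] [MeasurableSpace β]
    [MeasurableSpace γ] (ν : Measure α) [IsFiniteMeasure ν] (κ : Kernel β γ) [IsMarkovKernel κ]
    {g : α → β} (hg : Measurable g) :
    (ν ⊗ₘ κ.comap g hg).map (Prod.map g id) = ν.map g ⊗ₘ κ := by
  ext s hs
  rw [Measure.map_apply (hg.prodMap measurable_id) hs, Measure.compProd_apply hs,
    Measure.compProd_apply (hs.preimage (hg.prodMap measurable_id)),
    lintegral_map (Kernel.measurable_kernel_prodMk_left hs) hg]
  rfl

lemma map_zero_trajMeasure {X : Type*} [MeasurableSpace X] {μ₀ : Measure X}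
    [IsProbabilityMeasure μ₀]
    (κ : (n : ℕ) → Kernel ((i : Finset.Iic n) → X) X) [∀ n, IsMarkovKernel (κ n)] :
    (Kernel.trajMeasure (X := fun _ => X) μ₀ κ).map (fun x => x 0) = μ₀ := by
  have e : (fun x : ℕ → X => x 0) =
      (fun y : (i : Finset.Iic 0) → X => y ⟨0, by simp⟩) ∘ Preorder.frestrictLe 0 := rfl
  have hlast : Measurable fun y : (i : Finset.Iic 0) → X => y ⟨0, by simp⟩ :=
    measurable_pi_apply _
  rw [e, ← Measure.map_map hlast (Preorder.measurable_frestrictLe 0),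
    Kernel.trajMeasure, Measure.map_comp _ _ (Preorder.measurable_frestrictLe 0),
    Kernel.traj_map_frestrictLe, Kernel.partialTraj_self, Measure.id_comp,
    Measure.map_map hlast (MeasurableEquiv.measurable _)]
  exact Measure.map_id

/-- The two-sided sequence that a compatible chain of one-sided sequences defines: the `n`-th
sequence of the chain starts at the position `-n`. -/
def glue {A : Type*} (x : ℕ → ℕ → A) : ℤ → A := fun z => x z.natAbs (z + z.natAbs).toNat

lemma halfLine_glue {A : Type*} {x : ℕ → ℕ → A} (hx : ∀ n, shiftSeq 1 (x (n + 1)) = x n) (a : ℤ) :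
    halfLine a (glue x) = shiftSeq (a + a.natAbs).toNat (x a.natAbs) := by
  have h1 : ∀ n k i, x (n + k) (k + i) = x n i := by
    intro n k
    induction k with
    | zero => intro i; simp
    | succ k ih =>
      intro i
      rw [← ih i, ← hx (n + k), shiftSeq, ← add_assoc]
      congr 1; omega
  have h2 : ∀ n i m j : ℕ, (i : ℤ) - n = j - m → x n i = x m j := by
    intro n i m j h
    rcases le_total n m with hle | hle
    · obtain ⟨k, rfl⟩ := Nat.exists_eq_add_of_le hle
      rw [← h1 n k i]; congr 1; omega
    · obtain ⟨k, rfl⟩ := Nat.exists_eq_add_of_le hle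
      rw [← h1 m k j]; congr 1; omega
  funext i
  exact h2 _ _ _ _ (by omega)

/-- Natural extension: the chain of one-sided sequences is a Markov chain whose transition law is
the conditional law of a sequence given its shift. -/
lemma exists_two_sided {A : Type*} [MeasurableSpace A] [StandardBorelSpace A] [Nonempty A]
    (P : Measure (ℕ → A)) [IsProbabilityMeasure P] (hP : P.map (shiftSeq 1) = P) :
    ∃ Q : Measure (ℤ → A), IsProbabilityMeasure Q ∧ ∀ a : ℤ, Q.map (halfLine a) = P := by
  have hS := measurable_shiftSeq (A := A) 1
  have hSid : Measurable fun x : ℕ → A => (shiftSeq 1 x, x) := hS.prodMk measurable_id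
  set κ₀ : Kernel (ℕ → A) (ℕ → A) := condDistrib id (shiftSeq 1) P with hκ₀
  have hcond : P ⊗ₘ κ₀ = P.map (fun x => (shiftSeq 1 x, x)) := by
    have := compProd_map_condDistrib (mβ := MeasurableSpace.pi) (μ := P) 
      (X := shiftSeq 1) (Y := id) aemeasurable_id
    rwa [hP] at this
  have hlast : ∀ n : ℕ, Measurable fun y : (i : Finset.Iic n) → (ℕ → A) => y ⟨n, by simp⟩ :=
    fun n => measurable_pi_apply _
  set κ : (n : ℕ) → Kernel ((i : Finset.Iic n) → (ℕ → A)) (ℕ → A) :=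
    fun n => κ₀.comap _ (hlast n) with hκ
  have hmk : ∀ n, IsMarkovKernel (κ n) := fun n => by rw [hκ]; infer_instance
  set ν := Kernel.trajMeasure (X := fun _ => ℕ → A) P κ with hν
  have hstep : ∀ n : ℕ, ν.map (fun x => x n) ⊗ₘ κ₀ = ν.map (fun x => (x n, x (n + 1))) := by
    intro n
    have h1 := Kernel.map_frestrictLe_trajMeasure_compProd_eq_map_trajMeasure
      (X := fun _ => ℕ → A) (μ₀ := P) (κ := κ) (a := n)
    rw [← hν] at h1
    have hf : Measurable (Preorder.frestrictLe (π := fun _ : ℕ => ℕ → A) n) :=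
      Preorder.measurable_frestrictLe n
    have := Measure.isProbabilityMeasure_map (μ := ν) hf.aemeasurable
    have h2 := map_comap_compProd (ν.map (Preorder.frestrictLe n)) κ₀ (hlast n)
    rw [Measure.map_map (hlast n) hf] at h2
    have h3 : (fun y : (i : Finset.Iic n) → (ℕ → A) => y ⟨n, by simp⟩) ∘
        Preorder.frestrictLe (π := fun _ : ℕ => ℕ → A) n = fun x => x n := rfl
    rw [h3] at h2
    rw [← h2]
    change ((ν.map (Preorder.frestrictLe n)) ⊗ₘ κ n).map _ = _
    rw [h1, Measure.map_map ((hlast n).prodMap measurable_id)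
      (hf.prodMk (measurable_pi_apply (n + 1)))]
    rfl
  have hpair : ∀ n : ℕ, Measurable fun x : ℕ → ℕ → A => (x n, x (n + 1)) := fun n =>
    (measurable_pi_apply n).prodMk (measurable_pi_apply (n + 1))
  have hmarg : ∀ n : ℕ, ν.map (fun x => x n) = P := by
    intro n
    induction n with
    | zero => exact map_zero_trajMeasure κ
    | succ n ih =>
      have h1 := hstep n
      rw [ih, hcond] at h1
      have h2 := congrArg (fun m => m.map Prod.snd) h1
      rw [Measure.map_map measurable_snd hSid,
        Measure.map_map measurable_snd (hpair n)] at h2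
      exact h2.symm.trans Measure.map_id
  have hcompat : ∀ᵐ x ∂ν, ∀ n, shiftSeq 1 (x (n + 1)) = x n := by
    rw [ae_all_iff]
    intro n
    have h1 := hstep n
    rw [hmarg n, hcond] at h1
    have hm : MeasurableSet {p : (ℕ → A) × (ℕ → A) | shiftSeq 1 p.2 = p.1} :=
      measurableSet_eq_fun (hS.comp measurable_snd) measurable_fst
    have h2 : ∀ᵐ p ∂(P.map fun x => (shiftSeq 1 x, x)), shiftSeq 1 p.2 = p.1 :=
      (ae_map_iff hSid.aemeasurable hm).2 (Eventually.of_forall fun x => rfl)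
    rw [h1] at h2
    exact ae_of_ae_map (hpair n).aemeasurable h2
  have hshift : ∀ k, P.map (shiftSeq k) = P := by
    intro k
    induction k with
    | zero =>
      have : (shiftSeq 0 : (ℕ → A) → ℕ → A) = id := by funext x i; simp [shiftSeq]
      rw [this, Measure.map_id]
    | succ k ih =>
      have : (shiftSeq (k + 1) : (ℕ → A) → ℕ → A) = shiftSeq 1 ∘ shiftSeq k := by
        funext x; exact (shiftSeq_shiftSeq k 1 x).symm
      rw [this, ← Measure.map_map hS (measurable_shiftSeq k), ih, hP]
  have hglue : Measurable (glue : (ℕ → ℕ → A) → ℤ → A) :=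
    measurable_pi_iff.2 fun z => (measurable_pi_apply _).comp (measurable_pi_apply _)
  refine ⟨ν.map glue, Measure.isProbabilityMeasure_map hglue.aemeasurable, fun a => ?_⟩
  rw [Measure.map_map (measurable_halfLine a) hglue]
  have hae : halfLine a ∘ glue =ᵐ[ν] shiftSeq (a + a.natAbs).toNat ∘ fun x => x a.natAbs := by
    filter_upwards [hcompat] with x hx
    exact halfLine_glue hx a
  rw [Measure.map_congr hae, ← Measure.map_map (measurable_shiftSeq _) (measurable_pi_apply _),
    hmarg, hshift]

/-- The law of a two-sided sequence is determined by its restrictions to the half-lines. -/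
lemma two_sided_ext {A : Type*} [MeasurableSpace A] {Q Q' : Measure (ℤ → A)} [IsFiniteMeasure Q']
    (h : ∀ a : ℤ, Q.map (halfLine a) = Q'.map (halfLine a)) : Q = Q' := by
  refine IsProjectiveLimit.unique (P := fun J : Finset ℤ => Q'.map J.restrict) (fun J => ?_)
    fun J => rfl
  obtain ⟨a, ha⟩ := J.bddBelow
  set g : (ℕ → A) → (J → A) := fun x j => x ((j : ℤ) - a).toNat with hg
  have hgm : Measurable g := measurable_pi_iff.2 fun j => measurable_pi_apply _
  have e : (J.restrict : (ℤ → A) → (J → A)) = g ∘ halfLine a := by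
    funext x j
    have := ha j.2
    simp only [hg, Finset.restrict, Function.comp_apply, halfLine]
    congr 1; omega
  rw [e, ← Measure.map_map hgm (measurable_halfLine a), h a,
    Measure.map_map hgm (measurable_halfLine a), ← e]

/-! ### The stationary version -/

/-- The displacements of `π` together with the marks of its splitting times. -/
def trace (π : ℕ → ℕ) : ℕ → ℤ × Prop := fun i => ((π i : ℤ) - i, SplitsAt π i)

lemma measurable_trace : Measurable trace :=
  measurable_pi_iff.2 fun i =>
    ((Measurable.of_discrete (f := fun n : ℕ => (n : ℤ) - i)).comp (measurable_pi_apply i)).prodMk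
      (measurableSet_setOfPred.1 (measurableSet_splitsAt i))

lemma SplitsAt.trace_residual {π : ℕ → ℕ} {n : ℕ} (h : SplitsAt π n) :
    trace (residual n π) = shiftSeq n (trace π) := by
  funext i
  have h1 := h.add_residual i
  refine Prod.ext ?_ (propext (h.residual_iff i))
  simp only [trace, shiftSeq]; omega

/-- The one-sided stationary law: the trace of the permutation is seen from a uniform random
position in its first block, under the law biased by the length of this block. -/
noncomputable def stationaryTrace (lam : Measure (ℕ → ℕ)) : Measure (ℕ → ℤ × Prop) :=
  (∫⁻ π, (firstSplit π : ℝ≥0∞) ∂lam)⁻¹ • Measure.sum fun k : ℕ =>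
    (lam.restrict {π | (k : ℕ∞) < firstSplit π}).map (fun π => shiftSeq k (trace π))

lemma measurable_shiftSeq_trace (k : ℕ) : Measurable fun π => shiftSeq k (trace π) :=
  (measurable_shiftSeq k).comp measurable_trace

lemma stationaryTrace_apply {lam : Measure (ℕ → ℕ)} {B : Set (ℕ → ℤ × Prop)}
    (hB : MeasurableSet B) :
    stationaryTrace lam B = (∫⁻ π, (firstSplit π : ℝ≥0∞) ∂lam)⁻¹ *
      ∑' k : ℕ, lam ({π | (k : ℕ∞) < firstSplit π} ∩ {π | shiftSeq k (trace π) ∈ B}) := by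
  rw [stationaryTrace, Measure.smul_apply, Measure.sum_apply _ hB, smul_eq_mul]
  congr 1
  refine tsum_congr fun k => ?_
  have hm := measurable_shiftSeq_trace k
  rw [Measure.map_apply hm hB, Measure.restrict_apply (hB.preimage hm), Set.inter_comm]
  rfl

lemma ae_stationaryTrace {lam : Measure (ℕ → ℕ)} {p : (ℕ → ℤ × Prop) → Prop}
    (hp : MeasurableSet {x | p x}) (h : ∀ᵐ π ∂lam, ∀ k, p (shiftSeq k (trace π))) :
    ∀ᵐ x ∂stationaryTrace lam, p x := by
  refine Measure.ae_smul_measure (Measure.ae_sum_iff.2 fun k => ?_) _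
  refine (ae_map_iff (measurable_shiftSeq_trace k).aemeasurable hp).2 (ae_restrict_of_ae ?_)
  filter_upwards [h] with π hπ using hπ k

namespace IsRegenLaw

variable {lam : Measure (ℕ → ℕ)}

lemma one_le_lintegral_firstSplit (h : IsRegenLaw lam) :
    1 ≤ ∫⁻ π, (firstSplit π : ℝ≥0∞) ∂lam := by
  have := h.prob
  calc (1 : ℝ≥0∞) = ∫⁻ _, 1 ∂lam := by simp
    _ ≤ _ := lintegral_mono fun π => by
      have : (1 : ℕ∞) ≤ firstSplit π := Order.one_le_iff_pos.2 (firstSplit_pos π)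
      simpa using ENat.toENNReal_le.2 this

lemma isProbabilityMeasure_stationaryTrace (h : IsRegenLaw lam)
    (hfin : ∫⁻ π, (firstSplit π : ℝ≥0∞) ∂lam < ∞) :
    IsProbabilityMeasure (stationaryTrace lam) := by
  refine ⟨?_⟩
  rw [stationaryTrace_apply MeasurableSet.univ]
  simp only [Set.mem_univ, Set.ofPred_true, Set.inter_univ]
  rw [← lintegral_enat_eq_tsum measurableSet_lt_firstSplit]
  exact ENNReal.inv_mul_cancel (zero_lt_one.trans_le h.one_le_lintegral_firstSplit).ne' hfin.ne

/-- A step of the shift moves the position inside the first block, or to the start of the second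
block, from where the trace has the same law as from the start of the first one. -/
lemma map_shiftSeq_stationaryTrace (h : IsRegenLaw lam)
    (hfin : ∫⁻ π, (firstSplit π : ℝ≥0∞) ∂lam < ∞) :
    (stationaryTrace lam).map (shiftSeq 1) = stationaryTrace lam := by
  have := h.prob
  have htop := ae_firstSplit_ne_top hfin
  ext B hB
  rw [Measure.map_apply (measurable_shiftSeq 1) hB,
    stationaryTrace_apply (hB.preimage (measurable_shiftSeq 1)), stationaryTrace_apply hB]
  congr 1
  have hmB : ∀ k, MeasurableSet {π | shiftSeq k (trace π) ∈ B} := fun k =>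
    hB.preimage (measurable_shiftSeq_trace k)
  have hstep : ∀ k : ℕ, lam ({π | (k : ℕ∞) < firstSplit π} ∩
      {π | shiftSeq k (trace π) ∈ shiftSeq 1 ⁻¹' B}) =
      lam ({π | ((k + 1 : ℕ) : ℕ∞) < firstSplit π} ∩ {π | shiftSeq (k + 1) (trace π) ∈ B}) +
        lam {π | firstSplit π = (k + 1 : ℕ)} * lam {π | trace π ∈ B} := by
    intro k
    have hsplit : {π | (k : ℕ∞) < firstSplit π} ∩
        {π | shiftSeq k (trace π) ∈ shiftSeq 1 ⁻¹' B} =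
        ({π | ((k + 1 : ℕ) : ℕ∞) < firstSplit π} ∩ {π | shiftSeq (k + 1) (trace π) ∈ B}) ∪
        ({π | firstSplit π = (k + 1 : ℕ)} ∩ residual (k + 1) ⁻¹' {π | trace π ∈ B}) := by
      ext π
      simp only [Set.mem_inter_iff, Set.mem_union, Set.mem_ofPred_eq, Set.mem_preimage,
        shiftSeq_shiftSeq]
      have h1 : (k : ℕ∞) < firstSplit π ↔
          ((k + 1 : ℕ) : ℕ∞) < firstSplit π ∨ firstSplit π = (k + 1 : ℕ) := by
        rw [← ENat.add_one_le_iff (ENat.natCast_ne_top k), le_iff_lt_or_eq, Nat.cast_add,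
          Nat.cast_one, eq_comm (a := firstSplit π)]
      rw [h1, or_and_right]
      refine or_congr_right (and_congr_right fun hY => ?_)
      rw [(firstSplit_eq_coe_iff.1 hY).2.1.trace_residual]
    rw [hsplit, measure_union]
    · congr 1
      have h1 := h.regen_firstSplit (k + 1) MeasurableSet.univ (dependsOnPast_univ _)
        (hB.preimage measurable_trace)
      rwa [Set.inter_univ] at h1
    · rw [Set.disjoint_left]
      rintro π ⟨h1, -⟩ ⟨h2, -⟩
      rw [Set.mem_ofPred_eq] at h1 h2
      rw [h2] at h1; exact lt_irrefl _ h1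
    · exact (measurableSet_firstSplit_eq _).inter
        ((hB.preimage measurable_trace).preimage (measurable_residual _))
  rw [tsum_congr hstep, ENNReal.tsum_add, ENNReal.tsum_mul_right]
  have hone : ∑' k : ℕ, lam {π | firstSplit π = (k + 1 : ℕ)} = 1 := by
    have h1 := measure_eq_tsum_firstSplit htop (lam := lam) MeasurableSet.univ
    simp only [measure_univ, Set.inter_univ] at h1
    rw [tsum_eq_zero_add' ENNReal.summable] at h1
    have h0 : {π : ℕ → ℕ | firstSplit π = ((0 : ℕ) : ℕ∞)} = ∅ := by
      ext π; simp [(firstSplit_pos π).ne']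
    rw [h0, measure_empty, zero_add] at h1
    exact h1.symm
  rw [hone, one_mul]
  conv_rhs => rw [tsum_eq_zero_add' ENNReal.summable]
  rw [add_comm]
  congr 1
  congr 1
  ext π
  have : shiftSeq 0 (trace π) = trace π := by funext i; simp [shiftSeq]
  simp [this, firstSplit_pos π]

/-- Under the stationary law, conditionally on a split at the origin, the trace is that of the
original permutation. -/
lemma stationaryTrace_split {C : Set (ℕ → ℤ × Prop)} (hC : MeasurableSet C) :
    stationaryTrace lam ({x | (x 0).2} ∩ C) =
      (∫⁻ π, (firstSplit π : ℝ≥0∞) ∂lam)⁻¹ * lam (trace ⁻¹' C) := by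
  have hm : MeasurableSet {x : ℕ → ℤ × Prop | (x 0).2} :=
    measurableSet_setOfPred.2 (measurable_snd.comp (measurable_pi_apply 0))
  rw [stationaryTrace_apply (hm.inter hC)]
  congr 1
  rw [tsum_eq_single 0]
  · congr 1
    ext π
    have h0 : shiftSeq 0 (trace π) = trace π := by funext i; simp [shiftSeq]
    have h1 : (trace π 0).2 := splitsAt_zero π
    simp [h0, firstSplit_pos π, h1]
  · intro k hk
    convert measure_empty (μ := lam)
    ext π
    simp only [Set.mem_inter_iff, Set.mem_ofPred_eq, Set.mem_empty_iff_false, iff_false]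
    rintro ⟨h1, h2, -⟩
    exact coe_lt_firstSplit_iff.1 h1 k (Nat.pos_of_ne_zero hk) le_rfl h2

end IsRegenLaw

/-- The properties of the trace of a permutation, seen from an arbitrary position, that are used
for its two-sided extension. The last one says that no splitting time after the first mark remains
unmarked; it refers to a mark `s` since positions before the origin are not seen. -/
structure GoodTrace (x : ℕ → ℤ × Prop) : Prop where
  inj : ∀ i j : ℕ, i ≠ j → (i : ℤ) + (x i).1 ≠ j + (x j).1
  split : ∀ i k : ℕ, (x k).2 → ((i : ℤ) + (x i).1 < k ↔ i < k)
  split_gt : ∀ i : ℕ, ∃ n > i, (x n).2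
  of_split : ∀ s z : ℕ, s ≤ z → (x s).2 →
    (∀ i : ℕ, s ≤ i → ((i : ℤ) + (x i).1 < z ↔ i < z)) → (x z).2

lemma measurableSet_goodTrace : MeasurableSet {x | GoodTrace x} := by
  have e : {x | GoodTrace x} = {x : ℕ → ℤ × Prop |
      (∀ i j : ℕ, i ≠ j → (i : ℤ) + (x i).1 ≠ j + (x j).1) ∧
      (∀ i k : ℕ, (x k).2 → ((i : ℤ) + (x i).1 < k ↔ i < k)) ∧
      (∀ i : ℕ, ∃ n, n > i ∧ (x n).2) ∧
      ∀ s z : ℕ, s ≤ z → (x s).2 →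
        (∀ i : ℕ, s ≤ i → ((i : ℤ) + (x i).1 < z ↔ i < z)) → (x z).2} := by
    ext x
    exact ⟨fun h => ⟨h.1, h.2, h.3, h.4⟩, fun h => ⟨h.1, h.2.1, h.2.2.1, h.2.2.2⟩⟩
  have hfl : ∀ k : ℕ, Measurable fun x : ℕ → ℤ × Prop => (x k).2 := fun k =>
    measurable_snd.comp (measurable_pi_apply k)
  have hlt : ∀ (i k : ℕ), Measurable fun x : ℕ → ℤ × Prop => ((i : ℤ) + (x i).1 < k ↔ i < k) :=
    fun i k => (Measurable.of_discrete
      (f := fun a : ℤ × Prop => ((i : ℤ) + a.1 < k ↔ i < k))).comp (measurable_pi_apply i)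
  have hne : ∀ (i j : ℕ), Measurable fun x : ℕ → ℤ × Prop => (i : ℤ) + (x i).1 ≠ j + (x j).1 :=
    fun i j => by
      have hp : Measurable fun x : ℕ → ℤ × Prop => (x i, x j) :=
        (measurable_pi_apply i).prodMk (measurable_pi_apply j)
      exact (Measurable.of_discrete
        (f := fun a : (ℤ × Prop) × (ℤ × Prop) => (i : ℤ) + a.1.1 ≠ j + a.2.1)).comp hp
  rw [e]
  refine measurableSet_setOfPred.2 ?_
  refine Measurable.and ?_ (Measurable.and ?_ (Measurable.and ?_ ?_))
  · exact Measurable.forall fun i => Measurable.forall fun j => measurable_const.imp (hne i j)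
  · exact Measurable.forall fun i => Measurable.forall fun k => (hfl k).imp (hlt i k)
  · exact Measurable.forall fun i => Measurable.exists fun n => measurable_const.and (hfl n)
  · exact Measurable.forall fun s => Measurable.forall fun z => measurable_const.imp
      ((hfl s).imp ((Measurable.forall fun i => measurable_const.imp (hlt i z)).imp (hfl z)))

lemma goodTrace_shiftSeq {π : ℕ → ℕ} (hinj : Function.Injective π)
    (hs : ∀ i : ℕ, ∃ n > i, SplitsAt π n) (k : ℕ) : GoodTrace (shiftSeq k (trace π)) := by
  refine ⟨?_, ?_, ?_, ?_⟩
  · intro i j hij he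
    simp only [shiftSeq, trace] at he
    have : π (k + i) = π (k + j) := by omega
    have := hinj this
    omega
  · intro i n hn
    have h1 : SplitsAt π (k + n) := hn
    have := h1 (k + i)
    simp only [shiftSeq, trace]; omega
  · intro i
    obtain ⟨n, hn, h⟩ := hs (k + i)
    refine ⟨n - k, by omega, ?_⟩
    simp only [shiftSeq, trace]
    rwa [Nat.add_sub_cancel' (by omega)]
  · intro s z hsz hss h
    have h1 : SplitsAt π (k + s) := hss
    intro i
    by_cases hi : i < k + s
    · have := h1 i; omega
    · obtain ⟨j, rfl⟩ := Nat.exists_eq_add_of_le (not_lt.1 hi)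
      have h2 := h (s + j) (Nat.le_add_right s j)
      simp only [shiftSeq, trace, ← add_assoc] at h2
      push_cast at h2
      omega

/-- The permutation with the displacements `x`. -/
def ofTrace (x : ℤ → ℤ × Prop) : ℤ → ℤ := fun z => z + (x z).1

lemma measurable_ofTrace : Measurable ofTrace :=
  measurable_pi_iff.2 fun z =>
    (Measurable.of_discrete (f := fun a : ℤ × Prop => z + a.1)).comp (measurable_pi_apply z)

/-- A two-sided trace that is good on all half-lines and has arbitrarily early splits. -/
structure GoodTraceInt (x : ℤ → ℤ × Prop) : Prop where
  good : ∀ a, GoodTrace (halfLine a x)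
  split_lt : ∀ z : ℤ, ∃ t < z, (x t).2

namespace GoodTraceInt

variable {x : ℤ → ℤ × Prop}

lemma splitsAtInt_iff (h : GoodTraceInt x) (z : ℤ) : SplitsAtInt (ofTrace x) z ↔ (x z).2 := by
  constructor
  · intro hs
    obtain ⟨t, htz, ht⟩ := h.split_lt z
    have h1 := (h.good t).of_split 0 (z - t).toNat (Nat.zero_le _) (by simpa [halfLine] using ht) ?_
    · have e : t + ((z - t).toNat : ℤ) = z := by omega
      simpa only [halfLine, e] using h1
    · intro i _
      have := hs (t + i)
      simp only [halfLine, ofTrace] at this ⊢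
      omega
  · intro hz i
    obtain ⟨a, hai, haz⟩ : ∃ a : ℤ, a ≤ i ∧ a ≤ z := ⟨min i z, min_le_left _ _, min_le_right _ _⟩
    have e1 : a + ((i - a).toNat : ℤ) = i := by omega
    have e2 : a + ((z - a).toNat : ℤ) = z := by omega
    have h1 := (h.good a).split (i - a).toNat (z - a).toNat (by simpa only [halfLine, e2] using hz)
    simp only [halfLine, e1] at h1
    simp only [ofTrace]
    omega

lemma split_gt (h : GoodTraceInt x) (z : ℤ) : ∃ t > z, (x t).2 := by
  obtain ⟨n, hn, hs⟩ := (h.good z).split_gt 0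
  exact ⟨z + n, by omega, hs⟩

lemma bijective (h : GoodTraceInt x) : Function.Bijective (ofTrace x) := by
  have hinj : Function.Injective (ofTrace x) := by
    intro i j hij
    by_contra hne
    obtain ⟨a, hai, haz⟩ : ∃ a : ℤ, a ≤ i ∧ a ≤ j := ⟨min i j, min_le_left _ _, min_le_right _ _⟩
    have e1 : a + ((i - a).toNat : ℤ) = i := by omega
    have e2 : a + ((j - a).toNat : ℤ) = j := by omega
    have h1 := (h.good a).inj (i - a).toNat (j - a).toNat (by omega)
    simp only [halfLine, e1, e2] at h1
    simp only [ofTrace] at hij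
    omega
  refine ⟨hinj, fun z => ?_⟩
  -- Between two splits around `z` lies a finite interval that is mapped into itself.
  obtain ⟨s, hsz, hs⟩ := h.split_lt z
  obtain ⟨e, hez, he⟩ := h.split_gt z
  have hs' := (h.splitsAtInt_iff s).2 hs
  have he' := (h.splitsAtInt_iff e).2 he
  have himg : (Finset.Ico s e).image (ofTrace x) = Finset.Ico s e := by
    refine Finset.eq_of_subset_of_card_le ?_ (Finset.card_image_of_injective _ hinj).ge
    intro y hy
    obtain ⟨i, hi, rfl⟩ := Finset.mem_image.1 hy
    rw [Finset.mem_Ico] at hi ⊢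
    have h1 := hs' i; have h2 := he' i; omega
  have hz : z ∈ (Finset.Ico s e).image (ofTrace x) := by
    rw [himg, Finset.mem_Ico]; omega
  obtain ⟨i, -, hi⟩ := Finset.mem_image.1 hz
  exact ⟨i, hi⟩

end GoodTraceInt

/-- The one-sided permutation with the displacements `y`. -/
def ofTraceNat (y : ℕ → ℤ × Prop) : ℕ → ℕ := fun i => ((i : ℤ) + (y i).1).toNat

lemma measurable_ofTraceNat : Measurable ofTraceNat :=
  measurable_pi_iff.2 fun i =>
    (Measurable.of_discrete (f := fun a : ℤ × Prop => ((i : ℤ) + a.1).toNat)).comp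
      (measurable_pi_apply i)

lemma residualInt_ofTrace (z : ℤ) (x : ℤ → ℤ × Prop) :
    residualInt z (ofTrace x) = ofTraceNat (halfLine z x) := by
  funext i
  simp only [residualInt, ofTrace, ofTraceNat, halfLine]
  congr 1; omega

lemma ofTraceNat_trace (π : ℕ → ℕ) : ofTraceNat (trace π) = π := by
  funext i; simp [ofTraceNat, trace]

lemma measurableSet_splitsAtInt (z : ℤ) : MeasurableSet {σ : ℤ → ℤ | SplitsAtInt σ z} :=
  measurableSet_setOfPred.2 (Measurable.forall fun i =>
    (Measurable.of_discrete (f := fun a : ℤ => (a < z ↔ i < z))).comp (measurable_pi_apply i))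

lemma measurable_residualInt (z : ℤ) : Measurable (residualInt z) :=
  measurable_pi_iff.2 fun i =>
    (Measurable.of_discrete (f := fun a : ℤ => (a - z).toNat)).comp (measurable_pi_apply (z + i))

lemma measurable_splits_le (z : ℤ) :
    Measurable fun σ : ℤ → ℤ => {t : ℤ | t ≤ z ∧ SplitsAtInt σ t} :=
  measurable_pi_iff.2 fun t => measurable_const.and
    (measurableSet_setOfPred.1 (measurableSet_splitsAtInt t))

namespace IsRegenLaw

variable {lam : Measure (ℕ → ℕ)}

lemma ae_goodTraceInt (h : IsRegenLaw lam) (hfin : ∫⁻ π, (firstSplit π : ℝ≥0∞) ∂lam < ∞)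
    {Q : Measure (ℤ → ℤ × Prop)} (hQ : ∀ a, Q.map (halfLine a) = stationaryTrace lam) :
    ∀ᵐ x ∂Q, GoodTraceInt x := by
  have := h.isProbabilityMeasure_stationaryTrace hfin
  have hgood1 : ∀ᵐ x ∂stationaryTrace lam, GoodTrace x := by
    refine ae_stationaryTrace measurableSet_goodTrace ?_
    filter_upwards [h.bijective, h.ae_exists_splitsAt_gt (ae_firstSplit_ne_top hfin)]
      with π hb hs k using goodTrace_shiftSeq hb.injective hs k
  have hgood : ∀ᵐ x ∂Q, ∀ a, GoodTrace (halfLine a x) := by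
    rw [ae_all_iff]
    intro a
    rw [← hQ a] at hgood1
    exact ae_of_ae_map (measurable_halfLine a).aemeasurable hgood1
  -- The probability of no split in `[z - n, z)` is that of no split in `[0, n)` and tends to `0`.
  have hlt : ∀ᵐ x ∂Q, ∀ z : ℤ, ∃ t < z, (x t).2 := by
    rw [ae_all_iff]
    intro z
    rw [ae_iff]
    set s : ℕ → Set (ℕ → ℤ × Prop) := fun n => {x | ∀ i < n, ¬ (x i).2} with hs
    have hsm : ∀ n, MeasurableSet (s n) := fun n =>
      measurableSet_setOfPred.2 (Measurable.forall fun i => measurable_const.imp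
        (measurable_snd.comp (measurable_pi_apply i)).not)
    have hanti : Antitone s := fun m n hmn x hx i hi => hx i (hi.trans_le hmn)
    have hlim := tendsto_measure_iInter_atTop (μ := stationaryTrace lam)
      (fun n => (hsm n).nullMeasurableSet) hanti ⟨0, measure_ne_top _ _⟩
    have hzero : stationaryTrace lam (⋂ n, s n) = 0 := by
      refine measure_mono_null ?_ (ae_iff.1 hgood1)
      intro x hx hg
      obtain ⟨n, -, hn⟩ := hg.split_gt 0
      exact Set.mem_iInter.1 hx (n + 1) n (Nat.lt_succ_self n) hn
    rw [hzero] at hlim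
    refine le_antisymm (ge_of_tendsto' hlim fun n => ?_) bot_le
    rw [Function.comp_apply, ← hQ (z - n), Measure.map_apply (measurable_halfLine _) (hsm n)]
    refine measure_mono fun x hx i hi => ?_
    simp only [Set.mem_ofPred_eq, not_exists, not_and] at hx
    exact hx _ (by omega)
  filter_upwards [hgood, hlt] with x h1 h2 using ⟨h1, h2⟩

/-- Regeneration of the stationary trace: the joint law, on the event of a split at `z`, of the
splitting times up to `z` and the permutation to the right of `z`. -/
lemma measure_split_past_future (h : IsRegenLaw lam)
    {Q : Measure (ℤ → ℤ × Prop)} (hQ : ∀ a, Q.map (halfLine a) = stationaryTrace lam)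
    (z : ℤ) (F : Finset ℤ) (hF : ∀ t ∈ F, t ≤ z) {B : Set (ℕ → ℕ)} (hB : MeasurableSet B) :
    Q {x | (x z).2 ∧ (∀ t ∈ F, (x t).2) ∧ ofTraceNat (halfLine z x) ∈ B} =
      Q {x | (x z).2 ∧ ∀ t ∈ F, (x t).2} * lam B := by
  have := h.prob
  obtain ⟨a, haF, haz, ha⟩ : ∃ a : ℤ, (∀ t ∈ F, a ≤ t) ∧ a ≤ z ∧ (a = z ∨ a ∈ F) := by
    have hne : (insert z F).Nonempty := Finset.insert_nonempty z F
    refine ⟨(insert z F).min' hne, fun t ht => Finset.min'_le _ _ (Finset.mem_insert_of_mem ht),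
      Finset.min'_le _ _ (Finset.mem_insert_self z F), ?_⟩
    exact Finset.mem_insert.1 (Finset.min'_mem _ hne)
  set n := (z - a).toNat with hn
  have ez : a + (n : ℤ) = z := by omega
  set D : Set (ℕ → ℕ) := {π | ∀ t ∈ F, SplitsAt π (t - a).toNat} with hD
  have hDm : MeasurableSet D := by
    simp only [hD, Set.ofPred_forall]
    exact F.measurableSet_biInter fun t _ => measurableSet_splitsAt _
  have hDdep : DependsOnPast n D := by
    intro π π' h1 h2 hag hs t ht
    refine dependsOnPast_splitsAt ?_ π π' h1 h2 hag (hs t ht)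
    have := hF t ht; omega
  -- Both sides are probabilities of events on the half-line from `a`, where there is a split.
  have key : ∀ B : Set (ℕ → ℕ), MeasurableSet B →
      Q {x | (x z).2 ∧ (∀ t ∈ F, (x t).2) ∧ ofTraceNat (halfLine z x) ∈ B} =
        (∫⁻ π, (firstSplit π : ℝ≥0∞) ∂lam)⁻¹ * (lam ({π | SplitsAt π n} ∩ D) * lam B) := by
    intro B hB
    set C : Set (ℕ → ℤ × Prop) := {y | (y n).2 ∧ (∀ t ∈ F, (y (t - a).toNat).2) ∧
      ofTraceNat (shiftSeq n y) ∈ B} with hC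
    have hfl : ∀ k : ℕ, MeasurableSet {y : ℕ → ℤ × Prop | (y k).2} := fun k =>
      measurableSet_setOfPred.2 (measurable_snd.comp (measurable_pi_apply k))
    have hCm : MeasurableSet C := by
      have hFm : MeasurableSet {y : ℕ → ℤ × Prop | ∀ t ∈ F, (y (t - a).toNat).2} := by
        simp only [Set.ofPred_forall]
        exact F.measurableSet_biInter fun t _ => hfl _
      exact (hfl n).inter (hFm.inter
        (hB.preimage (measurable_ofTraceNat.comp (measurable_shiftSeq n))))
    have e1 : {x : ℤ → ℤ × Prop | (x z).2 ∧ (∀ t ∈ F, (x t).2) ∧ ofTraceNat (halfLine z x) ∈ B} =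
        halfLine a ⁻¹' ({y | (y 0).2} ∩ C) := by
      ext x
      have hsh : shiftSeq n (halfLine a x) = halfLine z x := by
        funext i; simp only [shiftSeq, halfLine]; congr 1; omega
      have hFx : (∀ t ∈ F, (x (a + ((t - a).toNat : ℤ))).2) ↔ ∀ t ∈ F, (x t).2 := by
        refine forall₂_congr fun t ht => ?_
        have e : a + ((t - a).toNat : ℤ) = t := by have := haF t ht; omega
        rw [e]
      simp only [Set.mem_ofPred_eq, Set.mem_preimage, Set.mem_inter_iff, hC, hsh]
      simp only [halfLine, Nat.cast_zero, add_zero, ez, hFx]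
      constructor
      · rintro ⟨h1, h2, h3⟩
        refine ⟨?_, h1, h2, h3⟩
        rcases ha with rfl | ha
        · exact h1
        · exact h2 a ha
      · exact fun h => h.2
    have e2 : trace ⁻¹' C = {π | SplitsAt π n} ∩ D ∩ residual n ⁻¹' B := by
      ext π
      simp only [hC, hD, Set.mem_preimage, Set.mem_ofPred_eq, Set.mem_inter_iff, and_assoc]
      refine and_congr_right fun hs => and_congr_right fun _ => ?_
      rw [← SplitsAt.trace_residual hs, ofTraceNat_trace]
    have hm0 : MeasurableSet ({y : ℕ → ℤ × Prop | (y 0).2} ∩ C) := (hfl 0).inter hCm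
    rw [e1, ← Measure.map_apply (measurable_halfLine a) hm0, hQ, stationaryTrace_split hCm, e2,
      h.regen n D B hDm hDdep hB]
  have h1 := key Set.univ MeasurableSet.univ
  simp only [Set.mem_univ, and_true, measure_univ, mul_one] at h1
  rw [key B hB, h1, mul_assoc]

/-- A positive recurrent regenerative law has a stationary version on `ℤ`. -/
theorem exists_stationary (h : IsRegenLaw lam) (hfin : ∫⁻ π, (firstSplit π : ℝ≥0∞) ∂lam < ∞) :
    ∃ Q : Measure (ℤ → ℤ), IsStationaryVersion Q id lam := by
  have := h.prob
  have := h.isProbabilityMeasure_stationaryTrace hfin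
  obtain ⟨Q, hprob, hQ⟩ := exists_two_sided (stationaryTrace lam)
    (h.map_shiftSeq_stationaryTrace hfin)
  have hgood := h.ae_goodTraceInt hfin hQ
  set m := ∫⁻ π, (firstSplit π : ℝ≥0∞) ∂lam with hm
  have hm0 : m ≠ 0 := (zero_lt_one.trans_le h.one_le_lintegral_firstSplit).ne'
  have hfl : ∀ z : ℤ, MeasurableSet {x : ℤ → ℤ × Prop | (x z).2} := fun z =>
    measurableSet_setOfPred.2 (measurable_snd.comp (measurable_pi_apply z))
  have hdens : ∀ z, Q {x | (x z).2} = m⁻¹ := by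
    intro z
    have h0 : MeasurableSet {y : ℕ → ℤ × Prop | (y 0).2} :=
      measurableSet_setOfPred.2 (measurable_snd.comp (measurable_pi_apply 0))
    have h1 := stationaryTrace_split (lam := lam) MeasurableSet.univ
    rw [Set.inter_univ, ← hQ z, Measure.map_apply (measurable_halfLine z) h0] at h1
    simp only [Set.preimage_univ, measure_univ, mul_one] at h1
    rw [← hm] at h1
    rw [← h1]
    congr 1
    ext x; simp [halfLine]
  -- The splits of the permutation are the marked ones, so that events can be read off the trace.
  have hreg : ∀ (z : ℤ) (A : Set (Set ℤ)) (B : Set (ℕ → ℕ)), MeasurableSet A → MeasurableSet B →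
      (Q.map ofTrace) ({σ | SplitsAtInt σ z} ∩
        ((fun σ => {t : ℤ | t ≤ z ∧ SplitsAtInt σ t}) ⁻¹' A ∩ residualInt z ⁻¹' B)) =
      (Q.map ofTrace) ({σ | SplitsAtInt σ z} ∩
        (fun σ => {t : ℤ | t ≤ z ∧ SplitsAtInt σ t}) ⁻¹' A) * lam B := by
    intro z A B hA hB
    have hprobσ := Measure.isProbabilityMeasure_map (μ := Q) measurable_ofTrace.aemeasurable
    have hz := measurableSet_splitsAtInt z
    have hpast := measurable_splits_le z
    have hres := (measurable_residualInt z)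
    set P₁ : Measure (Set ℤ) := (((Q.map ofTrace).restrict
      ({σ | SplitsAtInt σ z} ∩ residualInt z ⁻¹' B)).map
        fun σ => {t : ℤ | t ≤ z ∧ SplitsAtInt σ t}) with hP₁
    set P₂ : Measure (Set ℤ) := lam B • (((Q.map ofTrace).restrict {σ | SplitsAtInt σ z}).map
        fun σ => {t : ℤ | t ≤ z ∧ SplitsAtInt σ t}) with hP₂
    have hA1 : ∀ A, MeasurableSet A → P₁ A = (Q.map ofTrace) ({σ | SplitsAtInt σ z} ∩
        ((fun σ => {t : ℤ | t ≤ z ∧ SplitsAtInt σ t}) ⁻¹' A ∩ residualInt z ⁻¹' B)) := by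
      intro A hA
      rw [hP₁, Measure.map_apply hpast hA, Measure.restrict_apply (hA.preimage hpast)]
      congr 1
      ext σ; simp only [Set.mem_inter_iff]; tauto
    have hA2 : ∀ A, MeasurableSet A → P₂ A = (Q.map ofTrace) ({σ | SplitsAtInt σ z} ∩
        (fun σ => {t : ℤ | t ≤ z ∧ SplitsAtInt σ t}) ⁻¹' A) * lam B := by
      intro A hA
      rw [hP₂, Measure.smul_apply, Measure.map_apply hpast hA,
        Measure.restrict_apply (hA.preimage hpast), smul_eq_mul, mul_comm, Set.inter_comm]
    have : IsFiniteMeasure P₁ := by rw [hP₁]; infer_instance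
    suffices hP : P₁ = P₂ by rw [← hA1 A hA, ← hA2 A hA, hP]
    refine measure_set_ext fun F => ?_
    have hFm : MeasurableSet {R : Set ℤ | (F : Set ℤ) ⊆ R} := by
      have e : {R : Set ℤ | (F : Set ℤ) ⊆ R} = ⋂ n ∈ F, {R : Set ℤ | n ∈ R} := by
        ext R; simp [Set.subset_def]
      rw [e]
      exact F.measurableSet_biInter fun n _ => measurableSet_setOfPred.2 (measurable_pi_apply n)
    rw [hA1 _ hFm, hA2 _ hFm,
      Measure.map_apply measurable_ofTrace
        (hz.inter ((hFm.preimage hpast).inter (hB.preimage hres))),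
      Measure.map_apply measurable_ofTrace (hz.inter (hFm.preimage hpast))]
    by_cases hF : ∀ t ∈ F, t ≤ z
    · have e1 : ofTrace ⁻¹' ({σ | SplitsAtInt σ z} ∩
          ((fun σ => {t : ℤ | t ≤ z ∧ SplitsAtInt σ t}) ⁻¹' {R : Set ℤ | (F : Set ℤ) ⊆ R} ∩
          residualInt z ⁻¹' B)) =ᵐ[Q]
          ({x | (x z).2 ∧ (∀ t ∈ F, (x t).2) ∧ ofTraceNat (halfLine z x) ∈ B} :
            Set (ℤ → ℤ × Prop)) := by
        refine eventuallyEq_set.2 ?_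
        filter_upwards [hgood] with x hx
        simp only [Set.mem_preimage, Set.mem_inter_iff, Set.mem_ofPred_eq, hx.splitsAtInt_iff,
          residualInt_ofTrace, Set.subset_def, Finset.mem_coe]
        refine and_congr_right fun _ => and_congr_left fun _ => ?_
        exact ⟨fun h t ht => (h t ht).2, fun h t ht => ⟨hF t ht, h t ht⟩⟩
      have e2 : ofTrace ⁻¹' ({σ | SplitsAtInt σ z} ∩
          (fun σ => {t : ℤ | t ≤ z ∧ SplitsAtInt σ t}) ⁻¹' {R : Set ℤ | (F : Set ℤ) ⊆ R}) =ᵐ[Q]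
          ({x | (x z).2 ∧ ∀ t ∈ F, (x t).2} : Set (ℤ → ℤ × Prop)) := by
        refine eventuallyEq_set.2 ?_
        filter_upwards [hgood] with x hx
        simp only [Set.mem_preimage, Set.mem_inter_iff, Set.mem_ofPred_eq, hx.splitsAtInt_iff,
          Set.subset_def, Finset.mem_coe]
        refine and_congr_right fun _ => ?_
        exact ⟨fun h t ht => (h t ht).2, fun h t ht => ⟨hF t ht, h t ht⟩⟩
      rw [measure_congr e1, measure_congr e2, h.measure_split_past_future hQ z F hF hB]
    · push Not at hF
      obtain ⟨t, ht, htz⟩ := hF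
      have hemp : (fun σ : ℤ → ℤ => {t : ℤ | t ≤ z ∧ SplitsAtInt σ t}) ⁻¹'
          {R : Set ℤ | (F : Set ℤ) ⊆ R} = ∅ := by
        ext σ
        simp only [Set.mem_preimage, Set.mem_ofPred_eq, Set.mem_empty_iff_false, iff_false]
        intro hsub
        have : t ≤ z := (hsub (Finset.mem_coe.2 ht)).1
        omega
      simp [hemp]
  have hdensσ : ∀ z, (Q.map ofTrace) {σ | SplitsAtInt σ z} = m⁻¹ := by
    intro z
    rw [← hdens z, Measure.map_apply measurable_ofTrace (measurableSet_splitsAtInt z)]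
    refine measure_congr (eventuallyEq_set.2 ?_)
    filter_upwards [hgood] with x hx
    exact hx.splitsAtInt_iff z
  have hres : ∀ (z : ℤ) (B : Set (ℕ → ℕ)), MeasurableSet B →
      (Q.map ofTrace) ({σ | SplitsAtInt σ z} ∩ residualInt z ⁻¹' B) = m⁻¹ * lam B := by
    intro z B hB
    have h1 := hreg z Set.univ B MeasurableSet.univ hB
    simpa [hdensσ] using h1
  have hinv : m⁻¹ ≠ 0 := ENNReal.inv_ne_zero.2 hfin.ne
  have hinv' : m⁻¹ ≠ ∞ := ENNReal.inv_ne_top.2 hm0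
  have hbij : MeasurableSet {σ : ℤ → ℤ | Function.Bijective σ} := by
    refine MeasurableSet.inter ?_ ?_
    · refine measurableSet_setOfPred.2 ?_
      refine Measurable.forall fun i => Measurable.forall fun j => ?_
      have hp : Measurable fun σ : ℤ → ℤ => (σ i, σ j) :=
        (measurable_pi_apply i).prodMk (measurable_pi_apply j)
      exact (Measurable.of_discrete (f := fun a : ℤ × ℤ => (a.1 = a.2 → i = j))).comp hp
    · refine measurableSet_setOfPred.2 ?_
      refine Measurable.forall fun i => Measurable.exists fun j => ?_
      exact (Measurable.of_discrete (f := fun a : ℤ => a = i)).comp (measurable_pi_apply j)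
  refine ⟨Q.map ofTrace, Measure.isProbabilityMeasure_map measurable_ofTrace.aemeasurable,
    ?_, ?_, ?_, ?_, ?_, ?_⟩
  · refine (ae_map_iff measurable_ofTrace.aemeasurable hbij).2 ?_
    filter_upwards [hgood] with x hx using hx.bijective
  · intro a
    set sh : (ℤ → ℤ × Prop) → ℤ → ℤ × Prop := fun x z => x (a + z) with hsh
    have hshm : Measurable sh := measurable_pi_iff.2 fun z => measurable_pi_apply (a + z)
    have hshQ : Q.map sh = Q := by
      refine two_sided_ext fun b => ?_
      have e : halfLine b ∘ sh = halfLine (a + b) := by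
        funext x i; simp only [Function.comp_apply, halfLine, hsh, add_assoc]
      rw [Measure.map_map (measurable_halfLine b) hshm, e, hQ, hQ]
    have hd : ∀ a : ℤ, Measurable fun (σ : ℤ → ℤ) (z : ℤ) => σ (a + z) - (a + z) := fun a =>
      measurable_pi_iff.2 fun z =>
        (Measurable.of_discrete (f := fun y : ℤ => y - (a + z))).comp (measurable_pi_apply (a + z))
    have hd0 : Measurable fun (σ : ℤ → ℤ) (z : ℤ) => σ z - z :=
      measurable_pi_iff.2 fun z =>
        (Measurable.of_discrete (f := fun y : ℤ => y - z)).comp (measurable_pi_apply z)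
    rw [Measure.map_map (hd a) measurable_ofTrace, Measure.map_map hd0 measurable_ofTrace]
    have e : (fun (σ : ℤ → ℤ) (z : ℤ) => σ (a + z) - (a + z)) ∘ ofTrace =
        ((fun (σ : ℤ → ℤ) (z : ℤ) => σ z - z) ∘ ofTrace) ∘ sh := by
      funext x z; simp [ofTrace, hsh]
    rw [e, ← Measure.map_map (hd0.comp measurable_ofTrace) hshm, hshQ]
  · have hmeas : MeasurableSet {σ : ℤ → ℤ | ∀ z : ℤ,
        (∃ t, t < z ∧ SplitsAtInt σ t) ∧ ∃ t, t > z ∧ SplitsAtInt σ t} := by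
      have hs : ∀ t, Measurable fun σ : ℤ → ℤ => SplitsAtInt σ t := fun t =>
        measurableSet_setOfPred.1 (measurableSet_splitsAtInt t)
      exact measurableSet_setOfPred.2 (Measurable.forall fun z =>
        (Measurable.exists fun t => measurable_const.and (hs t)).and
          (Measurable.exists fun t => measurable_const.and (hs t)))
    refine (ae_map_iff measurable_ofTrace.aemeasurable hmeas).2 ?_
    filter_upwards [hgood] with x hx z
    simp only [hx.splitsAtInt_iff]
    exact ⟨hx.split_lt z, hx.split_gt z⟩
  · exact hdensσ
  · intro z
    rw [Measure.map_id]
    ext B hB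
    rw [Measure.map_apply (measurable_residualInt z) hB,
      cond_apply (measurableSet_splitsAtInt z), hres z B hB, hdensσ, ← mul_assoc,
      ENNReal.inv_mul_cancel hinv hinv', one_mul]
  · intro z
    rw [indepFun_iff_measure_inter_preimage_eq_mul]
    intro A B hA hB
    have hz := measurableSet_splitsAtInt z
    rw [cond_apply hz, cond_apply hz, cond_apply hz, hreg z A B hA hB, hres z B hB, hdensσ,
      ← mul_assoc (m⁻¹)⁻¹ m⁻¹, ENNReal.inv_mul_cancel hinv hinv', one_mul, mul_assoc]

end IsRegenLaw

/-! ### Sampling from a random discrete distribution -/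

/-- The state after `N` steps of a recursion driven by the sequence `x`. -/
def runState {S : Type*} (step : S → ℕ → S) (s₀ : S) (x : ℕ → ℕ) : ℕ → S
  | 0 => s₀
  | N + 1 => step (runState step s₀ x N) (x N)

/-- The probability that the state after `N` i.i.d. inputs with law `p` is `s`; the finite set
`T s` lists the pairs of a state and an input that lead to `s`. -/
noncomputable def stateProb {S : Type*} [DecidableEq S] (T : S → Finset (S × ℕ)) (s₀ : S)
    (p : ℕ → ℝ≥0∞) : ℕ → S → ℝ≥0∞
  | 0, s => if s = s₀ then 1 else 0
  | N + 1, s => ∑ q ∈ T s, stateProb T s₀ p N q.1 * p q.2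

/-- The sequence `y` preceded by `a`. -/
def consSeq (a : ℕ) (y : ℕ → ℕ) : ℕ → ℕ
  | 0 => a
  | j + 1 => y j

lemma measurable_stateProb {S : Type*} [DecidableEq S] (T : S → Finset (S × ℕ)) (s₀ : S)
    (N : ℕ) (s : S) : Measurable fun p => stateProb T s₀ p N s := by
  induction N generalizing s with
  | zero => exact measurable_const
  | succ N ih =>
    exact Finset.measurable_sum _ fun q _ => (ih q.1).mul (measurable_pi_apply q.2)

section Sample

variable {Ω : Type*} [MeasurableSpace Ω] {μ : Measure Ω} {X : ℕ → Ω → ℕ} {P : Ω → ℕ → ℝ}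

/-- The law of the random discrete distribution, with values in `ℝ≥0∞`. -/
noncomputable def ennMass (P : Ω → ℕ → ℝ) (ω : Ω) : ℕ → ℝ≥0∞ := fun i => ENNReal.ofReal (P ω i)

lemma measurable_ennMass (hP : Measurable P) : Measurable (ennMass P) :=
  measurable_pi_iff.2 fun i => ((measurable_pi_apply i).comp hP).ennreal_ofReal

lemma measurableSet_sample_eq (hX : ∀ j, Measurable (X j)) (N m : ℕ) (y : ℕ → ℕ) :
    MeasurableSet {ω | ∀ j < m, X (N + j) ω = y j} := by
  simp only [Set.ofPred_forall]
  exact MeasurableSet.iInter fun j => MeasurableSet.iInter fun _ =>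
    measurableSet_eq_fun (hX _) measurable_const

lemma measurable_runState {S : Type*} (step : S → ℕ → S) (s₀ : S) (hX : ∀ j, Measurable (X j))
    (N : ℕ) (s : S) : MeasurableSet {ω | runState step s₀ (fun j => X j ω) N = s} := by
  -- The state is a function of the finitely many discrete inputs.
  have key : ∀ N, Measurable[_, ⊤] fun ω => runState step s₀ (fun j => X j ω) N := by
    intro N
    induction N with
    | zero => exact measurable_const
    | succ N ih =>
      let _ : MeasurableSpace S := ⊤
      have : Measurable fun q : ℕ × S => step q.2 q.1 :=
        measurable_from_prod_countable_right fun n => measurable_from_top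
      exact this.comp ((hX N).prodMk ih)
  let _ : MeasurableSpace S := ⊤
  exact (key N) (MeasurableSpace.measurableSet_top (s := {s}))

/-- Joint law of the state after `N` samples and of further samples. -/
lemma measure_runState (hX : IsSampleFrom X P μ) (hP : Measurable P) {S : Type*} [DecidableEq S]
    {step : S → ℕ → S} {s₀ : S} {T : S → Finset (S × ℕ)}
    (hT : ∀ s q, q ∈ T s ↔ step q.1 q.2 = s) (N : ℕ) (s : S) (m : ℕ) (y : ℕ → ℕ) :
    μ ({ω | runState step s₀ (fun j => X j ω) N = s} ∩ {ω | ∀ j < m, X (N + j) ω = y j}) =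
      ∫⁻ ω, stateProb T s₀ (ennMass P ω) N s * ∏ j ∈ Finset.range m, ennMass P ω (y j) ∂μ := by
  induction N generalizing s m y with
  | zero =>
    simp only [runState, stateProb]
    by_cases hs : s = s₀
    · subst hs
      have h1 := hX.2 m (fun j => y j) Set.univ MeasurableSet.univ
      simp only [Set.preimage_univ, Set.inter_univ, Measure.restrict_univ] at h1
      simp only [if_true, one_mul, Set.ofPred_true, Set.univ_inter, ennMass]
      simp only [Finset.prod_range]
      rw [← h1]
      congr 1
      ext ω
      simp only [Set.mem_ofPred_eq, zero_add]
      exact ⟨fun h j => h j j.2, fun h j hj => h ⟨j, hj⟩⟩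
    · have : ¬ s₀ = s := fun h => hs h.symm
      simp [hs, this]
  | succ N ih =>
    have hset : {ω | runState step s₀ (fun j => X j ω) (N + 1) = s} ∩
        {ω | ∀ j < m, X (N + 1 + j) ω = y j} =
        ⋃ q ∈ T s, ({ω | runState step s₀ (fun j => X j ω) N = q.1} ∩
          {ω | ∀ j < m + 1, X (N + j) ω = consSeq q.2 y j}) := by
      ext ω
      simp only [Set.mem_inter_iff, Set.mem_ofPred_eq, Set.mem_iUnion, hT, runState]
      constructor
      · rintro ⟨h1, h2⟩
        refine ⟨(_, _), h1, rfl, ?_⟩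
        rintro (_ | j) hj
        · rfl
        · rw [← add_assoc, add_right_comm]; exact h2 j (by omega)
      · rintro ⟨q, h1, h2, h3⟩
        have h4 := h3 0 (Nat.succ_pos m)
        simp only [add_zero, consSeq] at h4
        refine ⟨by rw [h2, h4, h1], fun j hj => ?_⟩
        have h5 := h3 (j + 1) (by omega)
        rwa [← add_assoc, add_right_comm] at h5
    rw [hset, measure_biUnion_finset]
    · simp only [ih]
      rw [← lintegral_finsetSum]
      · refine lintegral_congr fun ω => ?_
        simp only [stateProb, Finset.prod_range_succ', consSeq, Finset.sum_mul]
        refine Finset.sum_congr rfl fun q _ => by ring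
      · intro q _
        refine ((measurable_stateProb T s₀ N q.1).comp (measurable_ennMass hP)).mul ?_
        exact Finset.measurable_prod _ fun j _ =>
          (measurable_pi_apply _).comp (measurable_ennMass hP)
    · intro q _ q' _ hqq
      rw [Function.onFun, Set.disjoint_left]
      rintro ω ⟨h1, h2⟩ ⟨h3, h4⟩
      apply hqq
      have h5 := h2 0 (Nat.succ_pos m)
      have h6 := h4 0 (Nat.succ_pos m)
      simp only [add_zero, consSeq] at h5 h6
      exact Prod.ext (h1.symm.trans h3) (h5.symm.trans h6)
    · intro q _
      exact (measurable_runState step s₀ hX.1 N q.1).inter (measurableSet_sample_eq hX.1 N _ _)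

/-- The expected number of visits to a state. -/
noncomputable def visits {S : Type*} [DecidableEq S] (T : S → Finset (S × ℕ)) (s₀ : S)
    (p : ℕ → ℝ≥0∞) (s : S) : ℝ≥0∞ := ∑' N, stateProb T s₀ p N s

/-- The probability of the input `a` in the state `s`, if this can happen at most once. -/
lemma measure_iUnion_runState (hX : IsSampleFrom X P μ) (hP : Measurable P) {S : Type*}
    [DecidableEq S] {step : S → ℕ → S} {s₀ : S} {T : S → Finset (S × ℕ)}
    (hT : ∀ s q, q ∈ T s ↔ step q.1 q.2 = s) (s : S) (a : ℕ)
    (huniq : ∀ (x : ℕ → ℕ) (N N' : ℕ), runState step s₀ x N = s → x N = a →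
      runState step s₀ x N' = s → x N' = a → N = N') :
    μ {ω | ∃ N, runState step s₀ (fun j => X j ω) N = s ∧ X N ω = a} =
      ∫⁻ ω, visits T s₀ (ennMass P ω) s * ennMass P ω a ∂μ := by
  have hset : {ω | ∃ N, runState step s₀ (fun j => X j ω) N = s ∧ X N ω = a} =
      ⋃ N, ({ω | runState step s₀ (fun j => X j ω) N = s} ∩
        {ω | ∀ j < 1, X (N + j) ω = (fun _ => a) j}) := by
    ext ω; simp
  rw [hset, measure_iUnion]
  · simp only [measure_runState hX hP hT]
    rw [← lintegral_tsum]
    · refine lintegral_congr fun ω => ?_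
      simp only [Finset.prod_range_one, visits, ENNReal.tsum_mul_right]
    · intro N
      refine (((measurable_stateProb T s₀ N s).comp (measurable_ennMass hP)).mul ?_).aemeasurable
      exact Finset.measurable_prod _ fun j _ =>
        (measurable_pi_apply _).comp (measurable_ennMass hP)
  · intro N N' hne
    rw [Function.onFun, Set.disjoint_left]
    rintro ω ⟨h1, h2⟩ ⟨h3, h4⟩
    have h5 := h2 0 zero_lt_one
    have h6 := h4 0 zero_lt_one
    exact hne (huniq (fun j => X j ω) N N' h1 h5 h3 h6)
  · intro N
    exact (measurable_runState step s₀ hX.1 N s).inter (measurableSet_sample_eq hX.1 N _ _)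

end Sample

/-- Summation of a linear recursion. -/
lemma tsum_eq_div_of_rec {u c : ℕ → ℝ≥0∞} {s : ℝ≥0∞} (hs : s < 1) (h0 : u 0 = 0)
    (hu : ∀ N, u (N + 1) = u N * s + c N) : ∑' N, u N = (∑' N, c N) / (1 - s) := by
  have hne : 1 - s ≠ 0 := (tsub_pos_of_lt hs).ne'
  have hne' : 1 - s ≠ ∞ := ne_top_of_le_ne_top ENNReal.one_ne_top tsub_le_self
  have hadd : s + (1 - s) = 1 := add_tsub_cancel_of_le hs.le
  set C := ∑' N, c N
  set U := ∑' N, u N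
  have hrec : U = U * s + C := by
    change ∑' N, u N = _
    rw [tsum_eq_zero_add' ENNReal.summable, h0, zero_add, tsum_congr hu, ENNReal.tsum_add,
      ENNReal.tsum_mul_right]
  have hle : U ≤ C / (1 - s) := by
    refine ENNReal.tsum_le_of_sum_range_le fun n => ?_
    induction n with
    | zero => simp
    | succ n ih =>
      rw [Finset.sum_range_succ', h0, add_zero]
      simp only [hu, Finset.sum_add_distrib, ← Finset.sum_mul]
      calc (∑ k ∈ Finset.range n, u k) * s + ∑ k ∈ Finset.range n, c k
          ≤ C / (1 - s) * s + C := by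
            gcongr
            exact ENNReal.sum_le_tsum _
        _ = C / (1 - s) * s + C / (1 - s) * (1 - s) := by
            rw [ENNReal.div_mul_cancel hne hne']
        _ = C / (1 - s) := by rw [← mul_add, hadd, mul_one]
  by_cases hU : U = ∞
  · rw [hU] at hle ⊢
    exact (top_le_iff.1 hle).symm
  · refine (ENNReal.eq_div_iff hne hne').2 ?_
    have h1 : U * s + U * (1 - s) = U * s + C := by rw [← mul_add, hadd, mul_one, ← hrec]
    have h2 : U * s ≠ ∞ := ENNReal.mul_ne_top hU hs.ne_top
    rw [mul_comm]
    exact (ENNReal.add_right_inj h2).1 h1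

/-! ### The sequence of distinct values -/

/-- `j` is the time of the first appearance of a value. -/
def IsNew (x : ℕ → ℕ) (j : ℕ) : Prop := ∀ k < j, x k ≠ x j

/-- Records a value that has not appeared yet; the most recent one comes first. -/
def histStep (l : List ℕ) (a : ℕ) : List ℕ := if a ∈ l then l else a :: l

/-- The list of the distinct values among the first `N` terms, the most recent one first. -/
abbrev hist (x : ℕ → ℕ) (N : ℕ) : List ℕ := runState histStep [] x N

/-- The list of the first `m` values of `π`, the last one first. -/
def initSeg (π : ℕ → ℕ) (m : ℕ) : List ℕ := ((List.range m).map π).reverse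

lemma initSeg_succ (π : ℕ → ℕ) (m : ℕ) : initSeg π (m + 1) = π m :: initSeg π m := by
  simp [initSeg, List.range_succ]

@[simp] lemma length_initSeg (π : ℕ → ℕ) (m : ℕ) : (initSeg π m).length = m := by simp [initSeg]

lemma mem_initSeg {π : ℕ → ℕ} {m a : ℕ} : a ∈ initSeg π m ↔ ∃ i < m, π i = a := by
  simp [initSeg]

lemma initSeg_eq_iff {π π' : ℕ → ℕ} {m : ℕ} :
    initSeg π m = initSeg π' m ↔ ∀ i < m, π i = π' i := by
  rw [initSeg, initSeg, List.reverse_inj, List.map_inj_left]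
  simp

lemma mem_hist {x : ℕ → ℕ} {N a : ℕ} : a ∈ hist x N ↔ ∃ k < N, x k = a := by
  induction N with
  | zero => simp [runState]
  | succ N ih =>
    have h1 : a ∈ hist x (N + 1) ↔ a ∈ hist x N ∨ x N = a := by
      change a ∈ histStep (hist x N) (x N) ↔ _
      rw [histStep]
      split_ifs with h
      · exact ⟨Or.inl, fun h' => h'.elim id fun e => e ▸ h⟩
      · rw [List.mem_cons, or_comm, eq_comm]
    rw [h1, ih]
    constructor
    · rintro (⟨k, hk, rfl⟩ | rfl)
      · exact ⟨k, by omega, rfl⟩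
      · exact ⟨N, by omega, rfl⟩
    · rintro ⟨k, hk, rfl⟩
      rcases Nat.lt_succ_iff_lt_or_eq.1 hk with h | rfl
      · exact Or.inl ⟨k, h, rfl⟩
      · exact Or.inr rfl

lemma notMem_hist_iff {x : ℕ → ℕ} {N : ℕ} : x N ∉ hist x N ↔ IsNew x N := by
  rw [mem_hist]; push Not; rfl

open Classical in
lemma distinctValues_count {x : ℕ → ℕ} {N : ℕ} (h : IsNew x N) :
    distinctValues x (Nat.count (IsNew x) N) = x N := by
  change x (Nat.nth (IsNew x) _) = x N
  rw [Nat.nth_count h]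

open Classical in
lemma hist_eq_initSeg (x : ℕ → ℕ) (N : ℕ) :
    hist x N = initSeg (distinctValues x) (Nat.count (IsNew x) N) := by
  induction N with
  | zero => simp [runState, initSeg]
  | succ N ih =>
    change histStep (hist x N) (x N) = _
    rw [histStep]
    by_cases h : IsNew x N
    · rw [if_neg (notMem_hist_iff.2 h), Nat.count_succ, if_pos h, initSeg_succ, ← ih,
        distinctValues_count h]
    · rw [if_pos (not_not.1 (mt notMem_hist_iff.1 h)), Nat.count_succ, if_neg h, add_zero, ih]

lemma isNew_nth {x : ℕ → ℕ} (hx : {j | IsNew x j}.Infinite) (i : ℕ) :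
    IsNew x (Nat.nth (IsNew x) i) :=
  Nat.nth_mem_of_infinite hx i

open Classical in
lemma hist_nth {x : ℕ → ℕ} (hx : {j | IsNew x j}.Infinite) (i : ℕ) :
    hist x (Nat.nth (IsNew x) i) = initSeg (distinctValues x) i := by
  rw [hist_eq_initSeg, Nat.count_nth_of_infinite hx]

lemma infinite_isNew {x : ℕ → ℕ} (hx : ∀ v, ∃ j, x j = v) : {j | IsNew x j}.Infinite := by
  have hfirst : ∀ v, ∃ j, IsNew x j ∧ x j = v := by
    intro v
    classical
    refine ⟨Nat.find (hx v), fun k hk => ?_, Nat.find_spec (hx v)⟩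
    rw [Nat.find_spec (hx v)]; exact Nat.find_min (hx v) hk
  have hsurj : x '' {j | IsNew x j} = Set.univ := by
    ext v
    simp only [Set.mem_image, Set.mem_ofPred_eq, Set.mem_univ, iff_true]
    exact hfirst v
  exact Set.Infinite.of_image x (hsurj ▸ Set.infinite_univ)

lemma bijective_distinctValues {x : ℕ → ℕ} (hx : ∀ v, ∃ j, x j = v) :
    Function.Bijective (distinctValues x) := by
  classical
  have hinf := infinite_isNew hx
  constructor
  · intro i j hij
    by_contra hne
    have key : ∀ i j, i < j → distinctValues x i ≠ distinctValues x j := fun i j hlt =>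
      isNew_nth hinf j _ (Nat.nth_strictMono hinf hlt)
    rcases lt_or_gt_of_ne hne with h | h
    · exact key i j h hij
    · exact key j i h hij.symm
  · intro v
    obtain ⟨j, hj, rfl⟩ : ∃ j, IsNew x j ∧ x j = v := by
      refine ⟨Nat.find (hx v), fun k hk => ?_, Nat.find_spec (hx v)⟩
      rw [Nat.find_spec (hx v)]; exact Nat.find_min (hx v) hk
    exact ⟨_, distinctValues_count hj⟩

/-- The distinct values begin with `a :: l` (most recent first) when at some time the value `a` is
drawn with history `l`. -/
lemma initSeg_distinctValues_iff {x : ℕ → ℕ} (hx : {j | IsNew x j}.Infinite) {l : List ℕ} {a : ℕ}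
    (ha : a ∉ l) : initSeg (distinctValues x) (l.length + 1) = a :: l ↔
      ∃ N, hist x N = l ∧ x N = a := by
  classical
  constructor
  · intro h
    rw [initSeg_succ, List.cons.injEq] at h
    exact ⟨_, (hist_nth hx l.length).trans h.2, h.1⟩
  · rintro ⟨N, h1, h2⟩
    have hnew : IsNew x N := notMem_hist_iff.1 (by rw [h1, h2]; exact ha)
    have h3 := hist_eq_initSeg x N
    rw [h1] at h3
    have hlen : l.length = Nat.count (IsNew x) N := by rw [h3, length_initSeg]
    rw [initSeg_succ, hlen, distinctValues_count hnew, h2, ← h3]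

/-- A new value is drawn with a given history at most once. -/
lemma eq_of_length_hist_eq {x : ℕ → ℕ} {N N' : ℕ} (h : IsNew x N) (h' : IsNew x N')
    (hl : (hist x N).length = (hist x N').length) : N = N' := by
  classical
  rw [hist_eq_initSeg, hist_eq_initSeg, length_initSeg, length_initSeg] at hl
  rw [← Nat.nth_count h, hl, Nat.nth_count h']

/-- The pairs of a history and a value that lead to a given history. -/
def histPred : List ℕ → Finset (List ℕ × ℕ)
  | [] => ∅
  | b :: l => (b :: l).toFinset.image (fun a => (b :: l, a)) ∪ if b ∈ l then ∅ else {(l, b)}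

lemma mem_histPred (l : List ℕ) (q : List ℕ × ℕ) : q ∈ histPred l ↔ histStep q.1 q.2 = l := by
  obtain ⟨l', a⟩ := q
  cases l with
  | nil =>
    simp only [histPred, Finset.notMem_empty, histStep, false_iff]
    split_ifs with h
    · rintro rfl; simp at h
    · simp
  | cons b l =>
    simp only [histPred, histStep, Finset.mem_union, Finset.mem_image, List.mem_toFinset,
      Prod.mk.injEq]
    constructor
    · rintro (⟨c, hc, rfl, rfl⟩ | h)
      · rw [if_pos hc]
      · split_ifs at h with hb
        · simp at h
        · rw [Finset.mem_singleton, Prod.mk.injEq] at h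
          rw [h.1, h.2, if_neg hb]
    · intro h
      split_ifs at h with ha
      · subst h; exact Or.inl ⟨a, ha, rfl, rfl⟩
      · rw [List.cons.injEq] at h
        obtain ⟨rfl, rfl⟩ := h
        right; simp [ha]

/-- The probability that the distinct values in a sample from `p` begin with the list `l` (most
recent first). -/
noncomputable def biasedWeight (p : ℕ → ℝ≥0∞) : List ℕ → ℝ≥0∞
  | [] => 1
  | a :: l => biasedWeight p l * (p a / (1 - (l.map p).sum))

lemma sum_toFinset_eq {p : ℕ → ℝ≥0∞} {l : List ℕ} (hl : l.Nodup) :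
    ∑ a ∈ l.toFinset, p a = (l.map p).sum := List.sum_toFinset p hl

lemma visits_nil (p : ℕ → ℝ≥0∞) : visits histPred [] p [] = 1 := by
  rw [visits, tsum_eq_single 0]
  · simp [stateProb]
  · intro N hN
    obtain ⟨N, rfl⟩ := Nat.exists_eq_succ_of_ne_zero hN
    simp [stateProb, histPred]

lemma visits_cons {p : ℕ → ℝ≥0∞} {l : List ℕ} {b : ℕ} (hl : (b :: l).Nodup)
    (hp : ((b :: l).map p).sum < 1) :
    visits histPred [] p (b :: l) = visits histPred [] p l * p b / (1 - ((b :: l).map p).sum) := by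
  rw [visits, tsum_eq_div_of_rec hp (c := fun N => stateProb histPred [] p N l * p b)]
  · rw [ENNReal.tsum_mul_right]; rfl
  · simp [stateProb]
  · intro N
    have hb : b ∉ l := (List.nodup_cons.1 hl).1
    rw [stateProb, histPred, if_neg hb, Finset.sum_union]
    · rw [Finset.sum_image (fun a _ a' _ h => (Prod.mk.inj h).2), Finset.sum_singleton,
        ← sum_toFinset_eq hl, Finset.mul_sum]
    · rw [Finset.disjoint_singleton_right]
      simp only [Finset.mem_image, not_exists, not_and, Prod.mk.injEq]
      intro a _ h
      have := congrArg List.length h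
      simp at this

lemma visits_eq_biasedWeight_div {p : ℕ → ℝ≥0∞} {l : List ℕ} (hl : l.Nodup)
    (hp : (l.map p).sum < 1) :
    visits histPred [] p l = biasedWeight p l / (1 - (l.map p).sum) := by
  induction l with
  | nil => simp [visits_nil, biasedWeight]
  | cons b l ih =>
    have hl' : (l.map p).sum < 1 := lt_of_le_of_lt (by simp) hp
    rw [visits_cons hl hp, ih (List.nodup_cons.1 hl).2 hl', biasedWeight]
    simp only [div_eq_mul_inv]
    ring

lemma measurable_biasedWeight (l : List ℕ) : Measurable fun p => biasedWeight p l := by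
  have hsum : ∀ l : List ℕ, Measurable fun p : ℕ → ℝ≥0∞ => (l.map p).sum := by
    intro l
    induction l with
    | nil => exact measurable_const
    | cons a l ih =>
      simp only [List.map_cons, List.sum_cons]
      exact (measurable_pi_apply a).add ih
  induction l with
  | nil => exact measurable_const
  | cons a l ih => exact ih.mul ((measurable_pi_apply a).div (measurable_const.sub (hsum l)))

section Sample

variable {Ω : Type*} [MeasurableSpace Ω] {μ : Measure Ω} {X : ℕ → Ω → ℕ} {P : Ω → ℕ → ℝ}

/-- A sample from a distribution with positive masses hits every value. -/
lemma ae_forall_exists_eq [IsProbabilityMeasure μ] (hX : IsSampleFrom X P μ) (hP : Measurable P)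
    (hpos : ∀ᵐ ω ∂μ, ∀ i, 0 < P ω i) (hsum : ∀ᵐ ω ∂μ, ∑' i, ennMass P ω i ≤ 1) :
    ∀ᵐ ω ∂μ, ∀ v, ∃ j, X j ω = v := by
  rw [ae_all_iff]
  intro v
  have hpm := measurable_ennMass hP
  have hbound : ∀ (N m : ℕ) (y : ℕ → ℕ),
      μ ({ω | ∀ j < N, X j ω ≠ v} ∩ {ω | ∀ j < m, X (N + j) ω = y j}) ≤
      ∫⁻ ω, (1 - ennMass P ω v) ^ N * ∏ j ∈ Finset.range m, ennMass P ω (y j) ∂μ := by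
    intro N
    induction N with
    | zero =>
      intro m y
      have h1 := measure_runState hX hP (step := histStep) (s₀ := []) mem_histPred 0 [] m y
      simp only [runState, stateProb, if_true, Set.ofPred_true, one_mul] at h1
      simpa using h1.le
    | succ N ih =>
      intro m y
      have hsub : {ω | ∀ j < N + 1, X j ω ≠ v} ∩ {ω | ∀ j < m, X (N + 1 + j) ω = y j} ⊆
          ⋃ a : {a : ℕ // a ≠ v}, ({ω | ∀ j < N, X j ω ≠ v} ∩
            {ω | ∀ j < m + 1, X (N + j) ω = consSeq a y j}) := by
        rintro ω ⟨h1, h2⟩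
        refine Set.mem_iUnion.2 ⟨⟨X N ω, h1 N (Nat.lt_succ_self N)⟩,
          fun j hj => h1 j (by omega), ?_⟩
        rintro (_ | j) hj
        · rfl
        · rw [← add_assoc, add_right_comm]; exact h2 j (by omega)
      refine (measure_mono hsub).trans ((measure_iUnion_le _).trans ?_)
      refine (ENNReal.tsum_le_tsum fun a : {a : ℕ // a ≠ v} =>
        ih (m + 1) (consSeq a y)).trans ?_
      have hm : ∀ (y : ℕ → ℕ) (m : ℕ), Measurable fun ω =>
          ∏ j ∈ Finset.range m, ennMass P ω (y j) :=
        fun y m => Finset.measurable_prod _ fun j _ => (measurable_pi_apply _).comp hpm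
      have hv : Measurable fun ω => 1 - ennMass P ω v :=
        measurable_const.sub ((measurable_pi_apply v).comp hpm)
      rw [← lintegral_tsum (β := {a : ℕ // a ≠ v}) (f := fun a ω => (1 - ennMass P ω v) ^ N *
        ∏ j ∈ Finset.range (m + 1), ennMass P ω (consSeq a y j))
        fun a => ((hv.pow_const N).mul (hm _ _)).aemeasurable]
      refine lintegral_mono_ae ?_
      filter_upwards [hsum] with ω hω
      have hle : ∑' a : {a : ℕ // a ≠ v}, ennMass P ω a ≤ 1 - ennMass P ω v := by
        refine ENNReal.le_sub_of_add_le_right ENNReal.ofReal_ne_top ?_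
        have h1 := (ENNReal.summable.tsum_add_tsum_compl (s := {v}) (f := ennMass P ω)
          ENNReal.summable).le.trans hω
        rw [tsum_singleton, add_comm] at h1
        exact h1
      calc ∑' a : {a : ℕ // a ≠ v}, (1 - ennMass P ω v) ^ N *
            ∏ j ∈ Finset.range (m + 1), ennMass P ω (consSeq a y j)
          = ∑' a : {a : ℕ // a ≠ v}, ((1 - ennMass P ω v) ^ N *
            ∏ j ∈ Finset.range m, ennMass P ω (y j)) * ennMass P ω a := by
            refine tsum_congr fun a => ?_
            simp only [Finset.prod_range_succ', consSeq, mul_assoc]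
        _ ≤ _ := by
            rw [ENNReal.tsum_mul_left, pow_succ, mul_right_comm]
            gcongr
  have hlim : Tendsto (fun N => ∫⁻ ω, (1 - ennMass P ω v) ^ N ∂μ) atTop (𝓝 0) := by
    have hv : Measurable fun ω => 1 - ennMass P ω v :=
      measurable_const.sub ((measurable_pi_apply v).comp hpm)
    have := tendsto_lintegral_of_dominated_convergence (μ := μ)
      (F := fun N ω => (1 - ennMass P ω v) ^ N) (f := fun _ => 0) (fun _ => 1)
      (fun N => hv.pow_const N)
      (fun N => Eventually.of_forall fun ω => pow_le_one' tsub_le_self N) (by simp) ?_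
    · simpa using this
    · filter_upwards [hpos] with ω hω
      refine ENNReal.tendsto_pow_atTop_nhds_zero_of_lt_one ?_
      refine ENNReal.sub_lt_self ENNReal.one_ne_top one_ne_zero ?_
      exact (ENNReal.ofReal_pos.2 (hω v)).ne'
  rw [ae_iff]
  refine le_antisymm (ge_of_tendsto' hlim fun N => ?_) bot_le
  have h1 := hbound N 0 (fun _ => 0)
  simp only [Finset.range_zero, Finset.prod_empty, mul_one] at h1
  refine le_trans (measure_mono ?_) h1
  intro ω hω
  simp only [Set.mem_ofPred_eq, not_exists] at hω
  exact ⟨fun j _ => hω j, fun j hj => absurd hj (Nat.not_lt_zero j)⟩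

/-- The law of the initial segments of a `P`-biased permutation. -/
lemma measure_initSeg [IsProbabilityMeasure μ] (hX : IsSampleFrom X P μ) (hP : Measurable P)
    (hall : ∀ᵐ ω ∂μ, ∀ v, ∃ j, X j ω = v)
    (hlt : ∀ᵐ ω ∂μ, ∀ l : List ℕ, l.Nodup → (l.map (ennMass P ω)).sum < 1)
    {l : List ℕ} (hl : l.Nodup) :
    μ {ω | initSeg (biasedPerm X ω) l.length = l} = ∫⁻ ω, biasedWeight (ennMass P ω) l ∂μ := by
  cases l with
  | nil => simp [initSeg, biasedWeight]
  | cons a l =>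
    obtain ⟨ha, hl'⟩ := List.nodup_cons.1 hl
    have h1 : {ω | initSeg (biasedPerm X ω) (a :: l).length = a :: l} =ᵐ[μ]
        ({ω | ∃ N, hist (fun j => X j ω) N = l ∧ X N ω = a} : Set Ω) := by
      refine eventuallyEq_set.2 ?_
      filter_upwards [hall] with ω hω
      exact initSeg_distinctValues_iff (infinite_isNew hω) ha
    rw [measure_congr h1, measure_iUnion_runState hX hP mem_histPred]
    · refine lintegral_congr_ae ?_
      filter_upwards [hlt] with ω hω
      rw [visits_eq_biasedWeight_div hl' (hω l hl'), biasedWeight]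
      simp only [div_eq_mul_inv]
      ring
    · intro x N N' h1 h2 h3 h4
      refine eq_of_length_hist_eq (x := x) (notMem_hist_iff.1 ?_) (notMem_hist_iff.1 ?_) ?_
      · rw [hist, h1, h2]; exact ha
      · rw [hist, h3, h4]; exact ha
      · rw [hist, hist, h1, h3]

end Sample

/-! ### Residual allocation models -/

/-- The mass that the factors `w` leave after `n` sticks. -/
def restMass (w : ℕ → ℝ) (n : ℕ) : ℝ := ∏ j ∈ Finset.range n, (1 - w j)

/-- The masses of the residual allocation model with the factors `w`. -/
noncomputable def stickMass (w : ℕ → ℝ) : ℕ → ℝ≥0∞ :=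
  fun i => ENNReal.ofReal (restMass w i * w i)

/-- The factors lie strictly between `0` and `1`. -/
def GoodFactors (w : ℕ → ℝ) : Prop := ∀ i, 0 < w i ∧ w i < 1

namespace GoodFactors

variable {w : ℕ → ℝ}

lemma restMass_pos (h : GoodFactors w) (n : ℕ) : 0 < restMass w n :=
  Finset.prod_pos fun j _ => sub_pos.2 (h j).2

lemma restMass_le_one (h : GoodFactors w) (n : ℕ) : restMass w n ≤ 1 :=
  Finset.prod_le_one (fun j _ => (sub_pos.2 (h j).2).le) fun j _ => by linarith [(h j).1]

lemma mass_pos (h : GoodFactors w) (i : ℕ) : 0 < restMass w i * w i :=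
  mul_pos (h.restMass_pos i) (h i).1

end GoodFactors

lemma sum_mass_eq (w : ℕ → ℝ) (n : ℕ) :
    ∑ i ∈ Finset.range n, restMass w i * w i = 1 - restMass w n := by
  induction n with
  | zero => simp [restMass]
  | succ n ih =>
    rw [Finset.sum_range_succ, ih, restMass, restMass, Finset.prod_range_succ]; ring

lemma restMass_add (w : ℕ → ℝ) (n k : ℕ) :
    restMass w (n + k) = restMass w n * restMass (fun i => w (n + i)) k :=
  Finset.prod_range_add _ n k

namespace GoodFactors

variable {w : ℕ → ℝ}

lemma sum_stickMass (h : GoodFactors w) (n : ℕ) :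
    ∑ i ∈ Finset.range n, stickMass w i = 1 - ENNReal.ofReal (restMass w n) := by
  simp only [stickMass]
  rw [← ENNReal.ofReal_sum_of_nonneg fun i _ => (h.mass_pos i).le, sum_mass_eq,
    ENNReal.ofReal_sub _ (h.restMass_pos n).le, ENNReal.ofReal_one]

lemma sum_stickMass_lt_one (h : GoodFactors w) (n : ℕ) :
    ∑ i ∈ Finset.range n, stickMass w i < 1 := by
  rw [h.sum_stickMass]
  exact ENNReal.sub_lt_self ENNReal.one_ne_top one_ne_zero
    (ENNReal.ofReal_pos.2 (h.restMass_pos n)).ne'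

lemma tsum_stickMass_le_one (h : GoodFactors w) : ∑' i, stickMass w i ≤ 1 :=
  ENNReal.tsum_le_of_sum_range_le fun n => (h.sum_stickMass_lt_one n).le

lemma sum_finset_stickMass_lt_one (h : GoodFactors w) (A : Finset ℕ) :
    ∑ a ∈ A, stickMass w a < 1 := by
  refine lt_of_le_of_lt ?_ (h.sum_stickMass_lt_one (A.sup id + 1))
  refine Finset.sum_le_sum_of_subset fun a ha => Finset.mem_range.2 ?_
  have : a ≤ A.sup id := Finset.le_sup (f := id) ha
  omega

lemma sum_list_stickMass_lt_one (h : GoodFactors w) {l : List ℕ} (hl : l.Nodup) :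
    (l.map (stickMass w)).sum < 1 := by
  rw [← sum_toFinset_eq hl]; exact h.sum_finset_stickMass_lt_one _

lemma stickMass_add (h : GoodFactors w) (n a : ℕ) :
    stickMass w (n + a) = ENNReal.ofReal (restMass w n) * stickMass (fun i => w (n + i)) a := by
  rw [stickMass, stickMass, restMass_add, mul_assoc, ENNReal.ofReal_mul (h.restMass_pos n).le]

/-- After an arrangement `l₁` of `[n]` the remaining values are those of a biased permutation for
the residual allocation model with the factors `w n, w (n + 1), …`. -/
lemma biasedWeight_append (h : GoodFactors w) {n : ℕ} {l₁ : List ℕ} (h₁ : l₁.Perm (List.range n))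
    (l : List ℕ) :
    biasedWeight (stickMass w) (l.map (n + ·) ++ l₁) =
      biasedWeight (stickMass w) l₁ * biasedWeight (stickMass fun i => w (n + i)) l := by
  induction l with
  | nil => simp [biasedWeight]
  | cons a l ih =>
    rw [List.map_cons, List.cons_append, biasedWeight, biasedWeight, ih, mul_assoc]
    congr 2
    set t := ENNReal.ofReal (restMass w n) with ht
    have ht1 : t ≤ 1 := by
      rw [ht, ← ENNReal.ofReal_one]; exact ENNReal.ofReal_le_ofReal (h.restMass_le_one n)
    have ht0 : t ≠ 0 := (ENNReal.ofReal_pos.2 (h.restMass_pos n)).ne'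
    have htt : t ≠ ∞ := ENNReal.ofReal_ne_top
    have hs₁ : (l₁.map (stickMass w)).sum = 1 - t := by
      rw [(h₁.map _).sum_eq, ← h.sum_stickMass n, ← List.sum_toFinset _ List.nodup_range,
        List.toFinset_range]
    have hs₂ : ((l.map (n + ·)).map (stickMass w)).sum =
        t * (l.map (stickMass fun i => w (n + i))).sum := by
      rw [List.map_map, ← List.sum_map_mul_left]
      congr 1
      exact List.map_congr_left fun b _ => h.stickMass_add n b
    rw [List.map_append, List.sum_append, hs₁, hs₂, h.stickMass_add, tsub_add_eq_tsub_tsub_swap,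
      ENNReal.sub_sub_cancel ENNReal.one_ne_top ht1]
    have e : t - t * (l.map (stickMass fun i => w (n + i))).sum =
        t * (1 - (l.map (stickMass fun i => w (n + i))).sum) := by
      rw [ENNReal.mul_sub fun _ _ => htt, mul_one]
    rw [e, ENNReal.mul_div_mul_left _ _ ht0 htt]

end GoodFactors

lemma biasedWeight_congr {p q : ℕ → ℝ≥0∞} {l : List ℕ} (h : ∀ a ∈ l, p a = q a) :
    biasedWeight p l = biasedWeight q l := by
  induction l with
  | nil => rfl
  | cons a l ih =>
    have h1 : ∀ b ∈ l, p b = q b := fun b hb => h b (List.mem_cons_of_mem a hb)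
    rw [biasedWeight, biasedWeight, ih h1, h a List.mem_cons_self, List.map_congr_left h1]

lemma measurable_stickMass : Measurable stickMass := by
  refine measurable_pi_iff.2 fun i => Measurable.ennreal_ofReal ?_
  refine Measurable.mul ?_ (measurable_pi_apply i)
  exact Finset.measurable_prod _ fun j _ => measurable_const.sub (measurable_pi_apply j)

section Sample

variable {Ω : Type*} [MeasurableSpace Ω] {μ : Measure Ω} {W : ℕ → Ω → ℝ} {X : ℕ → Ω → ℕ}

lemma measurable_stick (hWm : ∀ i, Measurable (W i)) : Measurable (stick W) := by
  refine measurable_pi_iff.2 fun i => Measurable.mul ?_ (hWm i)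
  exact Finset.measurable_prod _ fun j _ => measurable_const.sub (hWm j)

lemma ae_goodFactors (hW : ∀ i, ∀ᵐ ω ∂μ, 0 < W i ω ∧ W i ω < 1) :
    ∀ᵐ ω ∂μ, GoodFactors fun i => W i ω := ae_all_iff.2 hW

/-- The law of an i.i.d. sequence is invariant under injective reindexing. -/
lemma map_reindex_eq [IsProbabilityMeasure μ] (hWm : ∀ i, Measurable (W i)) (hWi : iIndepFun W μ)
    (hWd : ∀ i, IdentDistrib (W i) (W 0) μ μ) {f : ℕ → ℕ} (hf : Function.Injective f) :
    μ.map (fun ω i => W (f i) ω) = μ.map (fun ω i => W i ω) := by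
  have := Measure.isProbabilityMeasure_map (μ := μ) (hWm 0).aemeasurable
  have h1 : μ.map (fun ω i => W i ω) = Measure.infinitePi fun _ : ℕ => μ.map (W 0) := by
    rw [hWi.map_fun_eq_infinitePi_map hWm]
    congr 1
    funext i; exact (hWd i).map_eq
  have hs : Measurable fun (w : ℕ → ℝ) (i : ℕ) => w (f i) :=
    measurable_pi_iff.2 fun i => measurable_pi_apply _
  have h2 : μ.map (fun ω i => W (f i) ω) =
      (μ.map (fun ω i => W i ω)).map fun (w : ℕ → ℝ) (i : ℕ) => w (f i) :=
    (Measure.map_map hs (measurable_pi_iff.2 hWm)).symm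
  rw [h2, h1]
  exact Measure.map_infinitePi_infinitePi_of_inj (P := fun _ : ℕ => μ.map (W 0))
    (f := f) hf

variable [IsProbabilityMeasure μ]

lemma ae_hits (hWm : ∀ i, Measurable (W i)) (hW : ∀ i, ∀ᵐ ω ∂μ, 0 < W i ω ∧ W i ω < 1)
    (hX : IsSampleFrom X (stick W) μ) : ∀ᵐ ω ∂μ, ∀ v, ∃ j, X j ω = v := by
  refine ae_forall_exists_eq hX (measurable_stick hWm) ?_ ?_
  · filter_upwards [ae_goodFactors hW] with ω hω i using hω.mass_pos i
  · filter_upwards [ae_goodFactors hW] with ω hω using hω.tsum_stickMass_le_one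

lemma measure_initSeg_stick (hWm : ∀ i, Measurable (W i))
    (hW : ∀ i, ∀ᵐ ω ∂μ, 0 < W i ω ∧ W i ω < 1) (hX : IsSampleFrom X (stick W) μ)
    {l : List ℕ} (hl : l.Nodup) : μ {ω | initSeg (biasedPerm X ω) l.length = l} =
      ∫⁻ ω, biasedWeight (stickMass fun i => W i ω) l ∂μ := by
  refine measure_initSeg hX (measurable_stick hWm) (ae_hits hWm hW hX) ?_ hl
  filter_upwards [ae_goodFactors hW] with ω hω l hl using hω.sum_list_stickMass_lt_one hl

/-- Given an arrangement of `[n]` as initial segment, the subsequent values minus `n` have the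
original law: the weight factorizes, and the factors `W` up to `n` and after `n` are
independent. -/
lemma measure_initSeg_append (hWm : ∀ i, Measurable (W i))
    (hW : ∀ i, ∀ᵐ ω ∂μ, 0 < W i ω ∧ W i ω < 1) (hWi : iIndepFun W μ)
    (hWd : ∀ i, IdentDistrib (W i) (W 0) μ μ) (hX : IsSampleFrom X (stick W) μ) {n : ℕ}
    {l₁ l : List ℕ} (h₁ : l₁.Perm (List.range n)) (hl : l.Nodup) :
    μ {ω | initSeg (biasedPerm X ω) (n + l.length) = l.map (n + ·) ++ l₁} =
      μ {ω | initSeg (biasedPerm X ω) n = l₁} *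
        μ {ω | initSeg (biasedPerm X ω) l.length = l} := by
  have hlen : l₁.length = n := by rw [h₁.length_eq, List.length_range]
  have hnd₁ : l₁.Nodup := h₁.nodup_iff.2 List.nodup_range
  have hmem₁ : ∀ a ∈ l₁, a < n := fun a ha => List.mem_range.1 (h₁.mem_iff.1 ha)
  have hnd : (l.map (n + ·) ++ l₁).Nodup := by
    refine List.Nodup.append (hl.map fun a b hab => by simpa using hab) hnd₁ ?_
    intro a ha ha'
    obtain ⟨b, -, rfl⟩ := List.mem_map.1 ha
    have := hmem₁ _ ha'
    omega
  have h2 := measure_initSeg_stick hWm hW hX hnd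
  have h3 := measure_initSeg_stick hWm hW hX hnd₁
  rw [List.length_append, List.length_map, hlen, add_comm l.length] at h2
  rw [hlen] at h3
  rw [h2, h3, measure_initSeg_stick hWm hW hX hl]
  set f : (Fin n → ℝ) → ℝ≥0∞ := fun w =>
    biasedWeight (stickMass fun i => if hi : i < n then w ⟨i, hi⟩ else 0) l₁ with hf
  set g : (ℕ → ℝ) → ℝ≥0∞ := fun w => biasedWeight (stickMass w) l with hg
  have hgm : Measurable g := (measurable_biasedWeight l).comp measurable_stickMass
  have hfm : Measurable f := by
    refine ((measurable_biasedWeight l₁).comp measurable_stickMass).comp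
      (measurable_pi_iff.2 fun i => ?_)
    by_cases hi : i < n
    · simp only [hi, dif_pos]; exact measurable_pi_apply _
    · simp only [hi, dif_neg, not_false_eq_true]; exact measurable_const
  have hfW : ∀ ω, biasedWeight (stickMass fun i => W i ω) l₁ = f fun i : Fin n => W i ω := by
    intro ω
    refine biasedWeight_congr fun a ha => ?_
    have ha' := hmem₁ a ha
    rw [stickMass, stickMass, restMass, restMass, dif_pos ha']
    congr 2
    refine Finset.prod_congr rfl fun j hj => ?_
    rw [dif_pos ((Finset.mem_range.1 hj).trans ha')]
  have hind := (indepFun_past_future hWm hWi n).comp hfm hgm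
  have hpm : Measurable fun ω (i : Fin n) => W i ω := measurable_pi_iff.2 fun i => hWm _
  have hfutm : Measurable fun ω (i : ℕ) => W (n + i) ω := measurable_pi_iff.2 fun i => hWm _
  calc ∫⁻ ω, biasedWeight (stickMass fun i => W i ω) (l.map (n + ·) ++ l₁) ∂μ
      = ∫⁻ ω, ((f ∘ fun ω (i : Fin n) => W i ω) * (g ∘ fun ω (i : ℕ) => W (n + i) ω)) ω ∂μ := by
        refine lintegral_congr_ae ?_
        filter_upwards [ae_goodFactors hW] with ω hω
        rw [hω.biasedWeight_append h₁, hfW]; rfl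
    _ = (∫⁻ ω, f (fun i : Fin n => W i ω) ∂μ) * ∫⁻ ω, g (fun i => W (n + i) ω) ∂μ :=
        lintegral_mul_eq_lintegral_mul_lintegral_of_indepFun (hfm.comp hpm) (hgm.comp hfutm) hind
    _ = _ := by
        rw [← lintegral_map hgm hfutm, map_reindex_eq hWm hWi hWd (add_right_injective n),
          lintegral_map hgm (measurable_pi_iff.2 hWm)]
        simp only [hfW, hg]

lemma measurable_biasedPerm (hX : ∀ j, Measurable (X j)) : Measurable (biasedPerm X) := by
  classical
  refine measurable_pi_iff.2 fun i => ?_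
  have hnth : Measurable fun ω => Nat.nth (IsNew fun j => X j ω) i := by
    have hnew : ∀ j, MeasurableSet {ω | IsNew (fun j => X j ω) j} := fun j => by
      simp only [IsNew, Set.ofPred_forall]
      exact MeasurableSet.iInter fun k => MeasurableSet.iInter fun _ =>
        (measurableSet_eq_fun (hX k) (hX j)).compl
    have hcount : ∀ N, Measurable fun ω => Nat.count (IsNew fun j => X j ω) N := by
      intro N
      induction N with
      | zero => simp
      | succ N ih =>
        simp only [Nat.count_succ]
        exact ih.add (Measurable.ite (hnew N) measurable_const measurable_const)
    refine measurable_to_countable' fun N => ?_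
    -- The `i`-th new time is `N` if `N` is new and has `i` new times before it; or, for `N = 0`,
    -- by convention, if there are too few new times.
    have hset : (fun ω => Nat.nth (IsNew fun j => X j ω) i) ⁻¹' {N} =
        {ω | IsNew (fun j => X j ω) N ∧ Nat.count (IsNew fun j => X j ω) N = i} ∪
        (⋂ M, {ω | ¬ (IsNew (fun j => X j ω) M ∧ Nat.count (IsNew fun j => X j ω) M = i)} ∩
          {_ω | N = 0}) := by
      ext ω
      simp only [Set.mem_preimage, Set.mem_singleton_iff, Set.mem_union, Set.mem_ofPred_eq,
        Set.mem_iInter, Set.mem_inter_iff]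
      constructor
      · intro h
        by_cases hfin : ∀ hf : (Set.ofPred (IsNew fun j => X j ω)).Finite, i < hf.toFinset.card
        · left
          rw [← h]
          exact ⟨Nat.nth_mem i hfin, Nat.count_nth hfin⟩
        · right
          push Not at hfin
          obtain ⟨hf, hle⟩ := hfin
          rw [Nat.nth_of_card_le hf hle] at h
          refine fun M => ⟨fun hM => ?_, h.symm⟩
          have h1 := Nat.count_lt_card hf hM.1
          omega
      · rintro (⟨h1, h2⟩ | h)
        · rw [← h2, Nat.nth_count h1]
        · rw [(h 0).2]
          by_contra hne
          by_cases hfin : ∀ hf : (Set.ofPred (IsNew fun j => X j ω)).Finite, i < hf.toFinset.card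
          · exact (h _).1 ⟨Nat.nth_mem i hfin, Nat.count_nth hfin⟩
          · push Not at hfin
            obtain ⟨hf, hle⟩ := hfin
            exact hne (Nat.nth_of_card_le hf hle)
    have hev : ∀ M, MeasurableSet
        {ω | IsNew (fun j => X j ω) M ∧ Nat.count (IsNew fun j => X j ω) M = i} := fun M =>
      (hnew M).inter (measurableSet_eq_fun (hcount M) measurable_const)
    rw [hset]
    exact (hev N).union (MeasurableSet.iInter fun M => (hev M).compl.inter (MeasurableSet.const _))
  have h1 : Measurable fun q : ℕ × Ω => X q.1 q.2 := measurable_from_prod_countable_right hX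
  exact h1.comp (hnth.prodMk measurable_id)

end Sample

/-! ### Regeneration of the biased permutation -/

lemma measurableSet_initSeg (m : ℕ) (l : List ℕ) :
    MeasurableSet {π : ℕ → ℕ | initSeg π m = l} := by
  by_cases h : ∃ π₀ : ℕ → ℕ, initSeg π₀ m = l
  · obtain ⟨π₀, rfl⟩ := h
    simp only [initSeg_eq_iff, Set.ofPred_forall]
    exact MeasurableSet.iInter fun i => MeasurableSet.iInter fun _ =>
      measurableSet_eq_fun (measurable_pi_apply i) measurable_const
  · push Not at h
    simp [h]

lemma initSeg_eq_of_le {π π' : ℕ → ℕ} {m n : ℕ} (hmn : m ≤ n) (h : initSeg π n = initSeg π' n) :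
    initSeg π m = initSeg π' m :=
  initSeg_eq_iff.2 fun i hi => initSeg_eq_iff.1 h i (hi.trans_le hmn)

/-- A finite measure on sequences of integers is determined by the laws of the initial
segments. -/
lemma measure_seq_ext {ν ν' : Measure (ℕ → ℕ)} [IsFiniteMeasure ν]
    (h : ∀ l : List ℕ, ν {π | initSeg π l.length = l} = ν' {π | initSeg π l.length = l}) :
    ν = ν' := by
  refine ext_of_generate_finite
    (Set.range fun l : List ℕ => {π : ℕ → ℕ | initSeg π l.length = l}) ?_ ?_ ?_ ?_
  · refine le_antisymm ?_ ?_
    · have : Measurable[MeasurableSpace.generateFrom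
          (Set.range fun l : List ℕ => {π : ℕ → ℕ | initSeg π l.length = l})]
          (id : (ℕ → ℕ) → ℕ → ℕ) := by
        refine @measurable_pi_iff _ _ _ (_) _ _ |>.2 fun i => ?_
        refine @measurable_to_countable' _ _ _ _ (_) _ fun c => ?_
        have e : (fun π : ℕ → ℕ => id π i) ⁻¹' {c} =
            ⋃ l ∈ {l : List ℕ | l.length = i},
              {π : ℕ → ℕ | initSeg π (c :: l).length = c :: l} := by
          ext π
          simp only [Set.mem_preimage, Set.mem_singleton_iff, Set.mem_iUnion, Set.mem_ofPred_eq,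
            List.length_cons, initSeg_succ, List.cons.injEq, exists_prop]
          constructor
          · rintro rfl
            exact ⟨initSeg π i, length_initSeg π i, by simp, by simp⟩
          · rintro ⟨l, rfl, h1, -⟩; exact h1
        rw [e]
        exact MeasurableSet.biUnion (Set.to_countable _) fun l _ =>
          MeasurableSpace.measurableSet_generateFrom ⟨c :: l, rfl⟩
      have h2 := this.comap_le
      rwa [MeasurableSpace.comap_id] at h2
    · refine MeasurableSpace.generateFrom_le ?_
      rintro _ ⟨l, rfl⟩
      exact measurableSet_initSeg _ _
  · have key : ∀ l l' : List ℕ, l.length ≤ l'.length →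
        ({π : ℕ → ℕ | initSeg π l.length = l} ∩ {π | initSeg π l'.length = l'}).Nonempty →
        {π : ℕ → ℕ | initSeg π l.length = l} ∩ {π | initSeg π l'.length = l'} =
          {π | initSeg π l'.length = l'} := by
      rintro l l' hle ⟨π₀, h1, h2⟩
      refine Set.inter_eq_right.2 fun π hπ => ?_
      rw [Set.mem_ofPred_eq] at h1 h2 hπ ⊢
      rw [← h1, length_initSeg]
      exact initSeg_eq_of_le hle (hπ.trans h2.symm)
    rintro _ ⟨l, rfl⟩ _ ⟨l', rfl⟩ hne
    rcases le_total l.length l'.length with hle | hle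
    · exact ⟨l', (key l l' hle hne).symm⟩
    · refine ⟨l, ?_⟩
      rw [Set.inter_comm] at hne ⊢
      exact (key l' l hle hne).symm
  · rintro _ ⟨l, rfl⟩; exact h l
  · have := h []
    simpa [initSeg] using this

lemma nodup_initSeg {π : ℕ → ℕ} (h : Function.Injective π) (m : ℕ) : (initSeg π m).Nodup :=
  List.nodup_reverse.2 (List.nodup_range.map h)

/-- An injective map whose first `n` values are an arrangement of `[n]` splits at `n`. -/
lemma splitsAt_of_perm {π : ℕ → ℕ} (hπ : Function.Injective π) {n : ℕ}
    (h : (initSeg π n).Perm (List.range n)) : SplitsAt π n := by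
  intro i
  constructor
  · intro hi
    have h1 : π i ∈ initSeg π n := h.mem_iff.2 (List.mem_range.2 hi)
    obtain ⟨j, hj, he⟩ := mem_initSeg.1 h1
    exact hπ he ▸ hj
  · intro hi
    exact List.mem_range.1 (h.mem_iff.1 (mem_initSeg.2 ⟨i, hi, rfl⟩))

lemma SplitsAt.perm_initSeg {π : ℕ → ℕ} (hπ : Function.Injective π) {n : ℕ} (h : SplitsAt π n) :
    (initSeg π n).Perm (List.range n) := by
  refine (List.subperm_of_subset (nodup_initSeg hπ n) ?_).perm_of_length_le (by simp)
  intro a ha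
  obtain ⟨i, hi, rfl⟩ := mem_initSeg.1 ha
  exact List.mem_range.2 ((h i).2 hi)

lemma SplitsAt.initSeg_add {π : ℕ → ℕ} {n : ℕ} (h : SplitsAt π n) (m : ℕ) :
    initSeg π (n + m) = (initSeg (residual n π) m).map (n + ·) ++ initSeg π n := by
  induction m with
  | zero => simp [initSeg]
  | succ m ih =>
    rw [← add_assoc, initSeg_succ, initSeg_succ, ih, List.map_cons, List.cons_append,
      h.add_residual]

/-- Regeneration follows from the laws of the initial segments. -/
lemma isRegenLaw_of_initSeg {lam : Measure (ℕ → ℕ)} [IsProbabilityMeasure lam]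
    (hb : ∀ᵐ π ∂lam, Function.Bijective π)
    (h : ∀ (n : ℕ) (l₁ l : List ℕ), l₁.Perm (List.range n) → l.Nodup →
      lam {π | initSeg π (n + l.length) = l.map (n + ·) ++ l₁} =
        lam {π | initSeg π n = l₁} * lam {π | initSeg π l.length = l}) : IsRegenLaw lam := by
  have hstep : ∀ (n : ℕ) (l₁ : List ℕ) (B : Set (ℕ → ℕ)), l₁.Perm (List.range n) →
      MeasurableSet B → lam ({π | initSeg π n = l₁} ∩ residual n ⁻¹' B) =
        lam {π | initSeg π n = l₁} * lam B := by
    intro n l₁ B h₁ hB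
    have hν : (lam.restrict {π | initSeg π n = l₁}).map (residual n) =
        lam {π | initSeg π n = l₁} • lam := by
      refine measure_seq_ext fun l => ?_
      have hm := (measurableSet_initSeg l.length l).preimage (measurable_residual n)
      rw [Measure.map_apply (measurable_residual n) (measurableSet_initSeg _ _),
        Measure.restrict_apply hm, Measure.smul_apply, smul_eq_mul]
      by_cases hl : l.Nodup
      · rw [← h n l₁ l h₁ hl]
        refine measure_congr (eventuallyEq_set.2 ?_)
        filter_upwards [hb] with π hπ
        simp only [Set.mem_inter_iff, Set.mem_preimage, Set.mem_ofPred_eq]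
        constructor
        · rintro ⟨h2, h3⟩
          have hs : SplitsAt π n := splitsAt_of_perm hπ.injective (h3 ▸ h₁)
          rw [hs.initSeg_add, h2, h3]
        · intro h2
          have hlen : l₁.length = n := by rw [h₁.length_eq, List.length_range]
          have h3 : initSeg π n = l₁ := by
            -- The last `n` entries of the list are its first `n` values.
            have key : ∀ m, ∃ l', l'.length = m ∧ initSeg π (n + m) = l' ++ initSeg π n := by
              intro m
              induction m with
              | zero => exact ⟨[], rfl, rfl⟩
              | succ m ih =>
                obtain ⟨l', hl', he⟩ := ih
                exact ⟨π (n + m) :: l', by simp [hl'], by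
                  rw [← add_assoc, initSeg_succ, he, List.cons_append]⟩
            obtain ⟨l', hl', he⟩ := key l.length
            rw [he] at h2
            exact (List.append_inj h2 (by simp [hl'])).2
          have hs : SplitsAt π n := splitsAt_of_perm hπ.injective (h3 ▸ h₁)
          rw [hs.initSeg_add, h3] at h2
          exact ⟨List.map_injective_iff.2 (fun a b hab => by simpa using hab)
            (List.append_cancel_right h2), h3⟩
      · have h0 : lam {π | initSeg π l.length = l} = 0 := by
          refine measure_mono_null ?_ (ae_iff.1 hb)
          intro π hπ hbij
          exact hl (hπ ▸ nodup_initSeg hbij.injective _)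
        have h0' : lam (residual n ⁻¹' {π | initSeg π l.length = l} ∩
            {π | initSeg π n = l₁}) = 0 := by
          refine measure_mono_null ?_ (ae_iff.1 hb)
          rintro π ⟨h2, h3⟩ hbij
          have hs : SplitsAt π n := splitsAt_of_perm hbij.injective (h3 ▸ h₁)
          have hinj : Function.Injective (residual n π) := by
            intro a b hab
            have h4 := hs.add_residual a
            have h5 := hs.add_residual b
            have : π (n + a) = π (n + b) := by omega
            have := hbij.injective this
            omega
          have h6 : initSeg (residual n π) l.length = l := h2
          exact hl (h6 ▸ nodup_initSeg hinj _)
        rw [h0, h0', mul_zero]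
    have h1 := congrArg (fun m => m B) hν
    rw [Measure.map_apply (measurable_residual n) hB,
      Measure.restrict_apply (hB.preimage (measurable_residual n)), Measure.smul_apply,
      smul_eq_mul, Set.inter_comm] at h1
    exact h1
  refine ⟨inferInstance, hb, fun n A B _ hA hB => ?_⟩
  -- The event is a countable union over the possible initial segments.
  set L : Set (List ℕ) := {l | l.Perm (List.range n) ∧
    ∃ π, SplitsAt π n ∧ π ∈ A ∧ initSeg π n = l} with hL
  have hmem : ∀ π : ℕ → ℕ, Function.Bijective π →
      ((SplitsAt π n ∧ π ∈ A) ↔ ∃ l ∈ L, initSeg π n = l) := by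
    intro π hπ
    constructor
    · rintro ⟨hs, hA'⟩
      exact ⟨_, ⟨hs.perm_initSeg hπ.injective, π, hs, hA', rfl⟩, rfl⟩
    · rintro ⟨l, ⟨h1, π₀, h2, h3, h4⟩, h5⟩
      have hs : SplitsAt π n := splitsAt_of_perm hπ.injective (h5 ▸ h1)
      exact ⟨hs, hA π₀ π h2 hs (initSeg_eq_iff.1 (h4.trans h5.symm)) h3⟩
  have hsum : ∀ B, MeasurableSet B →
      lam ({π | SplitsAt π n} ∩ A ∩ residual n ⁻¹' B) =
        ∑' l : L, lam {π | initSeg π n = l} * lam B := by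
    intro B hB
    have e : ({π | SplitsAt π n} ∩ A ∩ residual n ⁻¹' B : Set (ℕ → ℕ)) =ᵐ[lam]
        (⋃ l ∈ L, ({π | initSeg π n = l} ∩ residual n ⁻¹' B) : Set (ℕ → ℕ)) := by
      refine eventuallyEq_set.2 ?_
      filter_upwards [hb] with π hπ
      simp only [Set.mem_inter_iff, Set.mem_iUnion, Set.mem_ofPred_eq, hmem π hπ, exists_prop]
      constructor
      · rintro ⟨⟨l, h1, h2⟩, h3⟩; exact ⟨l, h1, h2, h3⟩
      · rintro ⟨l, h1, h2, h3⟩; exact ⟨⟨l, h1, h2⟩, h3⟩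
    rw [measure_congr e, measure_biUnion (Set.to_countable L)]
    · exact tsum_congr fun l => hstep n l B l.2.1 hB
    · intro l _ l' _ hne
      rw [Function.onFun, Set.disjoint_left]
      rintro π ⟨h1, -⟩ ⟨h2, -⟩
      exact hne (h1.symm.trans h2)
    · exact fun l _ => (measurableSet_initSeg n l).inter (hB.preimage (measurable_residual n))
  have h1 := hsum Set.univ MeasurableSet.univ
  simp only [Set.preimage_univ, Set.inter_univ, measure_univ, mul_one] at h1
  rw [hsum B hB, h1, ENNReal.tsum_mul_right]

theorem isRegenLaw_biasedPerm {Ω : Type*} [MeasurableSpace Ω] {μ : Measure Ω}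
    [IsProbabilityMeasure μ] {W : ℕ → Ω → ℝ} {X : ℕ → Ω → ℕ} (hWm : ∀ i, Measurable (W i))
    (hW : ∀ i, ∀ᵐ ω ∂μ, 0 < W i ω ∧ W i ω < 1) (hWi : iIndepFun W μ)
    (hWd : ∀ i, IdentDistrib (W i) (W 0) μ μ) (hX : IsSampleFrom X (stick W) μ) :
    IsRegenLaw (μ.map (biasedPerm X)) := by
  have hPi := measurable_biasedPerm hX.1
  have := Measure.isProbabilityMeasure_map (μ := μ) hPi.aemeasurable
  refine isRegenLaw_of_initSeg ?_ ?_
  · have hbij : MeasurableSet {σ : ℕ → ℕ | Function.Bijective σ} := by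
      refine MeasurableSet.inter ?_ ?_
      · refine measurableSet_setOfPred.2 ?_
        refine Measurable.forall fun i => Measurable.forall fun j => ?_
        have hp : Measurable fun σ : ℕ → ℕ => (σ i, σ j) :=
          (measurable_pi_apply i).prodMk (measurable_pi_apply j)
        exact (Measurable.of_discrete (f := fun a : ℕ × ℕ => (a.1 = a.2 → i = j))).comp hp
      · refine measurableSet_setOfPred.2 ?_
        refine Measurable.forall fun i => Measurable.exists fun j => ?_
        exact (Measurable.of_discrete (f := fun a : ℕ => a = i)).comp (measurable_pi_apply j)
    refine (ae_map_iff hPi.aemeasurable hbij).2 ?_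
    filter_upwards [ae_hits hWm hW hX] with ω hω using bijective_distinctValues hω
  · intro n l₁ l h₁ hl
    simp only [Measure.map_apply hPi (measurableSet_initSeg _ _)]
    exact measure_initSeg_append hWm hW hWi hWd hX h₁ hl

/-! ### The probability that `[n]` is a block -/

/-- The lists that enumerate the finite set `A`. -/
noncomputable def arrangements (A : Finset ℕ) : Finset (List ℕ) := A.toList.permutations.toFinset

lemma mem_arrangements {A : Finset ℕ} {l : List ℕ} :
    l ∈ arrangements A ↔ l.Nodup ∧ l.toFinset = A := by
  rw [arrangements, List.mem_toFinset, List.mem_permutations]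
  constructor
  · intro h
    refine ⟨h.nodup_iff.2 A.nodup_toList, ?_⟩
    rw [List.toFinset_eq_of_perm _ _ h, Finset.toList_toFinset]
  · rintro ⟨h1, rfl⟩
    exact (List.toFinset_toList h1).symm

lemma sum_arrangements {A : Finset ℕ} (hA : A.Nonempty) (f : List ℕ → ℝ≥0∞) :
    ∑ l ∈ arrangements A, f l = ∑ a ∈ A, ∑ l ∈ arrangements (A.erase a), f (a :: l) := by
  have h : arrangements A = A.biUnion fun a =>
      (arrangements (A.erase a)).image fun l => a :: l := by
    ext l
    simp only [Finset.mem_biUnion, Finset.mem_image, mem_arrangements]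
    constructor
    · rintro ⟨h1, h2⟩
      cases l with
      | nil => rw [← h2] at hA; simp at hA
      | cons a l =>
        have h3 := List.nodup_cons.1 h1
        refine ⟨a, by rw [← h2]; simp, l, ⟨h3.2, ?_⟩, rfl⟩
        rw [← h2, List.toFinset_cons, Finset.erase_insert (by simpa using h3.1)]
    · rintro ⟨a, ha, l, ⟨h1, h2⟩, rfl⟩
      refine ⟨List.nodup_cons.2 ⟨fun hl => ?_, h1⟩, ?_⟩
      · have := List.mem_toFinset.2 hl
        rw [h2] at this; simp at this
      · rw [List.toFinset_cons, h2, Finset.insert_erase ha]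
  rw [h, Finset.sum_biUnion]
  · refine Finset.sum_congr rfl fun a _ => ?_
    rw [Finset.sum_image fun l _ l' _ e => (List.cons.inj e).2]
  · intro a _ b _ hab
    rw [Function.onFun, Finset.disjoint_left]
    intro l h1 h2
    obtain ⟨l1, -, rfl⟩ := Finset.mem_image.1 h1
    obtain ⟨l2, -, e⟩ := Finset.mem_image.1 h2
    exact hab (List.cons.inj e).1.symm

/-- The probability that independent exponential variables with the rates `p i`, `i ∈ A`, are all
smaller than one with rate `c`, divided by `c`. -/
noncomputable def expRace (p : ℕ → ℝ) (A : Finset ℕ) (c : ℝ) : ℝ :=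
  ∫ t in Set.Ioi (0 : ℝ), Real.exp (-(c * t)) * ∏ i ∈ A, (1 - Real.exp (-(p i * t)))

lemma prod_one_sub_exp_mem {p : ℕ → ℝ} {A : Finset ℕ} {t : ℝ} (hp : ∀ i ∈ A, 0 ≤ p i) (ht : 0 ≤ t) :
    ∏ i ∈ A, (1 - Real.exp (-(p i * t))) ∈ Set.Icc (0 : ℝ) 1 := by
  have h : ∀ i ∈ A, 0 ≤ 1 - Real.exp (-(p i * t)) := fun i hi => by
    rw [sub_nonneg, Real.exp_le_one_iff, neg_nonpos]; exact mul_nonneg (hp i hi) ht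
  exact ⟨Finset.prod_nonneg h, Finset.prod_le_one h fun i _ => by
    linarith [Real.exp_pos (-(p i * t))]⟩

lemma integrableOn_exp_neg {c : ℝ} (hc : 0 < c) :
    IntegrableOn (fun t => Real.exp (-(c * t))) (Set.Ioi 0) := by
  simpa only [neg_mul] using integrableOn_exp_mul_Ioi (neg_neg_of_pos hc) 0

lemma integrableOn_expRace {p : ℕ → ℝ} {A : Finset ℕ} {c : ℝ} (hp : ∀ i ∈ A, 0 ≤ p i)
    (hc : 0 < c) : IntegrableOn
      (fun t => Real.exp (-(c * t)) * ∏ i ∈ A, (1 - Real.exp (-(p i * t)))) (Set.Ioi 0) := by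
  refine Integrable.mono (integrableOn_exp_neg hc) ?_ ?_
  · exact (by fun_prop : Continuous _).aestronglyMeasurable
  · refine (ae_restrict_iff' measurableSet_Ioi).2 (Eventually.of_forall fun t ht => ?_)
    have h := prod_one_sub_exp_mem hp (le_of_lt ht)
    rw [norm_mul, Real.norm_of_nonneg h.1]
    exact mul_le_of_le_one_right (norm_nonneg _) h.2

/-- Condition on which of the `A`-variables is the largest; formally, integrate by parts. -/
lemma mul_expRace {p : ℕ → ℝ} {A : Finset ℕ} {c : ℝ} (hA : A.Nonempty) (hp : ∀ i ∈ A, 0 ≤ p i)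
    (hc : 0 < c) :
    c * expRace p A c = ∑ a ∈ A, p a * expRace p (A.erase a) (c + p a) := by
  have hp' : ∀ a, ∀ i ∈ A.erase a, 0 ≤ p i := fun a i hi => hp i (Finset.mem_of_mem_erase hi)
  have hca : ∀ a ∈ A, 0 < c + p a := fun a ha => add_pos_of_pos_of_nonneg hc (hp a ha)
  set F : ℝ → ℝ := fun t => Real.exp (-(c * t)) * ∏ i ∈ A, (1 - Real.exp (-(p i * t))) with hF
  set F' : ℝ → ℝ := fun t =>
    (∑ a ∈ A, p a * (Real.exp (-((c + p a) * t)) * ∏ i ∈ A.erase a, (1 - Real.exp (-(p i * t))))) -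
      c * F t with hF'
  have hint : ∀ a ∈ A, IntegrableOn (fun t => p a * (Real.exp (-((c + p a) * t)) *
      ∏ i ∈ A.erase a, (1 - Real.exp (-(p i * t))))) (Set.Ioi 0) := fun a ha =>
    (integrableOn_expRace (hp' a) (hca a ha)).const_mul _
  have hFint : IntegrableOn F (Set.Ioi 0) := integrableOn_expRace hp hc
  have hderiv : ∀ t ∈ Set.Ioi (0 : ℝ), HasDerivAt F (F' t) t := by
    intro t _
    have h1 : HasDerivAt (fun t => Real.exp (-(c * t))) (Real.exp (-(c * t)) * -c) t := by
      simpa using (((hasDerivAt_id t).const_mul c).neg).exp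
    have h2 : ∀ i ∈ A, HasDerivAt (fun t => 1 - Real.exp (-(p i * t)))
        (p i * Real.exp (-(p i * t))) t := fun i _ => by
      have : HasDerivAt (fun x => 1 - Real.exp (-(p i * x)))
          (-(Real.exp (-(p i * t)) * -(p i * 1))) t :=
        ((((hasDerivAt_id t).const_mul (p i)).neg).exp).const_sub 1
      exact this.congr_deriv (by ring)
    refine HasDerivAt.congr_deriv (f := F) (h1.mul (HasDerivAt.fun_finsetProd h2)) ?_
    simp only [hF', hF, smul_eq_mul, Finset.mul_sum, sub_eq_add_neg, add_mul, neg_add, Real.exp_add]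
    rw [add_comm]
    congr 1
    · refine Finset.sum_congr rfl fun a _ => by ring
    · ring
  have h0 : F 0 = 0 := by
    obtain ⟨a, ha⟩ := hA
    simp only [hF]
    rw [Finset.prod_eq_zero ha (by simp), mul_zero]
  have hlim : Tendsto F atTop (𝓝 0) := by
    have h1 : Tendsto (fun t : ℝ => Real.exp (-(c * t))) atTop (𝓝 0) :=
      Real.tendsto_exp_neg_atTop_nhds_zero.comp (tendsto_id.const_mul_atTop hc)
    refine squeeze_zero' ?_ ?_ h1
    · filter_upwards [eventually_ge_atTop 0] with t ht
      exact mul_nonneg (Real.exp_pos _).le (prod_one_sub_exp_mem hp ht).1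
    · filter_upwards [eventually_ge_atTop 0] with t ht
      exact mul_le_of_le_one_right (Real.exp_pos _).le (prod_one_sub_exp_mem hp ht).2
  have hcont : ContinuousWithinAt F (Set.Ici 0) 0 :=
    (by fun_prop : Continuous F).continuousWithinAt
  have key := integral_Ioi_of_hasDerivAt_of_tendsto hcont hderiv
    ((integrable_finsetSum _ hint).sub (hFint.const_mul c)) hlim
  rw [h0, sub_zero, integral_sub (integrable_finsetSum _ hint) (hFint.const_mul c),
    integral_finsetSum _ hint, integral_const_mul] at key
  simp only [integral_const_mul] at key
  simp only [expRace]
  linarith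

lemma expRace_nonneg {p : ℕ → ℝ} {A : Finset ℕ} {c : ℝ} (hp : ∀ i ∈ A, 0 ≤ p i) :
    0 ≤ expRace p A c :=
  setIntegral_nonneg measurableSet_Ioi fun _ ht =>
    mul_nonneg (Real.exp_pos _).le (prod_one_sub_exp_mem hp (le_of_lt ht)).1

lemma mul_expRace_empty (p : ℕ → ℝ) {c : ℝ} (hc : 0 < c) : c * expRace p ∅ c = 1 := by
  simp only [expRace, Finset.prod_empty, mul_one]
  have := integral_exp_mul_Ioi (neg_neg_of_pos hc) 0
  simp only [neg_mul, mul_zero, Real.exp_zero] at this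
  rw [this]
  field_simp

/-- The probability that the values in `A` precede all the others in a biased permutation, in
continuous time: give each value an independent exponential clock. -/
lemma sum_biasedWeight_arrangements {p : ℕ → ℝ} (hp : ∀ i, 0 ≤ p i) {A : Finset ℕ}
    (hA : ∑ i ∈ A, p i < 1) :
    ∑ l ∈ arrangements A, biasedWeight (fun i => ENNReal.ofReal (p i)) l =
      ENNReal.ofReal ((1 - ∑ i ∈ A, p i) * expRace p A (1 - ∑ i ∈ A, p i)) := by
  induction A using Finset.strongInduction with
  | H A ih =>
    rcases A.eq_empty_or_nonempty with rfl | hne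
    · have : arrangements ∅ = {[]} := by
        ext l
        rw [mem_arrangements, Finset.mem_singleton]
        constructor
        · rintro ⟨-, h⟩; simpa using h
        · rintro rfl; simp
      rw [this, Finset.sum_singleton, Finset.sum_empty, sub_zero, mul_expRace_empty p one_pos]
      simp [biasedWeight]
    · set c := 1 - ∑ i ∈ A, p i with hc
      have hc0 : 0 < c := sub_pos.2 hA
      have hce : ∀ a ∈ A, 1 - ∑ i ∈ A.erase a, p i = c + p a := fun a ha => by
        rw [hc, ← Finset.add_sum_erase A p ha]; ring
      rw [sum_arrangements hne, mul_expRace hne (fun i _ => hp i) hc0,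
        ENNReal.ofReal_sum_of_nonneg fun a _ =>
          mul_nonneg (hp a) (expRace_nonneg fun i _ => hp i)]
      refine Finset.sum_congr rfl fun a ha => ?_
      have hpos : 0 < c + p a := add_pos_of_pos_of_nonneg hc0 (hp a)
      have hsum : ∀ l ∈ arrangements (A.erase a),
          biasedWeight (fun i => ENNReal.ofReal (p i)) (a :: l) =
          biasedWeight (fun i => ENNReal.ofReal (p i)) l *
            (ENNReal.ofReal (p a) / ENNReal.ofReal (c + p a)) := by
        intro l hl
        obtain ⟨h1, h2⟩ := mem_arrangements.1 hl
        rw [biasedWeight, ← sum_toFinset_eq h1, h2,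
          ← ENNReal.ofReal_sum_of_nonneg fun i _ => hp i, ← ENNReal.ofReal_one,
          ← ENNReal.ofReal_sub _ (Finset.sum_nonneg fun i _ => hp i), hce a ha]
      rw [Finset.sum_congr rfl hsum, ← Finset.sum_mul,
        ih _ (Finset.erase_ssubset ha) (by linarith [hce a ha]), hce a ha,
        ← ENNReal.ofReal_div_of_pos hpos, ← ENNReal.ofReal_mul
          (mul_nonneg hpos.le (expRace_nonneg fun i _ => hp i))]
      congr 1
      field_simp

/-- The same integral on the time scale of the rate `c`. -/
lemma mul_expRace_eq (p : ℕ → ℝ) (A : Finset ℕ) {c : ℝ} (hc : 0 < c) :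
    c * expRace p A c =
      ∫ x in Set.Ioi (0 : ℝ), Real.exp (-x) * ∏ i ∈ A, (1 - Real.exp (-(x * (p i / c)))) := by
  have h := integral_comp_mul_left_Ioi
    (fun x : ℝ => Real.exp (-x) * ∏ i ∈ A, (1 - Real.exp (-(x * (p i / c))))) 0 hc
  rw [mul_zero, smul_eq_mul] at h
  rw [← mul_right_inj' (inv_ne_zero hc.ne'), ← h, inv_mul_cancel_left₀ hc.ne', expRace]
  refine integral_congr_ae (Eventually.of_forall fun t => ?_)
  simp only
  congr 1
  refine Finset.prod_congr rfl fun i _ => ?_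
  congr 3
  field_simp

/-- The order reversal of `[n]`, extended by the identity. -/
def reverseBelow (n j : ℕ) : ℕ := if j < n then n - 1 - j else j

lemma reverseBelow_injective (n : ℕ) : Function.Injective (reverseBelow n) := by
  intro a b h
  simp only [reverseBelow] at h
  split_ifs at h <;> omega

/-- Reversing the order of the first `n` factors turns the ratios `P_i / T_n` into the ratios
`W_i / T_i`. -/
lemma GoodFactors.prod_reverse {w : ℕ → ℝ} (h : GoodFactors w) (n : ℕ) (g : ℝ → ℝ) :
    ∏ i ∈ Finset.range n, g (restMass (fun j => w (reverseBelow n j)) i * w (reverseBelow n i) /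
      restMass (fun j => w (reverseBelow n j)) n) =
      ∏ i ∈ Finset.range n, g (w i / restMass w (i + 1)) := by
  rw [← Finset.prod_range_reflect]
  refine Finset.prod_congr rfl fun i hi => ?_
  have hi' := Finset.mem_range.1 hi
  set v : ℕ → ℝ := fun j => w (reverseBelow n j) with hv
  have hvg : GoodFactors v := fun j => h _
  have e1 : w (reverseBelow n (n - 1 - i)) = w i := by
    congr 1
    rw [reverseBelow, if_pos (by omega)]; omega
  have e2 : restMass v n = restMass v (n - 1 - i) * restMass w (i + 1) := by
    have : n = n - 1 - i + (i + 1) := by omega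
    conv_lhs => rw [this]
    rw [restMass_add]
    congr 1
    rw [restMass, restMass, ← Finset.prod_range_reflect]
    refine Finset.prod_congr rfl fun j hj => ?_
    have hj' := Finset.mem_range.1 hj
    simp only [hv]
    congr 2
    rw [reverseBelow, if_pos (by omega)]; omega
  rw [e1, e2, mul_div_mul_left _ _ (hvg.restMass_pos _).ne']

section Sample

variable {Ω : Type*} [MeasurableSpace Ω] {μ : Measure Ω} [IsProbabilityMeasure μ]
  {W : ℕ → Ω → ℝ} {X : ℕ → Ω → ℕ}

lemma measure_splitsAt (hWm : ∀ i, Measurable (W i))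
    (hW : ∀ i, ∀ᵐ ω ∂μ, 0 < W i ω ∧ W i ω < 1) (hX : IsSampleFrom X (stick W) μ) (n : ℕ) :
    μ {ω | SplitsAt (biasedPerm X ω) n} = ∫⁻ ω, ENNReal.ofReal
      (∫ x in Set.Ioi (0 : ℝ), Real.exp (-x) * ∏ i ∈ Finset.range n,
        (1 - Real.exp (-(x * (remaining W i ω * W i ω / remaining W n ω))))) ∂μ := by
  have hPi := measurable_biasedPerm hX.1
  have hset : {ω | SplitsAt (biasedPerm X ω) n} =ᵐ[μ]
      (⋃ l ∈ arrangements (Finset.range n), {ω | initSeg (biasedPerm X ω) n = l} : Set Ω) := by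
    refine eventuallyEq_set.2 ?_
    filter_upwards [ae_hits hWm hW hX] with ω hω
    have hinj := (bijective_distinctValues hω).injective
    have hperm : ∀ l : List ℕ, l ∈ arrangements (Finset.range n) ↔ l.Perm (List.range n) := by
      intro l
      rw [mem_arrangements]
      constructor
      · rintro ⟨h1, h2⟩
        refine (List.perm_ext_iff_of_nodup h1 List.nodup_range).2 fun a => ?_
        rw [← List.mem_toFinset, h2, Finset.mem_range, List.mem_range]
      · intro h1
        exact ⟨h1.nodup_iff.2 List.nodup_range, by
          rw [List.toFinset_eq_of_perm _ _ h1, List.toFinset_range]⟩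
    simp only [Set.mem_iUnion, Set.mem_ofPred_eq, exists_prop, exists_eq_right', hperm]
    exact ⟨fun h => h.perm_initSeg hinj, fun h => splitsAt_of_perm hinj h⟩
  rw [measure_congr hset, measure_biUnion_finset]
  · have hl : ∀ l ∈ arrangements (Finset.range n), μ {ω | initSeg (biasedPerm X ω) n = l} =
        ∫⁻ ω, biasedWeight (stickMass fun i => W i ω) l ∂μ := by
      intro l hl
      obtain ⟨h1, h2⟩ := mem_arrangements.1 hl
      have hlen : l.length = n := by
        rw [← List.toFinset_card_of_nodup h1, h2, Finset.card_range]
      rw [← measure_initSeg_stick hWm hW hX h1, hlen]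
    rw [Finset.sum_congr rfl hl, ← lintegral_finsetSum]
    · refine lintegral_congr_ae ?_
      filter_upwards [ae_goodFactors hW] with ω hω
      have hs := sum_mass_eq (fun i => W i ω) n
      have hpos := hω.restMass_pos n
      have h3 := sum_biasedWeight_arrangements (p := fun i => restMass (fun i => W i ω) i * W i ω)
        (fun i => (hω.mass_pos i).le) (A := Finset.range n) (by rw [hs]; linarith)
      rw [hs, sub_sub_cancel, mul_expRace_eq _ _ hpos] at h3
      exact h3
    · intro l _
      exact ((measurable_biasedWeight l).comp measurable_stickMass).comp (measurable_pi_iff.2 hWm)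
  · intro l _ l' _ hne
    rw [Function.onFun, Set.disjoint_left]
    rintro ω h1 h2
    exact hne (h1.symm.trans h2)
  · exact fun l _ => (measurableSet_initSeg n l).preimage hPi

/-- The probability that `[n]` is a block, in terms of the factors in reversed order. -/
theorem measureReal_splitsAt (hWm : ∀ i, Measurable (W i))
    (hW : ∀ i, ∀ᵐ ω ∂μ, 0 < W i ω ∧ W i ω < 1) (hWi : iIndepFun W μ)
    (hWd : ∀ i, IdentDistrib (W i) (W 0) μ μ) (hX : IsSampleFrom X (stick W) μ) (n : ℕ) :
    μ.real {ω | SplitsAt (biasedPerm X ω) n} =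
      ∫ x in Set.Ioi (0 : ℝ), Real.exp (-x) * ∫ ω, ∏ i ∈ Finset.range n,
        (1 - Real.exp (-(x * W i ω / remaining W (i + 1) ω))) ∂μ := by
  set G : ℝ → (ℕ → ℝ) → ℝ := fun x w =>
    ∏ i ∈ Finset.range n, (1 - Real.exp (-(x * (restMass w i * w i / restMass w n)))) with hG
  have hrm : ∀ k, Measurable fun w : ℕ → ℝ => restMass w k := fun k =>
    Finset.measurable_prod _ fun j _ => measurable_const.sub (measurable_pi_apply j)
  have hGm : Measurable fun q : ℝ × (ℕ → ℝ) => G q.1 q.2 := by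
    refine Finset.measurable_prod _ fun i _ => measurable_const.sub (Real.measurable_exp.comp ?_)
    refine (measurable_fst.mul ?_).neg
    exact ((((hrm i).mul (measurable_pi_apply i)).div (hrm n))).comp measurable_snd
  have hWp : Measurable fun ω i => W i ω := measurable_pi_iff.2 hWm
  have hbd : ∀ᵐ ω ∂μ, ∀ x : ℝ, 0 < x → G x (fun i => W i ω) ∈ Set.Icc (0 : ℝ) 1 := by
    filter_upwards [ae_goodFactors hW] with ω hω x hx
    have h := prod_one_sub_exp_mem (p := fun i => restMass (fun i => W i ω) i * W i ω /
      restMass (fun i => W i ω) n) (A := Finset.range n)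
      (fun i _ => (div_pos (hω.mass_pos i) (hω.restMass_pos n)).le) hx.le
    simpa only [hG, mul_comm x] using h
  have hjm : Measurable fun q : Ω × ℝ => Real.exp (-q.2) * G q.2 (fun i => W i q.1) :=
    (Real.measurable_exp.comp measurable_snd.neg).mul
      (hGm.comp (measurable_snd.prodMk (hWp.comp measurable_fst)))
  have hint : Integrable (Function.uncurry fun ω x => Real.exp (-x) * G x (fun i => W i ω))
      (μ.prod (volume.restrict (Set.Ioi 0))) := by
    have h1 : Integrable (fun q : Ω × ℝ => Real.exp (-q.2))
        (μ.prod (volume.restrict (Set.Ioi (0 : ℝ)))) := by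
      have := (integrableOn_exp_neg one_pos).integrable.comp_snd μ
      simpa only [one_mul] using this
    refine h1.mono hjm.aestronglyMeasurable ?_
    refine (Measure.ae_prod_iff_ae_ae (measurableSet_le hjm.norm
      (Real.measurable_exp.comp measurable_snd.neg).norm)).2 ?_
    filter_upwards [hbd] with ω hω
    refine (ae_restrict_iff' measurableSet_Ioi).2 (Eventually.of_forall fun x hx => ?_)
    rw [norm_mul, Real.norm_of_nonneg (hω x hx).1]
    exact mul_le_of_le_one_right (norm_nonneg _) (hω x hx).2
  have hswap := integral_integral_swap hint
  have hrev : ∀ x : ℝ, ∫ ω, G x (fun i => W i ω) ∂μ =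
      ∫ ω, ∏ i ∈ Finset.range n,
        (1 - Real.exp (-(x * W i ω / remaining W (i + 1) ω))) ∂μ := by
    intro x
    have hGx : Measurable (G x) := hGm.comp measurable_prodMk_left
    have hrp : Measurable fun ω i => W (reverseBelow n i) ω := measurable_pi_iff.2 fun i => hWm _
    rw [← integral_map (f := G x) hWp.aemeasurable hGx.aestronglyMeasurable,
      ← map_reindex_eq hWm hWi hWd (reverseBelow_injective n),
      integral_map hrp.aemeasurable hGx.aestronglyMeasurable]
    refine integral_congr_ae ?_
    filter_upwards [ae_goodFactors hW] with ω hω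
    have h := hω.prod_reverse n fun y => 1 - Real.exp (-(x * y))
    simp only [hG]
    rw [h]
    simp only [mul_div_assoc]
    rfl
  rw [measureReal_def, measure_splitsAt hWm hW hX]
  change (∫⁻ ω, ENNReal.ofReal (∫ x in Set.Ioi (0 : ℝ),
    Real.exp (-x) * G x fun i => W i ω) ∂μ).toReal = _
  rw [← integral_eq_lintegral_of_nonneg_ae, hswap]
  · simp only [integral_const_mul, hrev]
  · filter_upwards [hbd] with ω hω
    exact setIntegral_nonneg measurableSet_Ioi fun x hx =>
      mul_nonneg (Real.exp_pos _).le (hω x hx).1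
  · exact hint.integral_prod_left.aestronglyMeasurable

end Sample

/-! ### A criterion for positive recurrence -/

lemma one_sub_sum_le_prod {a : ℕ → ℝ} (h0 : ∀ i, 0 ≤ a i) (h1 : ∀ i, a i ≤ 1) (n : ℕ) :
    1 - ∑ i ∈ Finset.range n, a i ≤ ∏ i ∈ Finset.range n, (1 - a i) := by
  induction n with
  | zero => simp
  | succ n ih =>
    rw [Finset.sum_range_succ, Finset.prod_range_succ]
    have hle : ∏ i ∈ Finset.range n, (1 - a i) ≤ 1 :=
      Finset.prod_le_one (fun i _ => sub_nonneg.2 (h1 i)) fun i _ => by linarith [h0 i]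
    nlinarith [h0 n, mul_le_mul_of_nonneg_right hle (h0 n)]

/-- The partial products of `1 - a i` stay away from zero if the `a i < 1` are summable. -/
lemma exists_pos_le_prod {a : ℕ → ℝ} (h0 : ∀ i, 0 ≤ a i) (h1 : ∀ i, a i < 1) (hs : Summable a) :
    ∃ δ > 0, ∀ n, δ ≤ ∏ i ∈ Finset.range n, (1 - a i) := by
  have htail := (tendsto_sum_nat_add a).eventually (eventually_lt_nhds (b := 1 / 2) (by norm_num))
  obtain ⟨K, hK⟩ := htail.exists
  have hpos : ∀ n, 0 < ∏ i ∈ Finset.range n, (1 - a i) := fun n =>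
    Finset.prod_pos fun i _ => sub_pos.2 (h1 i)
  have hanti : Antitone fun n => ∏ i ∈ Finset.range n, (1 - a i) := by
    refine antitone_nat_of_succ_le fun n => ?_
    rw [Finset.prod_range_succ]
    exact mul_le_of_le_one_right (hpos n).le (by linarith [h0 n])
  refine ⟨(∏ i ∈ Finset.range K, (1 - a i)) * (1 / 2), mul_pos (hpos K) (by norm_num), fun n => ?_⟩
  refine le_trans ?_ (hanti (Nat.le_add_left n K))
  simp only
  rw [Finset.prod_range_add]
  refine mul_le_mul_of_nonneg_left ?_ (hpos K).le
  refine le_trans ?_ (one_sub_sum_le_prod (fun i => h0 (K + i)) (fun i => (h1 (K + i)).le) n)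
  have hsK : Summable fun i => a (K + i) := by
    simpa only [add_comm K] using (summable_nat_add_iff K).2 hs
  have h2 : ∑ i ∈ Finset.range n, a (K + i) ≤ ∑' i, a (i + K) := by
    simp only [add_comm _ K]
    exact hsK.sum_le_tsum _ fun i _ => h0 _
  linarith

lemma exp_mul_le_integral {D : ℝ → ℝ} (hD : ∀ x, 0 < x → D x ∈ Set.Icc (0 : ℝ) 1)
    (hmono : MonotoneOn D (Set.Ioi 0)) {x₀ : ℝ} (hx₀ : 0 < x₀) :
    Real.exp (-x₀) * D x₀ ≤ ∫ x in Set.Ioi (0 : ℝ), Real.exp (-x) * D x := by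
  have hexp : IntegrableOn (fun x : ℝ => Real.exp (-x)) (Set.Ioi 0) := by
    simpa only [one_mul] using integrableOn_exp_neg one_pos
  have hint : IntegrableOn (fun x => Real.exp (-x) * D x) (Set.Ioi 0) := by
    refine Integrable.mono hexp ?_ ?_
    · exact ((by fun_prop : Measurable fun x : ℝ => Real.exp (-x)).aemeasurable.mul
        (aemeasurable_restrict_of_monotoneOn measurableSet_Ioi hmono)).aestronglyMeasurable
    · refine (ae_restrict_iff' measurableSet_Ioi).2 (Eventually.of_forall fun x hx => ?_)
      rw [norm_mul, Real.norm_of_nonneg (hD x hx).1]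
      exact mul_le_of_le_one_right (norm_nonneg _) (hD x hx).2
  have hsub : Set.Ioi x₀ ⊆ Set.Ioi 0 := Set.Ioi_subset_Ioi hx₀.le
  calc Real.exp (-x₀) * D x₀ = ∫ x in Set.Ioi x₀, Real.exp (-x) * D x₀ := by
        rw [integral_mul_const, integral_exp_neg_Ioi]
    _ ≤ ∫ x in Set.Ioi x₀, Real.exp (-x) * D x := by
        refine setIntegral_mono_on ((hexp.mono_set hsub).mul_const _) (hint.mono_set hsub)
          measurableSet_Ioi fun x hx => ?_
        exact mul_le_mul_of_nonneg_left (hmono hx₀ (hsub hx) (le_of_lt hx)) (Real.exp_pos _).le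
    _ ≤ ∫ x in Set.Ioi 0, Real.exp (-x) * D x := by
        refine setIntegral_mono_set hint ?_ hsub.eventuallyLE
        refine (ae_restrict_iff' measurableSet_Ioi).2 (Eventually.of_forall fun x hx => ?_)
        exact mul_nonneg (Real.exp_pos _).le (hD x hx).1

lemma meanBlock_map {Ω : Type*} [MeasurableSpace Ω] {μ : Measure Ω} {Pi : Ω → ℕ → ℕ}
    (hPi : Measurable Pi) : meanBlock Pi μ = meanBlock id (μ.map Pi) :=
  (lintegral_map ((Measurable.of_discrete (f := fun n : ℕ∞ => (n : ℝ≥0∞))).comp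
    measurable_firstSplit) hPi).symm

section Sample

variable {Ω : Type*} [MeasurableSpace Ω] {μ : Measure Ω} [IsProbabilityMeasure μ]

/-- If the exponential terms are summable, the expected products have a positive lower bound. -/
lemma exists_pos_le_lintegral_prod {R : ℕ → Ω → ℝ} (hRm : ∀ i, Measurable (R i))
    (hR : ∀ᵐ ω ∂μ, ∀ i, 0 < R i ω) {x : ℝ} (hx : 0 < x)
    (hs : ∑' i, ∫⁻ ω, ENNReal.ofReal (Real.exp (-(x * R (i + 1) ω))) ∂μ ≠ ∞) :
    ∃ c : ℝ≥0∞, c ≠ 0 ∧ ∀ n, c ≤ ∫⁻ ω, ENNReal.ofReal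
      (∏ i ∈ Finset.range n, (1 - Real.exp (-(x * R i ω)))) ∂μ := by
  have hem : ∀ i, Measurable fun ω => Real.exp (-(x * R i ω)) := fun i =>
    Real.measurable_exp.comp ((hRm i).const_mul x).neg
  have hpm : ∀ n, Measurable fun ω => ENNReal.ofReal
      (∏ i ∈ Finset.range n, (1 - Real.exp (-(x * R i ω)))) := fun n =>
    (Finset.measurable_prod _ fun i _ => measurable_const.sub (hem i)).ennreal_ofReal
  rw [← lintegral_tsum fun i => (hem (i + 1)).ennreal_ofReal.aemeasurable] at hs
  have hfin := ae_lt_top (Measurable.tsum fun i => (hem (i + 1)).ennreal_ofReal) hs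
  refine ⟨∫⁻ ω, ⨅ n, ENNReal.ofReal
    (∏ i ∈ Finset.range n, (1 - Real.exp (-(x * R i ω)))) ∂μ, fun h0 => ?_,
    fun n => lintegral_mono fun ω => iInf_le _ n⟩
  rw [lintegral_eq_zero_iff (Measurable.iInf hpm)] at h0
  have hfalse : ∀ᵐ ω ∂μ, False := by
    filter_upwards [h0, hR, hfin] with ω h1 h2 h3
    have hsum : Summable fun i => Real.exp (-(x * R (i + 1) ω)) := by
      have := ENNReal.summable_toReal h3.ne
      simpa only [ENNReal.toReal_ofReal (Real.exp_pos _).le] using this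
    obtain ⟨δ, hδ, hle⟩ := exists_pos_le_prod (a := fun i => Real.exp (-(x * R i ω)))
      (fun i => (Real.exp_pos _).le)
      (fun i => Real.exp_lt_one_iff.2 (neg_neg_of_pos (mul_pos hx (h2 i))))
      ((summable_nat_add_iff 1).1 hsum)
    have h4 : ENNReal.ofReal δ ≤ ⨅ n, ENNReal.ofReal
        (∏ i ∈ Finset.range n, (1 - Real.exp (-(x * R i ω)))) :=
      le_iInf fun n => ENNReal.ofReal_le_ofReal (hle n)
    rw [h1] at h4
    exact (ENNReal.ofReal_pos.2 hδ).ne' (le_antisymm h4 bot_le)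
  exact hfalse.exists.elim fun _ h => h

variable {W : ℕ → Ω → ℝ} {X : ℕ → Ω → ℕ}

lemma measurable_remaining (hWm : ∀ i, Measurable (W i)) (n : ℕ) : Measurable (remaining W n) :=
  Finset.measurable_prod _ fun j _ => measurable_const.sub (hWm j)

/-- Summability keeps the probabilities of a split away from zero: in the formula for these
probabilities restrict the integral to the range from `x` on, where the products are at least as
large as at `x`. -/
theorem isPositiveRecurrent_of_tsum (hWm : ∀ i, Measurable (W i))
    (hW : ∀ i, ∀ᵐ ω ∂μ, 0 < W i ω ∧ W i ω < 1) (hWi : iIndepFun W μ)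
    (hWd : ∀ i, IdentDistrib (W i) (W 0) μ μ) (hX : IsSampleFrom X (stick W) μ)
    {x : ℝ} (hx : 0 < x) (hs : ∑' i, ∫⁻ ω, ENNReal.ofReal
      (Real.exp (-(x * W (i + 1) ω / remaining W (i + 2) ω))) ∂μ ≠ ∞) :
    IsPositiveRecurrent (biasedPerm X) μ := by
  set R : ℕ → Ω → ℝ := fun i ω => W i ω / remaining W (i + 1) ω with hRdef
  have hRm : ∀ i, Measurable (R i) := fun i => (hWm i).div (measurable_remaining hWm _)
  have hR : ∀ᵐ ω ∂μ, ∀ i, 0 < R i ω := by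
    filter_upwards [ae_goodFactors hW] with ω hω i
    exact div_pos (hω i).1 (hω.restMass_pos (i + 1))
  simp only [mul_div_assoc] at hs
  obtain ⟨c, hc0, hc⟩ := exists_pos_le_lintegral_prod hRm hR hx hs
  set D : ℕ → ℝ → ℝ := fun n x =>
    ∫ ω, ∏ i ∈ Finset.range n, (1 - Real.exp (-(x * R i ω))) ∂μ with hDdef
  have hmem : ∀ n x, 0 < x → ∀ᵐ ω ∂μ,
      ∏ i ∈ Finset.range n, (1 - Real.exp (-(x * R i ω))) ∈ Set.Icc (0 : ℝ) 1 := by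
    intro n x hx
    filter_upwards [hR] with ω hω
    have h := prod_one_sub_exp_mem (p := fun i => R i ω) (A := Finset.range n)
      (fun i _ => (hω i).le) hx.le
    simpa only [mul_comm x] using h
  have hmeas : ∀ n x, Measurable fun ω =>
      ∏ i ∈ Finset.range n, (1 - Real.exp (-(x * R i ω))) := fun n x =>
    Finset.measurable_prod _ fun i _ =>
      measurable_const.sub (Real.measurable_exp.comp ((hRm i).const_mul x).neg)
  have hint : ∀ n x, 0 < x → Integrable (fun ω =>
      ∏ i ∈ Finset.range n, (1 - Real.exp (-(x * R i ω)))) μ := fun n x hx =>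
    Integrable.of_mem_Icc 0 1 (hmeas n x).aemeasurable (hmem n x hx)
  have hD : ∀ n x, 0 < x → D n x ∈ Set.Icc (0 : ℝ) 1 := by
    intro n x hx
    refine ⟨integral_nonneg_of_ae ((hmem n x hx).mono fun ω h => h.1), ?_⟩
    have := integral_mono_ae (hint n x hx) (integrable_const 1) ((hmem n x hx).mono fun ω h => h.2)
    simpa using this
  have hmono : ∀ n, MonotoneOn (D n) (Set.Ioi 0) := by
    intro n x hx y hy hxy
    refine integral_mono_ae (hint n x hx) (hint n y hy) ?_
    filter_upwards [hR] with ω hω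
    refine Finset.prod_le_prod (fun i _ => ?_) fun i _ => ?_
    · rw [sub_nonneg, Real.exp_le_one_iff, neg_nonpos]
      exact mul_nonneg (le_of_lt hx) (hω i).le
    · gcongr
      exact (hω i).le
  have hu : ∀ n, ENNReal.ofReal (Real.exp (-x)) * c ≤ μ {ω | SplitsAt (biasedPerm X ω) n} := by
    intro n
    have h1 := measureReal_splitsAt hWm hW hWi hWd hX n
    simp only [mul_div_assoc] at h1
    have h2 := exp_mul_le_integral (hD n) (hmono n) hx
    rw [← ofReal_measureReal, h1]
    refine le_trans ?_ (ENNReal.ofReal_le_ofReal h2)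
    rw [ENNReal.ofReal_mul (Real.exp_pos _).le]
    gcongr
    rw [hDdef, ofReal_integral_eq_lintegral_ofReal (hint n x hx)
      ((hmem n x hx).mono fun ω h => h.1)]
    exact hc n
  have hPi := measurable_biasedPerm hX.1
  have hlam := isRegenLaw_biasedPerm hWm hW hWi hWd hX
  have h3 := hlam.lintegral_firstSplit_le (c := ENNReal.ofReal (Real.exp (-x)) * c) fun n => by
    rw [Measure.map_apply hPi (measurableSet_splitsAt n)]
    exact hu n
  rw [IsPositiveRecurrent, meanBlock_map hPi]
  refine lt_of_le_of_lt h3 (ENNReal.inv_lt_top.2 (pos_iff_ne_zero.2 (mul_ne_zero ?_ hc0)))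
  exact (ENNReal.ofReal_pos.2 (Real.exp_pos _)).ne'

lemma exp_neg_le_one_div_sqrt {y : ℝ} (hy : 0 < y) : Real.exp (-y) ≤ 1 / √y := by
  rw [Real.exp_neg, inv_eq_one_div]
  refine one_div_le_one_div_of_le (Real.sqrt_pos.2 hy) ?_
  refine le_trans ?_ (Real.add_one_le_exp y)
  nlinarith [Real.sq_sqrt hy.le, sq_nonneg (√y - 1)]

/-- Since `exp (-y) ≤ 1 / √y`, the terms of the series in the criterion are dominated by
`E √(1 - W₁) ⋯ √(1 - Wᵢ₋₁) / √Wᵢ`, which decays geometrically. -/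
theorem isPositiveRecurrent_of_lintegral (hWm : ∀ i, Measurable (W i))
    (hW : ∀ i, ∀ᵐ ω ∂μ, 0 < W i ω ∧ W i ω < 1) (hWi : iIndepFun W μ)
    (hWd : ∀ i, IdentDistrib (W i) (W 0) μ μ) (hX : IsSampleFrom X (stick W) μ)
    (hC : ∫⁻ ω, ENNReal.ofReal (1 / √(W 0 ω)) ∂μ ≠ ∞) :
    IsPositiveRecurrent (biasedPerm X) μ := by
  refine isPositiveRecurrent_of_tsum hWm hW hWi hWd hX one_pos ?_
  set f : ℝ → ℝ≥0∞ := fun w => ENNReal.ofReal √(1 - w) with hf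
  set g : ℝ → ℝ≥0∞ := fun w => ENNReal.ofReal (1 / √w) with hg
  have hfm : Measurable f := by fun_prop
  have hgm : Measurable g := by fun_prop
  set r := ∫⁻ ω, f (W 0 ω) ∂μ with hr
  have hr1 : r < 1 := by
    have h := lintegral_strict_mono (μ := μ) (f := fun ω => f (W 0 ω)) (g := fun _ => 1)
      (IsProbabilityMeasure.ne_zero μ) aemeasurable_const ?_ ?_
    · simpa using h
    · refine ne_top_of_le_ne_top (b := ∫⁻ _, 1 ∂μ) (by simp) (lintegral_mono_ae ?_)
      filter_upwards [hW 0] with ω hω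
      exact ENNReal.ofReal_le_one.2 (Real.sqrt_le_one.2 (by linarith))
    · filter_upwards [hW 0] with ω hω
      refine ENNReal.ofReal_lt_one.2 ?_
      rw [Real.sqrt_lt' one_pos]; linarith
  have hterm : ∀ i, ∫⁻ ω, ENNReal.ofReal (Real.exp (-(1 * W i ω / remaining W (i + 1) ω))) ∂μ ≤
      r ^ i * ∫⁻ ω, g (W 0 ω) ∂μ := by
    intro i
    set h : ℕ → ℝ → ℝ≥0∞ := fun j => if j = i then g else f with hh
    have hhm : ∀ j, Measurable (h j) := fun j => by
      simp only [hh]; split_ifs <;> assumption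
    have hprod : ∀ ω, ∏ j ∈ Finset.range (i + 1), h j (W j ω) =
        (∏ j ∈ Finset.range i, f (W j ω)) * g (W i ω) := by
      intro ω
      rw [Finset.prod_range_succ]
      congr 1
      · refine Finset.prod_congr rfl fun j hj => ?_
        simp only [hh]; rw [if_neg (Finset.mem_range.1 hj).ne]
      · simp only [hh, if_true]
    have hid : ∀ j (k : ℝ → ℝ≥0∞), Measurable k → ∫⁻ ω, k (W j ω) ∂μ = ∫⁻ ω, k (W 0 ω) ∂μ :=
      fun j k hk => ((hWd j).comp hk).lintegral_eq
    calc _ ≤ ∫⁻ ω, ∏ j ∈ Finset.range (i + 1), (h j ∘ W j) ω ∂μ := by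
          refine lintegral_mono_ae ?_
          filter_upwards [ae_goodFactors hW] with ω hω
          have hwi := hω i
          have hT := hω.restMass_pos i
          simp only [Function.comp_apply]
          rw [hprod ω, hf, hg, ← ENNReal.ofReal_prod_of_nonneg fun j _ => Real.sqrt_nonneg _,
            ← ENNReal.ofReal_mul (Finset.prod_nonneg fun j _ => Real.sqrt_nonneg _), one_mul]
          refine ENNReal.ofReal_le_ofReal ?_
          have hrem : remaining W (i + 1) ω = remaining W i ω * (1 - W i ω) :=
            Finset.prod_range_succ _ _
          have hT' : 0 < remaining W i ω := hT
          have hT1 : 0 < remaining W (i + 1) ω := hω.restMass_pos (i + 1)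
          refine (exp_neg_le_one_div_sqrt (div_pos hwi.1 hT1)).trans ?_
          have hsq : ∏ j ∈ Finset.range i, √(1 - W j ω) = √(remaining W i ω) := by
            rw [remaining, Real.sqrt_prod _ fun j _ => (sub_pos.2 (hω j).2).le]
          rw [hsq, Real.sqrt_div hwi.1.le, one_div_div, mul_one_div]
          refine div_le_div_of_nonneg_right ?_ (Real.sqrt_nonneg _)
          refine Real.sqrt_le_sqrt ?_
          rw [hrem]
          exact mul_le_of_le_one_right hT'.le (by linarith)
      _ = ∏ j ∈ Finset.range (i + 1), ∫⁻ ω, (h j ∘ W j) ω ∂μ :=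
          lintegral_prod_eq_prod_lintegral_of_indepFun _ _ (hWi.comp h hhm)
            fun j => (hhm j).comp (hWm j)
      _ = r ^ i * ∫⁻ ω, g (W 0 ω) ∂μ := by
          rw [Finset.prod_range_succ]
          congr 1
          · rw [← Finset.card_range i, ← Finset.prod_const, Finset.card_range]
            refine Finset.prod_congr rfl fun j hj => ?_
            simp only [hh, Function.comp_apply]
            rw [if_neg (Finset.mem_range.1 hj).ne, hid j f hfm]
          · simp only [hh, Function.comp_apply, if_true]
            exact hid i g hgm
  refine ne_top_of_le_ne_top ?_ (ENNReal.tsum_le_tsum fun i => hterm (i + 1))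
  rw [ENNReal.tsum_mul_right, ENNReal.tsum_geometric_add_one]
  refine ENNReal.mul_ne_top (ENNReal.mul_ne_top hr1.ne_top ?_) hC
  exact ENNReal.inv_ne_top.2 (tsub_pos_of_lt hr1).ne'

end Sample

lemma lintegral_one_div_sqrt_betaMeasure_ne_top {θ : ℝ} (hθ : 0 < θ) :
    ∫⁻ w, ENNReal.ofReal (1 / √w) ∂(betaMeasure 1 θ) ≠ ∞ := by
  have hb := beta_pos one_pos hθ
  have hb' := beta_pos one_half_pos hθ
  have hm : Measurable fun w : ℝ => ENNReal.ofReal (1 / √w) := by fun_prop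
  have hpdf : ∀ a, Measurable (betaPDF a θ) := fun a =>
    (measurable_betaPDFReal a θ).ennreal_ofReal
  rw [betaMeasure, lintegral_withDensity_eq_lintegral_mul _ (hpdf 1) hm]
  -- The integrand is a multiple of the density of the beta distribution with parameters `1/2`, `θ`.
  have e : ∀ w, (betaPDF 1 θ * fun w : ℝ => ENNReal.ofReal (1 / √w)) w =
      ENNReal.ofReal (beta (1 / 2) θ / beta 1 θ) * betaPDF (1 / 2) θ w := by
    intro w
    rw [Pi.mul_apply, betaPDF_eq, betaPDF_eq]
    split_ifs with h
    · rw [← ENNReal.ofReal_mul (div_pos hb' hb).le, ← ENNReal.ofReal_mul]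
      · congr 1
        have h1 : w ^ ((1 : ℝ) / 2 - 1) = 1 / √w := by
          rw [Real.sqrt_eq_rpow, one_div (w ^ _), ← Real.rpow_neg h.1.le]; norm_num
        rw [h1, sub_self, Real.rpow_zero]
        field_simp
      · exact mul_nonneg (mul_nonneg (one_div_pos.2 hb).le (Real.rpow_nonneg h.1.le _))
          (Real.rpow_nonneg (by linarith) _)
    · simp
  rw [lintegral_congr e, lintegral_const_mul _ (hpdf _), lintegral_betaPDF_eq_one one_half_pos hθ,
    mul_one]
  exact ENNReal.ofReal_ne_top

/-! ### Transfer from the law to the random permutation -/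

section Transfer

variable {Ω : Type*} [MeasurableSpace Ω] {μ : Measure Ω} {Pi : Ω → ℕ → ℕ}

lemma meanCycles_map (hPi : Measurable Pi) (h : IsRegenLaw (μ.map Pi))
    (htop : ∀ᵐ π ∂(μ.map Pi), firstSplit π ≠ ⊤) {j : ℕ} (hj : 1 ≤ j) :
    meanCycles Pi μ j = meanCycles id (μ.map Pi) j := by
  have hae : (fun π : ℕ → ℕ => (cycleCount π (firstSplit π).toNat j : ℝ≥0∞)) =ᵐ[μ.map Pi]
      fun π => ((blockCyclePoints j π / j : ℕ) : ℝ≥0∞) := by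
    filter_upwards [htop, h.bijective] with π hπ hb
    rw [blockCyclePoints, ← (splitsAt_firstSplit hπ).mul_cycleCount hb.injective j,
      Nat.mul_div_cancel_left _ hj]
  have hm : Measurable fun π => ((blockCyclePoints j π / j : ℕ) : ℝ≥0∞) :=
    (Measurable.of_discrete (f := fun n : ℕ => ((n / j : ℕ) : ℝ≥0∞))).comp
      (measurable_blockCyclePoints j)
  exact (lintegral_map' ⟨_, hm, hae⟩ hPi.aemeasurable).symm

lemma IsRegenLaw.hasCycleFrequencies (hPi : Measurable Pi) (h : IsRegenLaw (μ.map Pi))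
    (hfin : IsPositiveRecurrent Pi μ) : HasCycleFrequencies Pi μ := by
  rw [IsPositiveRecurrent, meanBlock_map hPi] at hfin
  have htop := ae_firstSplit_ne_top hfin
  refine ⟨fun j hj => ?_, ?_⟩
  · rw [meanBlock_map hPi, meanCycles_map hPi h htop hj]
    exact ae_of_ae_map hPi.aemeasurable (h.ae_tendsto_cycleCount hfin hj)
  · rw [meanBlock_map hPi]
    refine Eq.trans (tsum_congr fun j => ?_) (h.tsum_mul_lintegral_cycleCount htop)
    rcases Nat.eq_zero_or_pos j with rfl | hj
    · simp
    · rw [meanCycles_map hPi h htop hj]; rfl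

lemma IsRegenLaw.allBlocksFinite (hPi : Measurable Pi) (h : IsRegenLaw (μ.map Pi))
    (hfin : IsPositiveRecurrent Pi μ) : AllBlocksFinite Pi μ := by
  rw [IsPositiveRecurrent, meanBlock_map hPi] at hfin
  exact ae_of_ae_map hPi.aemeasurable (h.ae_exists_splitsAt_gt (ae_firstSplit_ne_top hfin))

lemma IsRegenLaw.exists_isStationaryVersion (hPi : Measurable Pi) (h : IsRegenLaw (μ.map Pi))
    (hfin : IsPositiveRecurrent Pi μ) : ∃ Q : Measure (ℤ → ℤ), IsStationaryVersion Q Pi μ := by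
  rw [IsPositiveRecurrent, meanBlock_map hPi] at hfin
  obtain ⟨Q, hQ⟩ := h.exists_stationary hfin
  refine ⟨Q, hQ.prob, hQ.bijective, hQ.stationary, hQ.unbounded, fun z => ?_, fun z => ?_,
    hQ.residual_indep⟩
  · rw [meanBlock_map hPi]; exact hQ.density z
  · rw [hQ.residual_law z, Measure.map_id]

end Transfer

end RegenPerm

theorem mainTheorem3 {Ω : Type*} [MeasurableSpace Ω] (μ : Measure Ω) [IsProbabilityMeasure μ]
    (W : ℕ → Ω → ℝ) (hWm : ∀ i, Measurable (W i)) (hW : ∀ i, ∀ᵐ ω ∂μ, 0 < W i ω ∧ W i ω < 1)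
    (hWindep : iIndepFun W μ) (hWident : ∀ i, IdentDistrib (W i) (W 0) μ μ)
    (X : ℕ → Ω → ℕ) (hX : RegenPerm.IsSampleFrom X (RegenPerm.stick W) μ) :
    RegenPerm.IsStrictlyRegenerative (RegenPerm.biasedPerm X) μ ∧
    (∀ n : ℕ, μ.real {ω | RegenPerm.SplitsAt (RegenPerm.biasedPerm X ω) n} =
      ∫ x in Set.Ioi (0 : ℝ), Real.exp (-x) *
        ∫ ω, ∏ i ∈ Finset.range n,
          (1 - Real.exp (-(x * W i ω / RegenPerm.remaining W (i + 1) ω))) ∂μ) ∧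
    ((∃ x : ℝ, 0 < x ∧ Summable (fun i : ℕ =>
        ∫ ω, Real.exp (-(x * W (i + 1) ω / RegenPerm.remaining W (i + 2) ω)) ∂μ)) →
      RegenPerm.IsPositiveRecurrent (RegenPerm.biasedPerm X) μ) ∧
    (((∃ q : ℝ, 0 < q ∧ q < 1 ∧ ∀ i, ∀ᵐ ω ∂μ, W i ω = 1 - q) ∨
        (∃ θ : ℝ, 0 < θ ∧ ∀ i, μ.map (W i) = betaMeasure 1 θ)) →
      RegenPerm.IsPositiveRecurrent (RegenPerm.biasedPerm X) μ ∧
      RegenPerm.AllBlocksFinite (RegenPerm.biasedPerm X) μ ∧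
      RegenPerm.HasCycleFrequencies (RegenPerm.biasedPerm X) μ ∧
      ∃ Q : Measure (ℤ → ℤ),
        RegenPerm.IsStationaryVersion Q (RegenPerm.biasedPerm X) μ) := by
  have hPi := RegenPerm.measurable_biasedPerm hX.1
  have hlam := RegenPerm.isRegenLaw_biasedPerm hWm hW hWindep hWident hX
  refine ⟨hlam.isStrictlyRegenerative hPi,
    RegenPerm.measureReal_splitsAt hWm hW hWindep hWident hX, ?_, ?_⟩
  · rintro ⟨x, hx, hs⟩
    refine RegenPerm.isPositiveRecurrent_of_tsum hWm hW hWindep hWident hX hx ?_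
    have hint : ∀ i, Integrable (fun ω =>
        Real.exp (-(x * W (i + 1) ω / RegenPerm.remaining W (i + 2) ω))) μ := by
      intro i
      refine Integrable.of_mem_Icc 0 1 (Real.measurable_exp.comp (((hWm (i + 1)).const_mul x).div
        (RegenPerm.measurable_remaining hWm (i + 2))).neg).aemeasurable ?_
      filter_upwards [RegenPerm.ae_goodFactors hW] with ω hω
      refine ⟨(Real.exp_pos _).le, Real.exp_le_one_iff.2 (neg_nonpos.2 ?_)⟩
      exact div_nonneg (mul_nonneg hx.le (hω (i + 1)).1.le) (hω.restMass_pos (i + 2)).le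
    have hpos : ∀ i, 0 ≤ ∫ ω,
        Real.exp (-(x * W (i + 1) ω / RegenPerm.remaining W (i + 2) ω)) ∂μ :=
      fun i => integral_nonneg fun ω => (Real.exp_pos _).le
    simp only [← ofReal_integral_eq_lintegral_ofReal (hint _)
      (Eventually.of_forall fun ω => (Real.exp_pos _).le)]
    rw [← ENNReal.ofReal_tsum_of_nonneg hpos hs]
    exact ENNReal.ofReal_ne_top
  · intro hcases
    have hrec : RegenPerm.IsPositiveRecurrent (RegenPerm.biasedPerm X) μ := by
      refine RegenPerm.isPositiveRecurrent_of_lintegral hWm hW hWindep hWident hX ?_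
      rcases hcases with ⟨q, -, -, hq⟩ | ⟨θ, hθ, hβ⟩
      · have hc : (fun ω => ENNReal.ofReal (1 / √(W 0 ω))) =ᵐ[μ]
            fun _ => ENNReal.ofReal (1 / √(1 - q)) := by
          filter_upwards [hq 0] with ω hω
          rw [hω]
        rw [lintegral_congr_ae hc, lintegral_const, measure_univ, mul_one]
        exact ENNReal.ofReal_ne_top
      · have hm : Measurable fun w : ℝ => ENNReal.ofReal (1 / √w) := by fun_prop
        rw [← lintegral_map hm (hWm 0), hβ 0]
        exact RegenPerm.lintegral_one_div_sqrt_betaMeasure_ne_top hθ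
    exact ⟨hrec, hlam.allBlocksFinite hPi hrec, hlam.hasCycleFrequencies hPi hrec,
      hlam.exists_isStationaryVersion hPi hrec⟩
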